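/- Let $0<\beta\le 1$ and let $G=(G(x))_{x\in\mathbb R}$ be a centered stationary Gaussian random field with almost surely continuous realizations and covariance function $\mathcal C$, i.e. $\mathbb E[G(x)G(y)]=\mathcal C(x-y)$, where $\mathcal C$ is Hölder continuous at $0$ and $|\mathcal C(x)|\le M(1+|x|)^{-\beta}$ for some $M$ and all $x\in\mathbb R$. Assume $G\not\equiv0$ and set $a(x)=e^{G(x)}$. Let $\gamma:[0,\infty)\to[0,\infty)$ be bounded with $\lim_{t\downarrow0}\gamma(t)=0$. Assume asymptotic homogeneity of $\mathcal C$: * if $\beta=1$, there is $\bar{\mathcal C}\in\mathbb R$ such that $\big|\frac1{\log L}\int_{-L}^L\mathcal C(x)\,dx-\bar{\mathcal C}\big|\le\gamma(\tfrac1L)$ for all sufficiently large $L$; * if $0<\beta<1$, $\gamma$ is nondecreasing on $(0,\infty)$ and there are $\bar{\mathcal C}^+,\bar{\mathcal C}^-\in\mathbb R$ such that $|x^\beta\mathcal C(\pm x)-\bar{\mathcal C}^{\pm}|\le\gamma(\tfrac1x)$ for all $x>0$. Let $f,g\in C^1([0,1])$. For $\varepsilon\in(0,1)$ let $u_\varepsilon\in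 C^1([0,1])$ be the (almost surely unique) solution of $$\big(a(\tfrac x\varepsilon)u_\varepsilon'(x)\big)'=f'(x)\ \text{ on }(0,1),\qquad u_\varepsilon(0)=u_\varepsilon(1)=0,$$ and let $v_\varepsilon$ be the solution of the same problem with $f$ replaced by $g$. Then almost surely $I_\varepsilon(f,g):=\int_0^1u_\varepsilon'g=\int_0^1v_\varepsilon'f$, and $I_\varepsilon(f,g)$ is square integrable. Set $\sigma_\varepsilon(f,g):=\pi_\beta(\varepsilon)^{-1}\sqrt{\operatorname{Var}[I_\varepsilon(f,g)]}$ with $\pi_\beta(\varepsilon)=\varepsilon^{\beta/2}$ if $\beta<1$ and $\pi_1(\varepsilon)=\sqrt\varepsilon\,|\log\varepsilon|^{1/2}$. Then there is a constant $K<\infty$, independent of $\varepsilon$, such that for all $\varepsilon\in(0,1)$ $$|\sigma_\varepsilon(f,g)^2-\sigma(f,g)^2|\le K\,\Pi_\beta(\varepsilon),$$ where $$\Pi_\beta(\varepsilon)=\begin{cases}\varepsilon^{\beta\wedge(1-\beta)}+\inf_{\delta\in(0,1]}\big(\delta^{1-\beta}+\gamma(\delta^{-1}\varepsilon)\big),&0<\beta<1,\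 \beta\ne\frac12,\\ \varepsilon^{1/2}|\log\varepsilon|+\inf_{\delta\in(0,1]}\big(\delta^{1-\beta}+\gamma(\delta^{-1}\varepsilon)\big),&\beta=\frac12,\\ |\log\varepsilon|^{-1}+\gamma(\varepsilon),&\beta=1,\end{cases}$$ and $\sigma(f,g)^2:=\mathcal Q_\beta\big((f-\bar f)(g-\bar g)\big)$ with $\bar f=\int_0^1f$, $\bar g=\int_0^1g$ and $$\mathcal Q_\beta(h)=e^{\mathcal C(0)}\begin{cases}\int_0^1\int_0^1h(x)\,\bar{\mathcal C}^{\operatorname{sign}(x-y)}|x-y|^{-\beta}\,h(y)\,dx\,dy,&0<\beta<1,\\ \bar{\mathcal C}\int_0^1h(x)^2\,dx,&\beta=1.\end{cases}$$ -/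

import Mathlib

open MeasureTheory ProbabilityTheory Filter Topology Set

namespace LogNormalHomog

noncomputable section

/-- `G` is a centered stationary Gaussian random field on `ℝ` with covariance function `C`
(so that `E[G(x) G(y)] = C (x - y)`) and almost surely continuous realizations. -/
structure IsStationaryGaussianField {Ω : Type*} [MeasurableSpace Ω] (P : Measure Ω)
    (G : ℝ → Ω → ℝ) (C : ℝ → ℝ) : Prop where
  gaussian : IsGaussianProcess G P
  mean_zero : ∀ x, ∫ ω, G x ω ∂P = 0
  covariance_eq : ∀ x y, cov[G x, G y; P] = C (x - y)
  continuous_paths : ∀ᵐ ω ∂P, Continuous fun x => G x ω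

/-- Hölder continuity of `C` at the origin. -/
def HolderAtZero (C : ℝ → ℝ) : Prop :=
  ∃ α M r : ℝ, 0 < α ∧ 0 < r ∧ ∀ x, |x| ≤ r → |C x - C 0| ≤ M * |x| ^ α

/-- The decay `|C(x)| ≲ (1 + |x|)^{-β}`. -/
def DecaysWithExponent (C : ℝ → ℝ) (β : ℝ) : Prop :=
  ∃ M : ℝ, ∀ x, |C x| ≤ M * (1 + |x|) ^ (-β)

/-- `γ : [0, ∞) → [0, ∞)` is bounded and tends to `0` at `0`. -/
structure IsRate (γ : ℝ → ℝ) : Prop where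
  nonneg : ∀ t, 0 ≤ t → 0 ≤ γ t
  bounded : ∃ M : ℝ, ∀ t, 0 ≤ t → γ t ≤ M
  tendsto_zero : Tendsto γ (𝓝[>] 0) (𝓝 0)

/-- Asymptotic homogeneity of `C` with rate `γ`. The constant `Cbar` is relevant for `β = 1` only,
the constants `Cplus`, `Cminus` for `β < 1` only. -/
structure AsymptoticallyHomogeneous (β : ℝ) (C γ : ℝ → ℝ) (Cbar Cplus Cminus : ℝ) : Prop where
  rate : IsRate γ
  eq_one : β = 1 → ∀ᶠ L : ℝ in atTop,
    |1 / Real.log L * (∫ x in (-L)..L, C x) - Cbar| ≤ γ (1 / L)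
  lt_one : β < 1 → ∀ x : ℝ, 0 < x →
    |x ^ β * C x - Cplus| ≤ γ (1 / x) ∧ |x ^ β * C (-x) - Cminus| ≤ γ (1 / x)
  mono : β < 1 → MonotoneOn γ (Ioi 0)

/-- `u ∈ C¹([0,1])` solves `(a(x/ε) u'(x))' = f'(x)` on `(0,1)` with `u(0) = u(1) = 0`. -/
structure IsSolution (a : ℝ → ℝ) (ε : ℝ) (f u : ℝ → ℝ) : Prop where
  contDiffOn : ContDiffOn ℝ 1 u (Icc 0 1)
  equation : ∀ x ∈ Ioo (0 : ℝ) 1, HasDerivAt (fun y => a (y / ε) * deriv u y) (deriv f x) x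
  left : u 0 = 0
  right : u 1 = 0

/-- `∫₀¹ u'(x) g(x) dx`. -/
def gradAverage (u g : ℝ → ℝ) : ℝ := ∫ x in (0 : ℝ)..1, deriv u x * g x

/-- The fluctuation scaling `π_β(ε)` for `0 < β ≤ 1`. -/
def piRate (β ε : ℝ) : ℝ :=
  if β < 1 then ε ^ (β / 2) else √ε * |Real.log ε| ^ (1 / 2 : ℝ)

/-- `σ_ε = π_β(ε)⁻¹ √Var[I]`. -/
def sigmaEps {Ω : Type*} [MeasurableSpace Ω] (P : Measure Ω) (β ε : ℝ) (I : Ω → ℝ) : ℝ :=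
  (piRate β ε)⁻¹ * √(Var[I; P])

/-- `inf_{δ ∈ (0,1]} (δ^{1-β} + γ(δ⁻¹ ε))`. -/
def infTerm (β : ℝ) (γ : ℝ → ℝ) (ε : ℝ) : ℝ :=
  sInf ((fun δ : ℝ => δ ^ (1 - β) + γ (δ⁻¹ * ε)) '' Ioc 0 1)

/-- The convergence rate `Π_β(ε)` for `0 < β ≤ 1`. -/
def PiRate (β : ℝ) (γ : ℝ → ℝ) (ε : ℝ) : ℝ :=
  if β = 1 then |Real.log ε|⁻¹ + γ ε
  else if β = 1 / 2 then ε ^ (1 / 2 : ℝ) * |Real.log ε| + infTerm β γ ε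
  else ε ^ (min β (1 - β)) + infTerm β γ ε

/-- The quadratic form `Q_β` for `0 < β ≤ 1`; the kernel for `β < 1` is
`C̄^{sign(x-y)} |x-y|^{-β}`, the diagonal being negligible. -/
def quadForm (β C₀ Cbar Cplus Cminus : ℝ) (h : ℝ → ℝ) : ℝ :=
  Real.exp C₀ *
    if β < 1 then
      ∫ x in (0 : ℝ)..1, ∫ y in (0 : ℝ)..1,
        h x * ((if y < x then Cplus else Cminus) * |x - y| ^ (-β)) * h y
    else Cbar * ∫ x in (0 : ℝ)..1, h x ^ 2

/-- `f - f̄` with `f̄ = ∫₀¹ f`. -/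
def centered (f : ℝ → ℝ) (x : ℝ) : ℝ := f x - ∫ y in (0 : ℝ)..1, f y

/-- The limiting variance `σ(f,g)² = Q_β((f - f̄)(g - ḡ))`. -/
def sigmaSq (β C₀ Cbar Cplus Cminus : ℝ) (f g : ℝ → ℝ) : ℝ :=
  quadForm β C₀ Cbar Cplus Cminus fun x => centered f x * centered g x

end

end LogNormalHomog

/-! Write `w = exp (-G(·/ε))`, and let `F`, `Γ` be the centred data. Integrating the equation once
gives `u' = (F + c) w` with `c` fixed by the boundary values, hence `I = ∫ F Γ w - (∫ F w)(∫ Γ w) /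
∫ w` (`IsSolution.gradAverage_eq`), which is symmetric in `F` and `Γ`. Split `w` into its mean `m =
exp (C 0 / 2)` and its fluctuation. Since `F` and `Γ` have mean zero, `I = const + X - A Z / (m +
Y)` with `X`, `A`, `Z`, `Y` linear in the fluctuation, so the last term is of second order.

Let `S` bound the integral in `y` of `(1 + |x - y| / ε)^{-β}`; it can be taken of order `ε^β`, or `ε
(1 + |log ε|)` if `β = 1`. Joint moments of the fluctuation are sums over graphs without isolated
vertices, with edge weights `exp C - 1`. Fourth moments are dominated by perfect matchings and are
`O(S²)`. The third moment of `X`, `A`, `Z` is also `O(S²)`, because a graph on three vertices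
without isolated ones has at least two edges; Hölder's inequality would only give `S^{3/2}`, which
is too weak for the claimed rate. With these bounds `variance_sub_ratio` yields `Var I = E X² +
O(S²)` (`variance_approx`).

The rest is deterministic. With `h = F Γ`, `E X²` is `exp (C 0)` times the double integral of `h(x)
h(y) (exp C - 1)`. Replacing `exp C - 1` by `C` costs an integral of `(1 + z / ε)^{-2β}`
(`integral_exp_cov_sub_le`), which is the source of the different regimes around `β = 1/2`. The
linear term is compared with its limit by cutting at distance `δ` from the diagonal if `β < 1`
(`leading_order_of_lt`), and, if `β = 1`, by freezing `h(x) h(y)` on the diagonal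
(`leading_order_of_eq`).

The bound must hold for every `ε` in `(0, 1)`, not only for small ones. At `β = 1/2` this requires
that `γ` does not vanish identically on the positive axis, which follows from `C 0 > 0`
(`exists_rate_pos`, `exists_le_infTerm`). -/

namespace LogNormalHomog

/-! ### A jointly measurable version of the field -/

/-- A field with almost surely continuous realizations has a jointly measurable version
with continuous realizations. -/
lemma IsStationaryGaussianField.exists_measurable_version {Ω : Type*} [MeasurableSpace Ω]
    {P : Measure Ω} {G : ℝ → Ω → ℝ} {C : ℝ → ℝ} (hG : IsStationaryGaussianField P G C) :
    ∃ H : ℝ → Ω → ℝ, Measurable (Function.uncurry H) ∧ (∀ ω, Continuous fun x => H x ω) ∧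
      (∀ᵐ ω ∂P, ∀ x, G x ω = H x ω) ∧ IsStationaryGaussianField P H C := by
  classical
  have hm := fun q : ℚ => hG.gaussian.aemeasurable (q : ℝ)
  have hae : ∀ᵐ ω ∂P, (Continuous fun x => G x ω) ∧ ∀ q : ℚ, G q ω = (hm q).mk _ ω :=
    hG.continuous_paths.and (ae_all_iff.2 fun q => (hm q).ae_eq_mk)
  -- The exceptional set need not be measurable; cutting off on a measurable null superset keeps
  -- every rational slice measurable.
  obtain ⟨N, hNsub, hNm, hN0⟩ := exists_measurable_superset_of_null (ae_iff.1 hae)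
  have hgood : ∀ ω, ω ∉ N → (Continuous fun x => G x ω) ∧ ∀ q : ℚ, G q ω = (hm q).mk _ ω := by
    intro ω hω
    by_contra h
    exact hω (hNsub h)
  let H : ℝ → Ω → ℝ := fun x ω => if ω ∈ N then 0 else G x ω
  have hHc : ∀ ω, Continuous fun x => H x ω := by
    intro ω
    by_cases h : ω ∈ N
    · simpa [H, h] using continuous_const
    · simpa [H, h] using (hgood ω h).1
  have hHq : ∀ q : ℚ, Measurable (H q) := by
    intro q
    have : H q = fun ω => if ω ∈ N then 0 else (hm q).mk _ ω := by
      funext ω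
      by_cases h : ω ∈ N
      · simp [H, h]
      · simp [H, h, (hgood ω h).2 q]
    rw [this]
    exact Measurable.ite hNm measurable_const (hm q).measurable_mk
  have hHx : ∀ x, Measurable (H x) := by
    intro x
    obtain ⟨w, hw⟩ : ∃ w : ℕ → ℚ, Tendsto (fun n => (w n : ℝ)) atTop (𝓝 x) := by
      obtain ⟨w, hw1, hw2⟩ := mem_closure_iff_seq_limit.1 (Rat.denseRange_cast (𝕜 := ℝ) x)
      choose v hv using hw1
      exact ⟨v, by simpa [hv] using hw2⟩
    refine measurable_of_tendsto_metrizable (fun n => hHq (w n)) ?_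
    rw [tendsto_pi_nhds]
    intro ω
    exact ((hHc ω).tendsto x).comp hw
  have hGH : ∀ᵐ ω ∂P, ∀ x, G x ω = H x ω := by
    filter_upwards [measure_eq_zero_iff_ae_notMem.1 hN0] with ω hω x
    simp [H, hω]
  have hGHx : ∀ x, G x =ᵐ[P] H x := fun x => hGH.mono fun ω h => h x
  refine ⟨H, ?_, hHc, hGH, ?_⟩
  · exact measurable_uncurry_of_continuous_of_measurable hHc hHx
  · refine ⟨hG.gaussian.congr hGHx, fun x => ?_, fun x y => ?_, ae_of_all _ hHc⟩
    · rw [← hG.mean_zero x]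
      exact integral_congr_ae (hGHx x).symm
    · rw [← hG.covariance_eq x y]
      simp only [covariance, integral_congr_ae (hGHx x), integral_congr_ae (hGHx y)]
      refine integral_congr_ae ?_
      filter_upwards [hGH] with ω h
      rw [h x, h y]

/-! ### Moments of `exp (-G)` and of its fluctuation -/

section Moments

variable {Ω : Type*} [MeasurableSpace Ω] {P : Measure Ω} {G : ℝ → Ω → ℝ} {C : ℝ → ℝ}

lemma IsStationaryGaussianField.even (hG : IsStationaryGaussianField P G C) (x : ℝ) :
    C (-x) = C x := by
  have h1 := hG.covariance_eq 0 x
  have h2 := hG.covariance_eq x 0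
  rw [covariance_comm] at h1
  simp only [zero_sub, sub_zero] at h1 h2
  rw [← h1, ← h2]

lemma IsStationaryGaussianField.cov_comm (hG : IsStationaryGaussianField P G C) (x y : ℝ) :
    C (y - x) = C (x - y) := by
  rw [← hG.even (x - y), neg_sub]

/-- Exponential moments of linear combinations of the field. -/
lemma IsStationaryGaussianField.exp_neg_sum (hG : IsStationaryGaussianField P G C)
    {ι : Type*} (s : Finset ι) (x : ι → ℝ) :
    Integrable (fun ω => Real.exp (-∑ i ∈ s, G (x i) ω)) P ∧
      ∫ ω, Real.exp (-∑ i ∈ s, G (x i) ω) ∂P =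
        Real.exp ((∑ i ∈ s, ∑ j ∈ s, C (x i - x j)) / 2) := by
  have hP := hG.gaussian.isProbabilityMeasure
  have hL := (hG.gaussian.comp_right x).hasGaussianLaw_fun_sum (I := s)
  have hmap := hL.map_eq_gaussianReal
  have hmem : ∀ i ∈ s, MemLp (fun ω => G (x i) ω) 2 P := fun i _ =>
    (hG.gaussian.hasGaussianLaw_eval (x i)).memLp_two
  have hmean : ∫ ω, ∑ i ∈ s, (G ∘ x) i ω ∂P = 0 := by
    rw [integral_finsetSum]
    · exact Finset.sum_eq_zero fun i _ => hG.mean_zero (x i)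
    · exact fun i hi => (hmem i hi).integrable one_le_two
  have hvar : Var[fun ω => ∑ i ∈ s, (G ∘ x) i ω; P] = ∑ i ∈ s, ∑ j ∈ s, C (x i - x j) := by
    refine (variance_fun_sum' hmem).trans ?_
    exact Finset.sum_congr rfl fun i _ => Finset.sum_congr rfl fun j _ =>
      hG.covariance_eq (x i) (x j)
  rw [hmean] at hmap
  have hmgf := mgf_gaussianReal hmap (-1)
  have hval : ∫ ω, Real.exp (-∑ i ∈ s, G (x i) ω) ∂P =
      Real.exp ((∑ i ∈ s, ∑ j ∈ s, C (x i - x j)) / 2) := by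
    simp only [mgf, neg_one_mul] at hmgf
    refine hmgf.trans ?_
    rw [← hvar, Real.coe_toNNReal _ (variance_nonneg _ _)]
    congr 1
    ring
  refine ⟨?_, hval⟩
  -- The integral of a non-integrable function is `0` by convention, whereas the value just computed
  -- is positive.
  by_contra h
  have := integral_undef h
  rw [hval] at this
  exact (Real.exp_pos _).ne' this

/-- The fluctuation of the inverse coefficient `exp (-G)` around its mean. -/
noncomputable def fluct (G : ℝ → Ω → ℝ) (C : ℝ → ℝ) (x : ℝ) (ω : Ω) : ℝ :=
  Real.exp (-G x ω) - Real.exp (C 0 / 2)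

lemma IsStationaryGaussianField.exp_one (hG : IsStationaryGaussianField P G C) (x : ℝ) :
    Integrable (fun ω => Real.exp (-G x ω)) P ∧
      ∫ ω, Real.exp (-G x ω) ∂P = Real.exp (C 0 / 2) := by
  simpa using hG.exp_neg_sum Finset.univ ![x]

lemma IsStationaryGaussianField.exp_two (hG : IsStationaryGaussianField P G C) (x y : ℝ) :
    Integrable (fun ω => Real.exp (-G x ω) * Real.exp (-G y ω)) P ∧
      ∫ ω, Real.exp (-G x ω) * Real.exp (-G y ω) ∂P =
        Real.exp (C 0 / 2) ^ 2 * Real.exp (C (x - y)) := by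
  have h := hG.exp_neg_sum Finset.univ ![x, y]
  simp only [Fin.sum_univ_two, Matrix.cons_val_zero, Matrix.cons_val_one, sub_self, neg_add,
    Real.exp_add, hG.cov_comm x y] at h
  refine ⟨h.1, h.2.trans ?_⟩
  simp only [← Real.exp_nat_mul, ← Real.exp_add]
  congr 1
  push_cast
  ring

lemma IsStationaryGaussianField.exp_three (hG : IsStationaryGaussianField P G C) (x y z : ℝ) :
    Integrable (fun ω => Real.exp (-G x ω) * Real.exp (-G y ω) * Real.exp (-G z ω)) P ∧
      ∫ ω, Real.exp (-G x ω) * Real.exp (-G y ω) * Real.exp (-G z ω) ∂P =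
        Real.exp (C 0 / 2) ^ 3 *
          (Real.exp (C (x - y)) * Real.exp (C (x - z)) * Real.exp (C (y - z))) := by
  have h := hG.exp_neg_sum Finset.univ ![x, y, z]
  simp only [Fin.sum_univ_three, Matrix.cons_val, sub_self, neg_add,
    Real.exp_add, hG.cov_comm x y, hG.cov_comm x z, hG.cov_comm y z] at h
  refine ⟨h.1, h.2.trans ?_⟩
  simp only [← Real.exp_nat_mul, ← Real.exp_add]
  congr 1
  push_cast
  ring

lemma IsStationaryGaussianField.exp_four (hG : IsStationaryGaussianField P G C) (x y z w : ℝ) :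
    Integrable (fun ω => Real.exp (-G x ω) * Real.exp (-G y ω) * Real.exp (-G z ω)
      * Real.exp (-G w ω)) P ∧
      ∫ ω, Real.exp (-G x ω) * Real.exp (-G y ω) * Real.exp (-G z ω) * Real.exp (-G w ω) ∂P =
        Real.exp (C 0 / 2) ^ 4 *
          (Real.exp (C (x - y)) * Real.exp (C (x - z)) * Real.exp (C (x - w)) *
            (Real.exp (C (y - z)) * Real.exp (C (y - w)) * Real.exp (C (z - w)))) := by
  have h := hG.exp_neg_sum Finset.univ ![x, y, z, w]
  simp only [Fin.sum_univ_four, Matrix.cons_val, sub_self, neg_add,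
    Real.exp_add, hG.cov_comm x y, hG.cov_comm x z, hG.cov_comm y z, hG.cov_comm x w,
    hG.cov_comm y w, hG.cov_comm z w] at h
  refine ⟨h.1, h.2.trans ?_⟩
  simp only [← Real.exp_nat_mul, ← Real.exp_add]
  congr 1
  push_cast
  ring

/-- Multiplying by one more centered factor. -/
lemma integrable_mul_sub {F b : Ω → ℝ} {m A B : ℝ}
    (hF : Integrable F P ∧ ∫ ω, F ω ∂P = A)
    (hFb : Integrable (fun ω => F ω * b ω) P ∧ ∫ ω, F ω * b ω ∂P = B) :
    Integrable (fun ω => F ω * (b ω - m)) P ∧ ∫ ω, F ω * (b ω - m) ∂P = B - m * A := by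
  have h : (fun ω => F ω * (b ω - m)) = fun ω => F ω * b ω - m * F ω := by
    funext ω; ring
  rw [h]
  refine ⟨hFb.1.sub (hF.1.const_mul m), ?_⟩
  rw [integral_sub hFb.1 (hF.1.const_mul m), integral_const_mul, hF.2, hFb.2]

lemma integrable_eq_of_eq {F F' : Ω → ℝ} {A A' : ℝ} (h : Integrable F P ∧ ∫ ω, F ω ∂P = A)
    (hF : ∀ ω, F' ω = F ω) (hA : A' = A) : Integrable F' P ∧ ∫ ω, F' ω ∂P = A' := by
  obtain rfl : F' = F := funext hF
  rw [hA]
  exact h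

lemma IsStationaryGaussianField.fluct_one (hG : IsStationaryGaussianField P G C) (x : ℝ) :
    Integrable (fluct G C x) P ∧ ∫ ω, fluct G C x ω ∂P = 0 := by
  have := hG.gaussian.isProbabilityMeasure
  have h1 : Integrable (fun _ : Ω => (1 : ℝ)) P ∧ ∫ _, (1 : ℝ) ∂P = 1 := by simp
  exact integrable_eq_of_eq (integrable_mul_sub (m := Real.exp (C 0 / 2)) h1
    (integrable_eq_of_eq (hG.exp_one x) (fun ω => one_mul _) rfl))
    (fun ω => by simp [fluct]) (by simp)

/-- Mixed products trade one factor `exp (-G)` at a time for its centred version. Each expectation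
is then a combination of two earlier ones, so that the Gaussian computation is confined to pure
exponentials. -/
lemma IsStationaryGaussianField.exp_mul_fluct (hG : IsStationaryGaussianField P G C)
    (x y : ℝ) :
    Integrable (fun ω => Real.exp (-G x ω) * fluct G C y ω) P ∧
      ∫ ω, Real.exp (-G x ω) * fluct G C y ω ∂P =
        Real.exp (C 0 / 2) ^ 2 * (Real.exp (C (x - y)) - 1) :=
  integrable_eq_of_eq (integrable_mul_sub (m := Real.exp (C 0 / 2)) (hG.exp_one x)
    (hG.exp_two x y)) (fun ω => rfl) (by ring)

lemma IsStationaryGaussianField.fluct_two (hG : IsStationaryGaussianField P G C) (x y : ℝ) :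
    Integrable (fun ω => fluct G C x ω * fluct G C y ω) P ∧
      ∫ ω, fluct G C x ω * fluct G C y ω ∂P =
        Real.exp (C 0 / 2) ^ 2 * (Real.exp (C (x - y)) - 1) :=
  integrable_eq_of_eq (integrable_mul_sub (m := Real.exp (C 0 / 2)) (hG.fluct_one y)
    (integrable_eq_of_eq (hG.exp_mul_fluct x y) (fun ω => mul_comm _ _) rfl))
    (fun ω => mul_comm _ _) (by ring)

lemma IsStationaryGaussianField.exp_exp_fluct (hG : IsStationaryGaussianField P G C)
    (x y z : ℝ) :
    Integrable (fun ω => Real.exp (-G x ω) * Real.exp (-G y ω) * fluct G C z ω) P ∧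
      ∫ ω, Real.exp (-G x ω) * Real.exp (-G y ω) * fluct G C z ω ∂P =
        Real.exp (C 0 / 2) ^ 3 * (Real.exp (C (x - y)) *
          (Real.exp (C (x - z)) * Real.exp (C (y - z)) - 1)) :=
  integrable_eq_of_eq (integrable_mul_sub (m := Real.exp (C 0 / 2)) (hG.exp_two x y)
    (hG.exp_three x y z)) (fun ω => rfl) (by ring)

lemma IsStationaryGaussianField.exp_fluct_fluct (hG : IsStationaryGaussianField P G C)
    (x y z : ℝ) :
    Integrable (fun ω => Real.exp (-G x ω) * fluct G C y ω * fluct G C z ω) P ∧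
      ∫ ω, Real.exp (-G x ω) * fluct G C y ω * fluct G C z ω ∂P =
        Real.exp (C 0 / 2) ^ 3 * (Real.exp (C (x - y)) *
          (Real.exp (C (x - z)) * Real.exp (C (y - z)) - 1) - (Real.exp (C (x - z)) - 1)) :=
  integrable_eq_of_eq (integrable_mul_sub (m := Real.exp (C 0 / 2)) (hG.exp_mul_fluct x z)
    (integrable_eq_of_eq (hG.exp_exp_fluct x y z) (fun ω => mul_right_comm _ _ _) rfl))
    (fun ω => mul_right_comm _ _ _) (by ring)

/-- With `t = exp C - 1` on each edge, the bracket equals the sum of the three paths and the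
triangle: centring removes every graph with an isolated vertex. -/
lemma IsStationaryGaussianField.fluct_three (hG : IsStationaryGaussianField P G C)
    (x y z : ℝ) :
    Integrable (fun ω => fluct G C x ω * fluct G C y ω * fluct G C z ω) P ∧
      ∫ ω, fluct G C x ω * fluct G C y ω * fluct G C z ω ∂P =
        Real.exp (C 0 / 2) ^ 3 * (Real.exp (C (x - y)) *
          (Real.exp (C (x - z)) * Real.exp (C (y - z)) - 1) - (Real.exp (C (x - z)) - 1)
            - (Real.exp (C (y - z)) - 1)) :=
  integrable_eq_of_eq (integrable_mul_sub (m := Real.exp (C 0 / 2))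
    (b := fun ω => Real.exp (-G x ω)) (hG.fluct_two y z)
    (integrable_eq_of_eq (hG.exp_fluct_fluct x y z) (fun ω => by ring) rfl))
    (fun ω => by simp only [fluct]; ring) (by ring)

lemma IsStationaryGaussianField.exp_exp_exp_fluct (hG : IsStationaryGaussianField P G C)
    (x y z w : ℝ) :
    Integrable (fun ω => Real.exp (-G x ω) * Real.exp (-G y ω) * Real.exp (-G z ω)
      * fluct G C w ω) P ∧
      ∫ ω, Real.exp (-G x ω) * Real.exp (-G y ω) * Real.exp (-G z ω) * fluct G C w ω ∂P =
        Real.exp (C 0 / 2) ^ 4 *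
          (Real.exp (C (x - y)) * Real.exp (C (x - z)) * Real.exp (C (y - z)) *
            (Real.exp (C (x - w)) * Real.exp (C (y - w)) * Real.exp (C (z - w)) - 1)) :=
  integrable_eq_of_eq (integrable_mul_sub (m := Real.exp (C 0 / 2)) (hG.exp_three x y z)
    (hG.exp_four x y z w)) (fun ω => rfl) (by ring)

lemma IsStationaryGaussianField.exp_exp_fluct_fluct (hG : IsStationaryGaussianField P G C)
    (x y z w : ℝ) :
    Integrable (fun ω => Real.exp (-G x ω) * Real.exp (-G y ω) * fluct G C z ω
      * fluct G C w ω) P ∧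
      ∫ ω, Real.exp (-G x ω) * Real.exp (-G y ω) * fluct G C z ω * fluct G C w ω ∂P =
        Real.exp (C 0 / 2) ^ 4 *
          (Real.exp (C (x - y)) * Real.exp (C (x - z)) * Real.exp (C (y - z)) *
            (Real.exp (C (x - w)) * Real.exp (C (y - w)) * Real.exp (C (z - w)) - 1)
            - Real.exp (C (x - y)) * (Real.exp (C (x - w)) * Real.exp (C (y - w)) - 1)) :=
  integrable_eq_of_eq (integrable_mul_sub (m := Real.exp (C 0 / 2)) (hG.exp_exp_fluct x y w)
    (integrable_eq_of_eq (hG.exp_exp_exp_fluct x y z w) (fun ω => mul_right_comm _ _ _) rfl))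
    (fun ω => mul_right_comm _ _ _) (by ring)

lemma IsStationaryGaussianField.exp_fluct_fluct_fluct (hG : IsStationaryGaussianField P G C)
    (x y z w : ℝ) :
    Integrable (fun ω => Real.exp (-G x ω) * fluct G C y ω * fluct G C z ω
      * fluct G C w ω) P ∧
      ∫ ω, Real.exp (-G x ω) * fluct G C y ω * fluct G C z ω * fluct G C w ω ∂P =
        Real.exp (C 0 / 2) ^ 4 *
          (Real.exp (C (x - y)) * Real.exp (C (x - z)) * Real.exp (C (y - z)) *
            (Real.exp (C (x - w)) * Real.exp (C (y - w)) * Real.exp (C (z - w)) - 1)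
            - Real.exp (C (x - y)) * (Real.exp (C (x - w)) * Real.exp (C (y - w)) - 1)
            - (Real.exp (C (x - z)) * (Real.exp (C (x - w)) * Real.exp (C (z - w)) - 1)
              - (Real.exp (C (x - w)) - 1))) :=
  integrable_eq_of_eq (integrable_mul_sub (m := Real.exp (C 0 / 2))
    (b := fun ω => Real.exp (-G y ω)) (hG.exp_fluct_fluct x z w)
    (integrable_eq_of_eq (hG.exp_exp_fluct_fluct x y z w) (fun ω => by ring) rfl))
    (fun ω => by simp only [fluct]; ring) (by ring)

/-- The fourth mixed moment of the fluctuation, as a sum over the graphs on four vertices without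
isolated vertices. -/
lemma IsStationaryGaussianField.fluct_four (hG : IsStationaryGaussianField P G C)
    (x y z w : ℝ) {t : ℝ → ℝ → ℝ} (ht : ∀ a b, t a b = Real.exp (C (a - b)) - 1) :
    Integrable (fun ω => fluct G C x ω * fluct G C y ω * fluct G C z ω * fluct G C w ω) P ∧
      ∫ ω, fluct G C x ω * fluct G C y ω * fluct G C z ω * fluct G C w ω ∂P =
        Real.exp (C 0 / 2) ^ 4 *
          (t x y * t z w * ((1 + t x z) * (1 + t x w) * (1 + t y z) * (1 + t y w))
          + t x z * t y w * ((1 + t x w) * (1 + t y z) * (1 + t x y + t z w))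
          + t x w * t y z * ((1 + t x y + t z w) * (1 + t x z + t y w))
          + t x y * t x z * t x w + t x y * t y z * t y w
          + t x z * t y z * t z w + t x w * t y w * t z w) :=
  -- The graphs are sorted by the first perfect matching they contain, in the order `xy|zw`,
  -- `xz|yw`, `xw|yz`; those containing none are the four stars.
  integrable_eq_of_eq (integrable_mul_sub (m := Real.exp (C 0 / 2))
    (b := fun ω => Real.exp (-G x ω)) (hG.fluct_three y z w)
    (integrable_eq_of_eq (hG.exp_fluct_fluct_fluct x y z w) (fun ω => by ring) rfl))
    (fun ω => by simp only [fluct]; ring) (by simp only [ht]; ring)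

end Moments

/-! ### Decay kernels and graph sums -/

/-- Lebesgue measure on the unit interval. -/
noncomputable abbrev unitVol : Measure ℝ := volume.restrict (Ioc 0 1)

instance : IsProbabilityMeasure unitVol := ⟨by simp [unitVol]⟩

/-- A bounded symmetric kernel with small integrals which is comparable on two sides of a
triangle. -/
structure IsDecayKernel (κ : ℝ → ℝ → ℝ) (S : ℝ) : Prop where
  measurable : Measurable (Function.uncurry κ)
  nonneg : ∀ x y, 0 ≤ κ x y
  le_one : ∀ x y, κ x y ≤ 1
  symm : ∀ x y, κ x y = κ y x
  triangle : ∀ x y z, κ x z * κ y z ≤ 2 * κ x y * (κ x z + κ y z)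
  integral_le : ∀ x, ∫ y, κ x y ∂unitVol ≤ S

section Kernel

variable {κ : ℝ → ℝ → ℝ} {S : ℝ}

/-- A bounded measurable function is integrable with respect to a finite measure. -/
lemma integrable_of_abs_le {T : Type*} [MeasurableSpace T] {τ : Measure T} [IsFiniteMeasure τ]
    {φ : T → ℝ} {B : ℝ} (hφ : Measurable φ) (hB : ∀ t, |φ t| ≤ B) : Integrable φ τ :=
  Integrable.of_bound hφ.aestronglyMeasurable B (ae_of_all _ hB)

lemma IsDecayKernel.abs_le (hκ : IsDecayKernel κ S) (x y : ℝ) : |κ x y| ≤ 1 := by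
  rw [abs_of_nonneg (hκ.nonneg x y)]
  exact hκ.le_one x y

lemma IsDecayKernel.abs_mul_le (hκ : IsDecayKernel κ S) (x y z w : ℝ) :
    |κ x y * κ z w| ≤ 1 := by
  rw [abs_mul]
  exact mul_le_one₀ (hκ.abs_le x y) (abs_nonneg _) (hκ.abs_le z w)

lemma IsDecayKernel.measurable_comp (hκ : IsDecayKernel κ S) {T : Type*} [MeasurableSpace T]
    {a b : T → ℝ} (ha : Measurable a) (hb : Measurable b) :
    Measurable fun t => κ (a t) (b t) :=
  hκ.measurable.comp (ha.prodMk hb)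

lemma IsDecayKernel.integrable (hκ : IsDecayKernel κ S) {T : Type*} [MeasurableSpace T]
    (τ : Measure T) [IsFiniteMeasure τ] {a b : T → ℝ} (ha : Measurable a) (hb : Measurable b) :
    Integrable (fun t => κ (a t) (b t)) τ :=
  integrable_of_abs_le (hκ.measurable_comp ha hb) fun _ => hκ.abs_le _ _

lemma IsDecayKernel.integrable_mul (hκ : IsDecayKernel κ S) {T : Type*} [MeasurableSpace T]
    (τ : Measure T) [IsFiniteMeasure τ] {a b c d : T → ℝ} (ha : Measurable a)
    (hb : Measurable b) (hc : Measurable c) (hd : Measurable d) :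
    Integrable (fun t => κ (a t) (b t) * κ (c t) (d t)) τ :=
  integrable_of_abs_le ((hκ.measurable_comp ha hb).mul (hκ.measurable_comp hc hd))
    fun _ => hκ.abs_mul_le _ _ _ _

lemma IsDecayKernel.bound_nonneg (hκ : IsDecayKernel κ S) : 0 ≤ S :=
  (integral_nonneg fun y => hκ.nonneg 0 y).trans (hκ.integral_le 0)

/-- The integral of a function bounded by a constant with respect to a probability measure. -/
lemma integral_le_const {T : Type*} [MeasurableSpace T] {τ : Measure T} [IsProbabilityMeasure τ]
    {φ : T → ℝ} {B : ℝ} (hφ : Integrable φ τ) (hB : ∀ t, φ t ≤ B) : ∫ t, φ t ∂τ ≤ B := by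
  simpa using integral_mono hφ (integrable_const B) hB

lemma IsDecayKernel.integral_prod_le (hκ : IsDecayKernel κ S) :
    ∫ p, κ p.1 p.2 ∂(unitVol.prod unitVol) ≤ S := by
  rw [integral_prod _ (hκ.integrable _ measurable_fst measurable_snd)]
  exact integral_le_const (hκ.integrable _ measurable_fst measurable_snd).integral_prod_left
    hκ.integral_le

lemma IsDecayKernel.integral_mul_le (hκ : IsDecayKernel κ S) (a b : ℝ) :
    ∫ p, κ a p.1 * κ b p.2 ∂(unitVol.prod unitVol) ≤ S ^ 2 := by
  rw [integral_prod_mul (fun x => κ a x) fun y => κ b y, sq]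
  exact mul_le_mul (hκ.integral_le a) (hκ.integral_le b)
    (integral_nonneg fun y => hκ.nonneg b y) hκ.bound_nonneg

lemma IsDecayKernel.integral_path_le (hκ : IsDecayKernel κ S) (a : ℝ) :
    ∫ p, κ a p.1 * κ p.1 p.2 ∂(unitVol.prod unitVol) ≤ S ^ 2 := by
  have hi := hκ.integrable_mul (unitVol.prod unitVol) (measurable_const (a := a))
    measurable_fst measurable_fst measurable_snd
  rw [integral_prod _ hi, sq]
  calc ∫ x, ∫ y, κ a x * κ x y ∂unitVol ∂unitVol
      ≤ ∫ x, κ a x * S ∂unitVol := by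
        refine integral_mono hi.integral_prod_left
          ((hκ.integrable _ measurable_const measurable_id).mul_const S) fun x => ?_
        simp only [integral_const_mul]
        exact mul_le_mul_of_nonneg_left (hκ.integral_le x) (hκ.nonneg a x)
    _ = (∫ x, κ a x ∂unitVol) * S := integral_mul_const _ _
    _ ≤ S * S := mul_le_mul_of_nonneg_right (hκ.integral_le a) hκ.bound_nonneg

/-- Integrals over the paths with three vertices. -/
lemma IsDecayKernel.integral_three_le (hκ : IsDecayKernel κ S) :
    ∫ q, (κ q.1 q.2.1 * κ q.1 q.2.2 + κ q.1 q.2.1 * κ q.2.1 q.2.2)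
      ∂(unitVol.prod (unitVol.prod unitVol)) ≤ 2 * S ^ 2 := by
  have h1 := hκ.integrable_mul (unitVol.prod (unitVol.prod unitVol))
    measurable_fst measurable_snd.fst measurable_fst measurable_snd.snd
  have h2 := hκ.integrable_mul (unitVol.prod (unitVol.prod unitVol))
    measurable_fst measurable_snd.fst measurable_snd.fst measurable_snd.snd
  rw [integral_add h1 h2, integral_prod _ h1, integral_prod _ h2, two_mul]
  exact add_le_add
    (integral_le_const h1.integral_prod_left fun a => hκ.integral_mul_le a a)
    (integral_le_const h2.integral_prod_left fun a => hκ.integral_path_le a)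

/-- Integrals over the perfect matchings of four vertices. -/
lemma IsDecayKernel.integral_four_le (hκ : IsDecayKernel κ S) :
    ∫ q, (κ q.1.1 q.1.2 * κ q.2.1 q.2.2 + κ q.1.1 q.2.1 * κ q.1.2 q.2.2
        + κ q.1.1 q.2.2 * κ q.1.2 q.2.1)
      ∂((unitVol.prod unitVol).prod (unitVol.prod unitVol)) ≤ 3 * S ^ 2 := by
  set ν := (unitVol.prod unitVol).prod (unitVol.prod unitVol)
  have h1 := hκ.integrable_mul ν
    measurable_fst.fst measurable_fst.snd measurable_snd.fst measurable_snd.snd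
  have h2 := hκ.integrable_mul ν
    measurable_fst.fst measurable_snd.fst measurable_fst.snd measurable_snd.snd
  have h3 := hκ.integrable_mul ν
    measurable_fst.fst measurable_snd.snd measurable_fst.snd measurable_snd.fst
  have e1 : ∫ q, κ q.1.1 q.1.2 * κ q.2.1 q.2.2 ∂ν ≤ S ^ 2 := by
    rw [integral_prod_mul (fun p : ℝ × ℝ => κ p.1 p.2) fun p : ℝ × ℝ => κ p.1 p.2, sq]
    exact mul_le_mul hκ.integral_prod_le hκ.integral_prod_le
      (integral_nonneg fun y => hκ.nonneg _ _) hκ.bound_nonneg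
  have e2 : ∫ q, κ q.1.1 q.2.1 * κ q.1.2 q.2.2 ∂ν ≤ S ^ 2 := by
    rw [integral_prod _ h2]
    exact integral_le_const h2.integral_prod_left fun p => hκ.integral_mul_le p.1 p.2
  have e3 : ∫ q, κ q.1.1 q.2.2 * κ q.1.2 q.2.1 ∂ν ≤ S ^ 2 := by
    rw [integral_prod _ h3]
    refine integral_le_const h3.integral_prod_left fun p => ?_
    simpa only [mul_comm] using hκ.integral_mul_le p.2 p.1
  have h12 : Integrable (fun q : (ℝ × ℝ) × ℝ × ℝ => κ q.1.1 q.1.2 * κ q.2.1 q.2.2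
      + κ q.1.1 q.2.1 * κ q.1.2 q.2.2) ν := h1.add h2
  rw [integral_add h12 h3, integral_add h1 h2]
  linarith

/-- Bound for the polynomial of the third moment. -/
lemma IsDecayKernel.abs_three_le (hκ : IsDecayKernel κ S) {t : ℝ → ℝ → ℝ} {T : ℝ} (hT : 0 ≤ T)
    (ht : ∀ x y, |t x y| ≤ T * κ x y) (x y z : ℝ) :
    |t x y * t x z + t x y * t y z + t x z * t y z + t x y * t x z * t y z| ≤
      3 * T ^ 2 * (1 + T) * (κ x y * κ x z + κ x y * κ y z) := by
  have hprod : ∀ a b c d, |t a b * t c d| ≤ T ^ 2 * (κ a b * κ c d) := by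
    intro a b c d
    rw [abs_mul]
    calc |t a b| * |t c d| ≤ (T * κ a b) * (T * κ c d) :=
          mul_le_mul (ht a b) (ht c d) (abs_nonneg _) (mul_nonneg hT (hκ.nonneg _ _))
      _ = _ := by ring
  have ht1 : |t y z| ≤ T := (ht y z).trans (mul_le_of_le_one_right hT (hκ.le_one _ _))
  have h1 := hprod x y x z
  have h2 := hprod x y y z
  have h3 := hprod x z y z
  have h4 : |t x y * t x z * t y z| ≤ T ^ 2 * (κ x y * κ x z) * T := by
    rw [abs_mul]
    exact mul_le_mul h1 ht1 (abs_nonneg _)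
      (mul_nonneg (sq_nonneg T) (mul_nonneg (hκ.nonneg _ _) (hκ.nonneg _ _)))
  -- The path with middle vertex `z` is the one missing on the right-hand side; it is traded for the
  -- two paths through the edge `xy`.
  have h5 : κ x z * κ y z ≤ 2 * κ x y * (κ x z + κ y z) := hκ.triangle x y z
  have h6 : T ^ 2 * (κ x z * κ y z) ≤ T ^ 2 * (2 * κ x y * (κ x z + κ y z)) :=
    mul_le_mul_of_nonneg_left h5 (sq_nonneg T)
  have p1 : 0 ≤ T ^ 2 * T * (κ x y * κ x z) := by
    have := hκ.nonneg x y; have := hκ.nonneg x z; positivity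
  have p2 : 0 ≤ T ^ 2 * T * (κ x y * κ y z) := by
    have := hκ.nonneg x y; have := hκ.nonneg y z; positivity
  refine (abs_add_le _ _).trans ?_
  have e1 := abs_add_le (t x y * t x z + t x y * t y z) (t x z * t y z)
  have e2 := abs_add_le (t x y * t x z) (t x y * t y z)
  linarith

/-- Bound for the polynomial of the fourth moment. -/
lemma IsDecayKernel.abs_four_le (hκ : IsDecayKernel κ S) {t : ℝ → ℝ → ℝ} {T : ℝ} (hT : 0 ≤ T)
    (ht : ∀ x y, |t x y| ≤ T * κ x y) (x y z w : ℝ) :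
    |t x y * t z w * ((1 + t x z) * (1 + t x w) * (1 + t y z) * (1 + t y w))
      + t x z * t y w * ((1 + t x w) * (1 + t y z) * (1 + t x y + t z w))
      + t x w * t y z * ((1 + t x y + t z w) * (1 + t x z + t y w))
      + t x y * t x z * t x w + t x y * t y z * t y w
      + t x z * t y z * t z w + t x w * t y w * t z w| ≤
      (T ^ 2 * (1 + 2 * T) ^ 4 + 8 * T ^ 3) *
        (κ x y * κ z w + κ x z * κ y w + κ x w * κ y z) := by
  have hprod : ∀ a b c d, |t a b * t c d| ≤ T ^ 2 * (κ a b * κ c d) := by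
    intro a b c d
    rw [abs_mul]
    calc |t a b| * |t c d| ≤ (T * κ a b) * (T * κ c d) :=
          mul_le_mul (ht a b) (ht c d) (abs_nonneg _) (mul_nonneg hT (hκ.nonneg _ _))
      _ = _ := by ring
  have hn : ∀ a b c d, 0 ≤ κ a b * κ c d := fun a b c d =>
    mul_nonneg (hκ.nonneg _ _) (hκ.nonneg _ _)
  have ht1 : ∀ a b, |t a b| ≤ T := fun a b =>
    (ht a b).trans (mul_le_of_le_one_right hT (hκ.le_one _ _))
  have hone : ∀ a b, |1 + t a b| ≤ 1 + 2 * T := fun a b => by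
    have := abs_add_le 1 (t a b)
    have := ht1 a b
    rw [abs_one] at *
    linarith
  have htwo : ∀ a b c d, |1 + t a b + t c d| ≤ 1 + 2 * T := fun a b c d => by
    have := abs_add_le (1 + t a b) (t c d)
    have := abs_add_le 1 (t a b)
    have := ht1 a b
    have := ht1 c d
    rw [abs_one] at *
    linarith
  have hR : 1 ≤ 1 + 2 * T := by linarith
  have hR0 : 0 ≤ 1 + 2 * T := by linarith
  have m1 : |t x y * t z w * ((1 + t x z) * (1 + t x w) * (1 + t y z) * (1 + t y w))| ≤
      T ^ 2 * (κ x y * κ z w) * (1 + 2 * T) ^ 4 := by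
    rw [abs_mul]
    refine mul_le_mul (hprod _ _ _ _) ?_ (abs_nonneg _) (mul_nonneg (sq_nonneg T) (hn _ _ _ _))
    rw [abs_mul, abs_mul, abs_mul]
    calc _ ≤ (1 + 2 * T) * (1 + 2 * T) * (1 + 2 * T) * (1 + 2 * T) := by
          gcongr <;> apply hone
      _ = _ := by ring
  have m2 : |t x z * t y w * ((1 + t x w) * (1 + t y z) * (1 + t x y + t z w))| ≤
      T ^ 2 * (κ x z * κ y w) * (1 + 2 * T) ^ 4 := by
    rw [abs_mul]
    refine mul_le_mul (hprod _ _ _ _) ?_ (abs_nonneg _) (mul_nonneg (sq_nonneg T) (hn _ _ _ _))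
    rw [abs_mul, abs_mul]
    calc _ ≤ (1 + 2 * T) * (1 + 2 * T) * (1 + 2 * T) := by
          gcongr
          · apply hone
          · apply hone
          · apply htwo
      _ = (1 + 2 * T) ^ 3 := by ring
      _ ≤ _ := pow_le_pow_right₀ hR (by norm_num)
  have m3 : |t x w * t y z * ((1 + t x y + t z w) * (1 + t x z + t y w))| ≤
      T ^ 2 * (κ x w * κ y z) * (1 + 2 * T) ^ 4 := by
    rw [abs_mul]
    refine mul_le_mul (hprod _ _ _ _) ?_ (abs_nonneg _) (mul_nonneg (sq_nonneg T) (hn _ _ _ _))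
    rw [abs_mul]
    calc _ ≤ (1 + 2 * T) * (1 + 2 * T) := by
          gcongr <;> apply htwo
      _ = (1 + 2 * T) ^ 2 := by ring
      _ ≤ _ := pow_le_pow_right₀ hR (by norm_num)
  -- In a star, two of the edges are replaced by the edge joining their outer ends. Together with
  -- the third edge this is a perfect matching.
  have star : ∀ a b c d e f u v, κ a b * κ c d ≤ 4 * κ u v →
      |t a b * t c d * t e f| ≤ 4 * T ^ 3 * (κ u v * κ e f) := by
    intro a b c d e f u v h
    rw [abs_mul]
    calc _ ≤ T ^ 2 * (κ a b * κ c d) * (T * κ e f) :=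
          mul_le_mul (hprod _ _ _ _) (ht _ _) (abs_nonneg _)
            (mul_nonneg (sq_nonneg T) (hn _ _ _ _))
      _ ≤ T ^ 2 * (4 * κ u v) * (T * κ e f) :=
          mul_le_mul_of_nonneg_right (mul_le_mul_of_nonneg_left h (sq_nonneg T))
            (mul_nonneg hT (hκ.nonneg _ _))
      _ = _ := by ring
  have tri : ∀ a b c, κ a c * κ b c ≤ 4 * κ a b := by
    intro a b c
    have h := hκ.triangle a b c
    have : 2 * κ a b * (κ a c + κ b c) ≤ 2 * κ a b * 2 :=
      mul_le_mul_of_nonneg_left (by linarith [hκ.le_one a c, hκ.le_one b c])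
        (by linarith [hκ.nonneg a b])
    linarith
  -- The last two stars are both assigned to the matching `xy|zw`, whence the constant `8 * T ^ 3`.
  have s1 := star x y x z x w y z (by rw [hκ.symm x y, hκ.symm x z]; exact tri y z x)
  have s2 := star x y y z y w x z (by rw [hκ.symm y z]; exact tri x z y)
  have s3 := star x z y z z w x y (tri x y z)
  have s4 := star x w y w z w x y (tri x y w)
  have a1 := abs_add_le (t x y * t z w * ((1 + t x z) * (1 + t x w) * (1 + t y z) * (1 + t y w)))
    (t x z * t y w * ((1 + t x w) * (1 + t y z) * (1 + t x y + t z w)))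
  refine (abs_add_le _ _).trans ((add_le_add_left (abs_add_le _ _) _).trans ?_)
  refine (add_le_add_left (add_le_add_left (abs_add_le _ _) _) _).trans ?_
  refine (add_le_add_left (add_le_add_left (add_le_add_left (abs_add_le _ _) _) _) _).trans ?_
  refine (add_le_add_left (add_le_add_left (add_le_add_left (add_le_add_left
    (abs_add_le _ _) _) _) _) _).trans ?_
  have hT3 : 0 ≤ T ^ 3 := by positivity
  have q1 := mul_nonneg hT3 (hn x y z w)
  have q2 := mul_nonneg hT3 (hn x z y w)
  have q3 := mul_nonneg hT3 (hn x w y z)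
  rw [mul_comm (κ y z) (κ x w)] at s1
  linarith

end Kernel

/-! ### Moments of weighted integrals of the fluctuation -/

section FluctInt

variable {Ω : Type*} [MeasurableSpace Ω] {P : Measure Ω} {G : ℝ → Ω → ℝ} {C : ℝ → ℝ}

/-- Interchange of expectation and integration for a family bounded in `L¹`. -/
lemma integral_swap_of_bound {T : Type*} [MeasurableSpace T] {τ : Measure T} [IsFiniteMeasure τ]
    [IsProbabilityMeasure P] {F : T → Ω → ℝ} {A : ℝ} (hF : Measurable (Function.uncurry F))
    (hi : ∀ t, Integrable (F t) P) (hA : ∀ t, ∫ ω, |F t ω| ∂P ≤ A) :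
    Integrable (fun ω => ∫ t, F t ω ∂τ) P ∧
      ∫ ω, ∫ t, F t ω ∂τ ∂P = ∫ t, ∫ ω, F t ω ∂P ∂τ := by
  have hint : Integrable (Function.uncurry F) (τ.prod P) := by
    rw [integrable_prod_iff hF.aestronglyMeasurable]
    refine ⟨ae_of_all _ hi, ?_⟩
    refine Integrable.of_bound (hF.norm.stronglyMeasurable.integral_prod_right').aestronglyMeasurable
      A (ae_of_all _ fun t => ?_)
    rw [Real.norm_of_nonneg (integral_nonneg fun _ => norm_nonneg _)]
    exact hA t
  exact ⟨hint.integral_prod_right, (integral_integral_swap hint).symm⟩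

/-- The random variable `∫₀¹ h(x) (exp (-G(x/ε)) - E[exp (-G(x/ε))]) dx`. -/
noncomputable def fluctInt (G : ℝ → Ω → ℝ) (C : ℝ → ℝ) (ε : ℝ) (h : ℝ → ℝ) (ω : Ω) : ℝ :=
  ∫ x, h x * fluct G C (x / ε) ω ∂unitVol

lemma measurable_fluct (hGm : Measurable (Function.uncurry G)) (ε : ℝ) :
    Measurable fun q : ℝ × Ω => fluct G C (q.1 / ε) q.2 := by
  have h : Measurable fun q : ℝ × Ω => G (q.1 / ε) q.2 :=
    hGm.comp ((measurable_fst.div_const ε).prodMk measurable_snd)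
  exact (Real.measurable_exp.comp h.neg).sub_const _

/-- A uniform bound for the absolute moments of order at most four. -/
lemma IsStationaryGaussianField.exists_moment_bound (hG : IsStationaryGaussianField P G C) :
    ∃ A : ℝ, (∀ x, ∫ ω, |fluct G C x ω| ∂P ≤ A) ∧
      (∀ x y, ∫ ω, |fluct G C x ω * fluct G C y ω| ∂P ≤ A) ∧
      (∀ x y z, ∫ ω, |fluct G C x ω * fluct G C y ω * fluct G C z ω| ∂P ≤ A) ∧
      (∀ x y z w, ∫ ω, |fluct G C x ω * fluct G C y ω * fluct G C z ω * fluct G C w ω| ∂P ≤ A) := by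
  have := hG.gaussian.isProbabilityMeasure
  obtain ⟨B, hB⟩ : ∃ B : ℝ, ∀ x, Integrable (fun ω => fluct G C x ω ^ 4) P ∧
      ∫ ω, fluct G C x ω ^ 4 ∂P = B := by
    have h4 : ∀ x, _ := fun x => hG.fluct_four x x x x
      (t := fun a b => Real.exp (C (a - b)) - 1) fun _ _ => rfl
    -- On the diagonal the fourth moment depends on `C 0` only, so one constant serves all points.
    simp only [sub_self] at h4
    exact ⟨_, fun x => integrable_eq_of_eq (h4 x) (fun ω => by ring) rfl⟩
  have hB0 : 0 ≤ B := by
    rw [← (hB 0).2]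
    exact integral_nonneg fun ω => by positivity
  have key : ∀ a b : ℝ, |a * b| ≤ (a ^ 2 + b ^ 2) / 2 := fun a b => by
    rw [abs_le]; constructor <;> nlinarith [sq_nonneg (a - b), sq_nonneg (a + b)]
  have key1 : ∀ a : ℝ, a ^ 2 ≤ 1 + a ^ 4 := fun a => by nlinarith [sq_nonneg (a ^ 2 - 1)]
  have key4 : ∀ a b c d : ℝ, |a * b * c * d| ≤ a ^ 4 + b ^ 4 + c ^ 4 + d ^ 4 := by
    intro a b c d
    have h1 := key (a * b) (c * d)
    rw [show a * b * (c * d) = a * b * c * d by ring] at h1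
    nlinarith [sq_nonneg (a ^ 2 - b ^ 2), sq_nonneg (c ^ 2 - d ^ 2), sq_nonneg (a ^ 2),
      sq_nonneg (b ^ 2), sq_nonneg (c ^ 2), sq_nonneg (d ^ 2)]
  have i1 : Integrable (fun _ : Ω => (1 : ℝ)) P := integrable_const 1
  have main : ∀ x y z w, ∀ F : Ω → ℝ, (∀ ω, |F ω| ≤ 1 + fluct G C x ω ^ 4
      + fluct G C y ω ^ 4 + fluct G C z ω ^ 4 + fluct G C w ω ^ 4) →
      ∫ ω, |F ω| ∂P ≤ 1 + 4 * B := by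
    intro x y z w F hF
    have hsum : Integrable (fun ω => 1 + fluct G C x ω ^ 4
      + fluct G C y ω ^ 4 + fluct G C z ω ^ 4 + fluct G C w ω ^ 4) P :=
      (((i1.add (hB x).1).add (hB y).1).add (hB z).1).add (hB w).1
    calc ∫ ω, |F ω| ∂P ≤ ∫ ω, (1 + fluct G C x ω ^ 4
      + fluct G C y ω ^ 4 + fluct G C z ω ^ 4 + fluct G C w ω ^ 4) ∂P :=
          integral_mono_of_nonneg (ae_of_all _ fun _ => abs_nonneg _) hsum (ae_of_all _ hF)
      _ = 1 + 4 * B := by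
          have e1 : Integrable (fun ω => 1 + fluct G C x ω ^ 4) P := i1.add (hB x).1
          have e2 : Integrable (fun ω => 1 + fluct G C x ω ^ 4 + fluct G C y ω ^ 4) P :=
            e1.add (hB y).1
          have e3 : Integrable (fun ω => 1 + fluct G C x ω ^ 4 + fluct G C y ω ^ 4
            + fluct G C z ω ^ 4) P := e2.add (hB z).1
          rw [integral_add e3 (hB w).1, integral_add e2 (hB z).1, integral_add e1 (hB y).1,
            integral_add i1 (hB x).1, (hB x).2, (hB y).2, (hB z).2, (hB w).2]
          simp
          ring
  have hpow : ∀ x ω, 0 ≤ fluct G C x ω ^ 4 := fun x ω => by positivity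
  refine ⟨1 + 4 * B, fun x => ?_, fun x y => ?_, fun x y z => ?_, fun x y z w => ?_⟩
  · refine main x x x x _ fun ω => ?_
    have := key (fluct G C x ω) 1
    rw [mul_one] at this
    linarith [key1 (fluct G C x ω), hpow x ω]
  · refine main x y y y _ fun ω => ?_
    linarith [key (fluct G C x ω) (fluct G C y ω), key1 (fluct G C x ω), key1 (fluct G C y ω),
      hpow x ω, hpow y ω]
  · refine main x y z z _ fun ω => ?_
    have h := key4 (fluct G C x ω) (fluct G C y ω) (fluct G C z ω) 1
    rw [mul_one] at h
    linarith [hpow z ω]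
  · refine main x y z w _ fun ω => ?_
    linarith [key4 (fluct G C x ω) (fluct G C y ω) (fluct G C z ω) (fluct G C w ω)]

lemma IsStationaryGaussianField.fluctInt_one (hG : IsStationaryGaussianField P G C)
    (hGm : Measurable (Function.uncurry G)) {h : ℝ → ℝ} {B : ℝ} (hh : Measurable h)
    (hB : ∀ x, |h x| ≤ B) (ε : ℝ) :
    Integrable (fluctInt G C ε h) P ∧ ∫ ω, fluctInt G C ε h ω ∂P = 0 := by
  have := hG.gaussian.isProbabilityMeasure
  obtain ⟨A, hA, -⟩ := hG.exists_moment_bound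
  have hB0 : 0 ≤ B := (abs_nonneg _).trans (hB 0)
  have hs := integral_swap_of_bound (P := P) (τ := unitVol) (A := B * A)
    (F := fun x ω => h x * fluct G C (x / ε) ω)
    ((hh.comp measurable_fst).mul (measurable_fluct hGm ε))
    (fun x => (hG.fluct_one _).1.const_mul _) (fun x => by
      simp only [abs_mul, integral_const_mul]
      exact mul_le_mul (hB x) (hA _) (integral_nonneg fun _ => abs_nonneg _) hB0)
  refine ⟨hs.1, hs.2.trans ?_⟩
  simp [integral_const_mul, (hG.fluct_one _).2]

/-- The exact variance of the linear term; the prefactor `exp (C 0)` of the limiting quadratic form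
is the squared mean of `exp (-G)`. -/
lemma IsStationaryGaussianField.fluctInt_sq (hG : IsStationaryGaussianField P G C)
    (hGm : Measurable (Function.uncurry G)) {h : ℝ → ℝ} {B : ℝ} (hh : Measurable h)
    (hB : ∀ x, |h x| ≤ B) (ε : ℝ) :
    Integrable (fun ω => fluctInt G C ε h ω ^ 2) P ∧ ∫ ω, fluctInt G C ε h ω ^ 2 ∂P =
      Real.exp (C 0) * ∫ p, h p.1 * h p.2 * (Real.exp (C (p.1 / ε - p.2 / ε)) - 1)
        ∂(unitVol.prod unitVol) := by
  have := hG.gaussian.isProbabilityMeasure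
  obtain ⟨A, -, hA, -⟩ := hG.exists_moment_bound
  have hB0 : 0 ≤ B := (abs_nonneg _).trans (hB 0)
  have hD := measurable_fluct (C := C) hGm ε
  have hs := integral_swap_of_bound (P := P) (τ := unitVol.prod unitVol) (A := B * B * A)
    (F := fun p ω => h p.1 * h p.2 * (fluct G C (p.1 / ε) ω * fluct G C (p.2 / ε) ω))
    (((hh.comp measurable_fst.fst).mul (hh.comp measurable_fst.snd)).mul
      ((hD.comp (measurable_fst.fst.prodMk measurable_snd)).mul
        (hD.comp (measurable_fst.snd.prodMk measurable_snd))))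
    (fun p => (hG.fluct_two _ _).1.const_mul _) (fun p => by
      simp only [abs_mul (h p.1 * h p.2), integral_const_mul]
      refine mul_le_mul ?_ (hA _ _) (integral_nonneg fun _ => abs_nonneg _) (by positivity)
      rw [abs_mul]
      exact mul_le_mul (hB _) (hB _) (abs_nonneg _) hB0)
  refine integrable_eq_of_eq hs (fun ω => ?_) ?_
  · rw [sq, fluctInt, ← integral_prod_mul]
    exact integral_congr_ae (ae_of_all _ fun p => by ring)
  · rw [← integral_const_mul]
    refine integral_congr_ae (ae_of_all _ fun p => ?_)
    simp only [integral_const_mul, (hG.fluct_two _ _).2, ← Real.exp_nat_mul]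
    rw [show ((2 : ℕ) : ℝ) * (C 0 / 2) = C 0 by push_cast; ring]
    ring

/-- Every graph in the third moment contains a path with two edges, and each edge integrates to at
most `S`. The weights differ because the application is to `F Γ`, `F` and `Γ`. -/
lemma IsStationaryGaussianField.fluctInt_three (hG : IsStationaryGaussianField P G C)
    (hGm : Measurable (Function.uncurry G)) {h₁ h₂ h₃ : ℝ → ℝ} {B : ℝ}
    (hh₁ : Measurable h₁) (hh₂ : Measurable h₂) (hh₃ : Measurable h₃)
    (hB₁ : ∀ x, |h₁ x| ≤ B) (hB₂ : ∀ x, |h₂ x| ≤ B) (hB₃ : ∀ x, |h₃ x| ≤ B) {ε : ℝ}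
    {κ : ℝ → ℝ → ℝ} {S T : ℝ} (hκ : IsDecayKernel κ S) (hT : 0 ≤ T)
    (ht : ∀ x y, |Real.exp (C (x / ε - y / ε)) - 1| ≤ T * κ x y) :
    Integrable (fun ω => fluctInt G C ε h₁ ω * (fluctInt G C ε h₂ ω * fluctInt G C ε h₃ ω)) P ∧
      |∫ ω, fluctInt G C ε h₁ ω * (fluctInt G C ε h₂ ω * fluctInt G C ε h₃ ω) ∂P| ≤
        B ^ 3 * Real.exp (C 0 / 2) ^ 3 * (3 * T ^ 2 * (1 + T)) * (2 * S ^ 2) := by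
  have := hG.gaussian.isProbabilityMeasure
  obtain ⟨A, -, -, hA, -⟩ := hG.exists_moment_bound
  have hB0 : 0 ≤ B := (abs_nonneg _).trans (hB₁ 0)
  have hD := measurable_fluct (C := C) hGm ε
  have hBh : ∀ x y z, |h₁ x * h₂ y * h₃ z| ≤ B * B * B := fun x y z => by
    rw [abs_mul, abs_mul]
    exact mul_le_mul (mul_le_mul (hB₁ _) (hB₂ _) (abs_nonneg _) hB0) (hB₃ _) (abs_nonneg _)
      (by positivity)
  have hs := integral_swap_of_bound (P := P) (τ := unitVol.prod (unitVol.prod unitVol))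
    (A := B * B * B * A)
    (F := fun p ω => h₁ p.1 * h₂ p.2.1 * h₃ p.2.2 *
      (fluct G C (p.1 / ε) ω * fluct G C (p.2.1 / ε) ω * fluct G C (p.2.2 / ε) ω))
    ((((hh₁.comp measurable_fst.fst).mul (hh₂.comp measurable_fst.snd.fst)).mul
      (hh₃.comp measurable_fst.snd.snd)).mul
      (((hD.comp (measurable_fst.fst.prodMk measurable_snd)).mul
        (hD.comp (measurable_fst.snd.fst.prodMk measurable_snd))).mul
        (hD.comp (measurable_fst.snd.snd.prodMk measurable_snd))))
    (fun p => (hG.fluct_three _ _ _).1.const_mul _) (fun p => by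
      simp only [abs_mul (h₁ p.1 * h₂ p.2.1 * h₃ p.2.2), integral_const_mul]
      exact mul_le_mul (hBh _ _ _) (hA _ _ _) (integral_nonneg fun _ => abs_nonneg _)
        (by positivity))
  have hs' := integrable_eq_of_eq
    (F' := fun ω => fluctInt G C ε h₁ ω * (fluctInt G C ε h₂ ω * fluctInt G C ε h₃ ω)) hs
    (fun ω => by
      simp only [fluctInt]
      rw [← integral_prod_mul (μ := unitVol) (ν := unitVol), ← integral_prod_mul]
      exact integral_congr_ae (ae_of_all _ fun p => by ring)) rfl
  refine ⟨hs'.1, ?_⟩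
  rw [hs'.2]
  refine (abs_integral_le_integral_abs).trans ?_
  refine (integral_mono_of_nonneg (ae_of_all _ fun _ => abs_nonneg _)
    (g := fun q => B ^ 3 * Real.exp (C 0 / 2) ^ 3 * (3 * T ^ 2 * (1 + T)) *
      (κ q.1 q.2.1 * κ q.1 q.2.2 + κ q.1 q.2.1 * κ q.2.1 q.2.2)) ?_
    (ae_of_all _ fun q => ?_)).trans ?_
  · exact ((hκ.integrable_mul _ measurable_fst measurable_snd.fst measurable_fst
      measurable_snd.snd).add (hκ.integrable_mul _ measurable_fst measurable_snd.fst
      measurable_snd.fst measurable_snd.snd)).const_mul _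
  · simp only [integral_const_mul, (hG.fluct_three _ _ _).2]
    have hp := hκ.abs_three_le (t := fun x y => Real.exp (C (x / ε - y / ε)) - 1) hT ht
      q.1 q.2.1 q.2.2
    rw [abs_mul, abs_mul (Real.exp (C 0 / 2) ^ 3), abs_of_pos (pow_pos (Real.exp_pos _) 3)]
    calc _ ≤ (B * B * B) * (Real.exp (C 0 / 2) ^ 3 * (3 * T ^ 2 * (1 + T) *
          (κ q.1 q.2.1 * κ q.1 q.2.2 + κ q.1 q.2.1 * κ q.2.1 q.2.2))) := by
          refine mul_le_mul (hBh _ _ _) ?_ (by positivity) (by positivity)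
          refine mul_le_mul_of_nonneg_left (le_trans (le_of_eq ?_) hp) (by positivity)
          congr 1
          ring
      _ = _ := by ring
  · rw [integral_const_mul]
    exact mul_le_mul_of_nonneg_left hκ.integral_three_le (by positivity)

/-- All graphs are dominated by the three perfect matchings, each of which integrates to at most `S
^ 2`. -/
lemma IsStationaryGaussianField.fluctInt_four (hG : IsStationaryGaussianField P G C)
    (hGm : Measurable (Function.uncurry G)) {h : ℝ → ℝ} {B : ℝ} (hh : Measurable h)
    (hB : ∀ x, |h x| ≤ B) {ε : ℝ}
    {κ : ℝ → ℝ → ℝ} {S T : ℝ} (hκ : IsDecayKernel κ S) (hT : 0 ≤ T)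
    (ht : ∀ x y, |Real.exp (C (x / ε - y / ε)) - 1| ≤ T * κ x y) :
    Integrable (fun ω => fluctInt G C ε h ω ^ 4) P ∧
      ∫ ω, fluctInt G C ε h ω ^ 4 ∂P ≤
        B ^ 4 * Real.exp (C 0 / 2) ^ 4 * (T ^ 2 * (1 + 2 * T) ^ 4 + 8 * T ^ 3) *
          (3 * S ^ 2) := by
  have := hG.gaussian.isProbabilityMeasure
  obtain ⟨A, -, -, -, hA⟩ := hG.exists_moment_bound
  have hB0 : 0 ≤ B := (abs_nonneg _).trans (hB 0)
  have hD := measurable_fluct (C := C) hGm ε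
  have hBh : ∀ x y z w, |h x * h y * h z * h w| ≤ B * B * B * B := fun x y z w => by
    rw [abs_mul, abs_mul, abs_mul]
    exact mul_le_mul (mul_le_mul (mul_le_mul (hB _) (hB _) (abs_nonneg _) hB0) (hB _)
      (abs_nonneg _) (by positivity)) (hB _) (abs_nonneg _) (by positivity)
  have hs := integral_swap_of_bound (P := P)
    (τ := (unitVol.prod unitVol).prod (unitVol.prod unitVol)) (A := B * B * B * B * A)
    (F := fun p ω => h p.1.1 * h p.1.2 * h p.2.1 * h p.2.2 *
      (fluct G C (p.1.1 / ε) ω * fluct G C (p.1.2 / ε) ω * fluct G C (p.2.1 / ε) ω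
        * fluct G C (p.2.2 / ε) ω))
    (((((hh.comp measurable_fst.fst.fst).mul (hh.comp measurable_fst.fst.snd)).mul
      (hh.comp measurable_fst.snd.fst)).mul (hh.comp measurable_fst.snd.snd)).mul
      ((((hD.comp (measurable_fst.fst.fst.prodMk measurable_snd)).mul
        (hD.comp (measurable_fst.fst.snd.prodMk measurable_snd))).mul
        (hD.comp (measurable_fst.snd.fst.prodMk measurable_snd))).mul
        (hD.comp (measurable_fst.snd.snd.prodMk measurable_snd))))
    (fun p => (hG.fluct_four _ _ _ _ fun _ _ => rfl).1.const_mul _) (fun p => by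
      simp only [abs_mul (h p.1.1 * h p.1.2 * h p.2.1 * h p.2.2), integral_const_mul]
      exact mul_le_mul (hBh _ _ _ _) (hA _ _ _ _) (integral_nonneg fun _ => abs_nonneg _)
        (by positivity))
  have hs' := integrable_eq_of_eq (F' := fun ω => fluctInt G C ε h ω ^ 4) hs
    (fun ω => by
      rw [show fluctInt G C ε h ω ^ 4 = (fluctInt G C ε h ω * fluctInt G C ε h ω) *
        (fluctInt G C ε h ω * fluctInt G C ε h ω) by ring]
      simp only [fluctInt]
      rw [← integral_prod_mul (μ := unitVol) (ν := unitVol), ← integral_prod_mul]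
      exact integral_congr_ae (ae_of_all _ fun p => by ring)) rfl
  refine ⟨hs'.1, ?_⟩
  rw [hs'.2]
  refine (le_abs_self _).trans ((abs_integral_le_integral_abs).trans ?_)
  refine (integral_mono_of_nonneg (ae_of_all _ fun _ => abs_nonneg _)
    (g := fun q => B ^ 4 * Real.exp (C 0 / 2) ^ 4 * (T ^ 2 * (1 + 2 * T) ^ 4 + 8 * T ^ 3) *
      (κ q.1.1 q.1.2 * κ q.2.1 q.2.2 + κ q.1.1 q.2.1 * κ q.1.2 q.2.2
        + κ q.1.1 q.2.2 * κ q.1.2 q.2.1)) ?_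
    (ae_of_all _ fun q => ?_)).trans ?_
  · exact (((hκ.integrable_mul _ measurable_fst.fst measurable_fst.snd measurable_snd.fst
      measurable_snd.snd).add (hκ.integrable_mul _ measurable_fst.fst measurable_snd.fst
      measurable_fst.snd measurable_snd.snd)).add (hκ.integrable_mul _ measurable_fst.fst
      measurable_snd.snd measurable_fst.snd measurable_snd.fst)).const_mul _
  · have hp := hκ.abs_four_le (t := fun x y => Real.exp (C (x / ε - y / ε)) - 1) hT ht
      q.1.1 q.1.2 q.2.1 q.2.2
    simp only [integral_const_mul, (hG.fluct_four _ _ _ _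
      (t := fun a b => Real.exp (C (a - b)) - 1) fun _ _ => rfl).2]
    rw [abs_mul, abs_mul (Real.exp (C 0 / 2) ^ 4), abs_of_pos (pow_pos (Real.exp_pos _) 4)]
    calc _ ≤ (B * B * B * B) * (Real.exp (C 0 / 2) ^ 4 *
          ((T ^ 2 * (1 + 2 * T) ^ 4 + 8 * T ^ 3) *
          (κ q.1.1 q.1.2 * κ q.2.1 q.2.2 + κ q.1.1 q.2.1 * κ q.1.2 q.2.2
            + κ q.1.1 q.2.2 * κ q.1.2 q.2.1))) := by
          refine mul_le_mul (hBh _ _ _ _) ?_ (by positivity) (by positivity)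
          exact mul_le_mul_of_nonneg_left hp (by positivity)
      _ = _ := by ring
  · rw [integral_const_mul]
    exact mul_le_mul_of_nonneg_left hκ.integral_four_le (by positivity)

end FluctInt

/-! ### Explicit formula for the averaged gradient -/

lemma integral_unitVol (φ : ℝ → ℝ) : ∫ x, φ x ∂unitVol = ∫ x in (0 : ℝ)..1, φ x := by
  rw [intervalIntegral.integral_of_le zero_le_one]

lemma integrable_unitVol_of_continuous {φ : ℝ → ℝ} (hφ : Continuous φ) : Integrable φ unitVol :=
  (hφ.intervalIntegrable 0 1).1

/-- The explicit formula for averages of the gradient of the solution. -/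
lemma IsSolution.gradAverage_eq {φ f g u : ℝ → ℝ} {ε : ℝ} (hφ : Continuous φ)
    (hf : ContDiffOn ℝ 1 f (Icc 0 1))
    (hu : IsSolution (fun x => Real.exp (φ x)) ε f u) {F Γ : ℝ → ℝ} {p q : ℝ}
    (hF : Continuous F) (hΓ : Continuous Γ) (hfF : ∀ x ∈ Icc (0 : ℝ) 1, f x = F x + p)
    (hgΓ : ∀ x ∈ Icc (0 : ℝ) 1, g x = Γ x + q) :
    gradAverage u g = ∫ x, F x * Γ x * Real.exp (-φ (x / ε)) ∂unitVol -
      (∫ x, F x * Real.exp (-φ (x / ε)) ∂unitVol) *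
        (∫ x, Γ x * Real.exp (-φ (x / ε)) ∂unitVol) /
        ∫ x, Real.exp (-φ (x / ε)) ∂unitVol := by
  have hw : Continuous fun x => Real.exp (-φ (x / ε)) := by fun_prop
  have hderiv : ∀ x ∈ Ioo (0 : ℝ) 1,
      HasDerivAt (fun y => Real.exp (φ (y / ε)) * deriv u y - f y) 0 x := by
    intro x hx
    have hfd : HasDerivAt f (deriv f x) x :=
      ((hf.contDiffAt (Icc_mem_nhds hx.1 hx.2)).differentiableAt one_ne_zero).hasDerivAt
    have h := (hu.equation x hx).sub hfd
    rw [sub_self] at h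
    exact h
  -- First integral of the equation: the flux minus `f` is constant. The shift `p` is then absorbed
  -- in the constant.
  obtain ⟨c₀, hc₀⟩ := isOpen_Ioo.exists_is_const_of_deriv_eq_zero isPreconnected_Ioo
    (fun x hx => (hderiv x hx).differentiableAt.differentiableWithinAt)
    (fun x hx => (hderiv x hx).deriv)
  obtain ⟨c, hc⟩ : ∃ c, ∀ x ∈ Ioo (0 : ℝ) 1, deriv u x = (F x + c) * Real.exp (-φ (x / ε)) := by
    refine ⟨p + c₀, fun x hx => ?_⟩
    have h1 := hc₀ x hx
    rw [hfF x (Ioo_subset_Icc_self hx)] at h1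
    rw [Real.exp_neg, ← div_eq_mul_inv, eq_div_iff (Real.exp_pos _).ne']
    linarith
  -- At the endpoints `deriv u` also depends on values of `u` outside the unit interval; they are
  -- discarded as a null set.
  have hae : ∀ᵐ x ∂unitVol, x ∈ Ioo (0 : ℝ) 1 := by
    rw [unitVol, ← restrict_Ioo_eq_restrict_Ioc]
    exact ae_restrict_mem measurableSet_Ioo
  have hiF : Integrable (fun x => F x * Real.exp (-φ (x / ε))) unitVol :=
    integrable_unitVol_of_continuous (by fun_prop)
  have hiw : Integrable (fun x => Real.exp (-φ (x / ε))) unitVol :=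
    integrable_unitVol_of_continuous hw
  have hiΓ : Integrable (fun x => Γ x * Real.exp (-φ (x / ε))) unitVol :=
    integrable_unitVol_of_continuous (by fun_prop)
  have hiFΓ : Integrable (fun x => F x * Γ x * Real.exp (-φ (x / ε))) unitVol :=
    integrable_unitVol_of_continuous (by fun_prop)
  have hiU : Integrable (fun x => (F x + c) * Real.exp (-φ (x / ε))) unitVol :=
    integrable_unitVol_of_continuous (by fun_prop)
  have hiUΓ : Integrable (fun x => (F x + c) * Real.exp (-φ (x / ε)) * Γ x) unitVol :=
    integrable_unitVol_of_continuous (by fun_prop)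
  -- The boundary conditions say that `u'` has mean zero. This determines `c` and makes the shift
  -- `q` irrelevant.
  have hzero : ∫ x, (F x + c) * Real.exp (-φ (x / ε)) ∂unitVol = 0 := by
    rw [integral_unitVol, intervalIntegral.integral_eq_sub_of_hasDerivAt_of_le zero_le_one
      hu.contDiffOn.continuousOn, hu.left, hu.right, sub_zero]
    · intro x hx
      rw [← hc x hx]
      exact ((hu.contDiffOn.contDiffAt (Icc_mem_nhds hx.1 hx.2)).differentiableAt
        one_ne_zero).hasDerivAt
    · exact Continuous.intervalIntegrable (by fun_prop) _ _
  have hpos : 0 < ∫ x, Real.exp (-φ (x / ε)) ∂unitVol := by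
    rw [integral_unitVol]
    exact intervalIntegral.intervalIntegral_pos_of_pos (hw.intervalIntegrable _ _)
      (fun x => Real.exp_pos _) zero_lt_one
  have hgrad : gradAverage u g = ∫ x, F x * Γ x * Real.exp (-φ (x / ε)) ∂unitVol +
      c * ∫ x, Γ x * Real.exp (-φ (x / ε)) ∂unitVol := by
    rw [gradAverage, ← integral_unitVol]
    calc ∫ x, deriv u x * g x ∂unitVol
        = ∫ x, ((F x + c) * Real.exp (-φ (x / ε)) * Γ x
            + q * ((F x + c) * Real.exp (-φ (x / ε)))) ∂unitVol := by
          refine integral_congr_ae ?_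
          filter_upwards [hae] with x hx
          rw [hc x hx, hgΓ x (Ioo_subset_Icc_self hx)]
          ring
      _ = ∫ x, (F x + c) * Real.exp (-φ (x / ε)) * Γ x ∂unitVol := by
          rw [integral_add hiUΓ (hiU.const_mul q), integral_const_mul, hzero, mul_zero, add_zero]
      _ = ∫ x, (F x * Γ x * Real.exp (-φ (x / ε)) + c * (Γ x * Real.exp (-φ (x / ε))))
            ∂unitVol := integral_congr_ae (ae_of_all _ fun x => by ring)
      _ = _ := by rw [integral_add hiFΓ (hiΓ.const_mul c), integral_const_mul]
  have hcval : ∫ x, F x * Real.exp (-φ (x / ε)) ∂unitVol +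
      c * ∫ x, Real.exp (-φ (x / ε)) ∂unitVol = 0 := by
    rw [← hzero, ← integral_const_mul, ← integral_add hiF (hiw.const_mul c)]
    exact integral_congr_ae (ae_of_all _ fun x => by ring)
  rw [hgrad]
  field_simp
  linear_combination hcval * ∫ x, Γ x * Real.exp (-φ (x / ε)) ∂unitVol

/-! ### Variance of a linear term with a random ratio as correction -/

/-- The variance of `X - A Z / (m + Y)` is that of `X` up to fourth moments and a third mixed
moment. -/
lemma variance_sub_ratio {Ω : Type*} [MeasurableSpace Ω] {P : Measure Ω} [IsProbabilityMeasure P]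
    {I X A Z Y : Ω → ℝ} {c₀ m B Q Q₃ : ℝ} (hm : 0 < m) (hB : 0 ≤ B)
    (hI : I =ᵐ[P] fun ω => c₀ + (X ω - A ω * Z ω / (m + Y ω)))
    (hpos : ∀ ω, 0 < m + Y ω) (hAB : ∀ ω, |A ω| ≤ B * (m + Y ω))
    (hX : Integrable X P) (hA : Integrable A P) (hZ : Integrable Z P) (hY : Integrable Y P)
    (hX0 : ∫ ω, X ω ∂P = 0) (hX2 : Integrable (fun ω => X ω ^ 2) P)
    (hX4 : Integrable (fun ω => X ω ^ 4) P ∧ ∫ ω, X ω ^ 4 ∂P ≤ Q)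
    (hA4 : Integrable (fun ω => A ω ^ 4) P ∧ ∫ ω, A ω ^ 4 ∂P ≤ Q)
    (hZ4 : Integrable (fun ω => Z ω ^ 4) P ∧ ∫ ω, Z ω ^ 4 ∂P ≤ Q)
    (hY4 : Integrable (fun ω => Y ω ^ 4) P ∧ ∫ ω, Y ω ^ 4 ∂P ≤ Q)
    (hXAZ : Integrable (fun ω => X ω * (A ω * Z ω)) P ∧
      |∫ ω, X ω * (A ω * Z ω) ∂P| ≤ Q₃) :
    MemLp I 2 P ∧ |Var[I; P] - ∫ ω, X ω ^ 2 ∂P| ≤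
      2 * (Q₃ / m + 2 * (1 + B) / m / m * (4 * Q)) + 4 * (2 * (1 + B) / m) ^ 2 * (4 * Q) := by
  set c := 2 * (1 + B) / m with hc
  have hc0 : 0 ≤ c := by positivity
  set R : Ω → ℝ := fun ω => A ω * Z ω / (m + Y ω) with hR
  set W : Ω → ℝ := fun ω => X ω ^ 4 + A ω ^ 4 + Z ω ^ 4 + Y ω ^ 4 with hW
  have hXA : Integrable (fun ω => X ω ^ 4 + A ω ^ 4) P := hX4.1.add hA4.1
  have hXAZ4 : Integrable (fun ω => X ω ^ 4 + A ω ^ 4 + Z ω ^ 4) P := hXA.add hZ4.1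
  have hWi : Integrable W P := hXAZ4.add hY4.1
  have hWQ : ∫ ω, W ω ∂P ≤ 4 * Q := by
    simp only [hW]
    rw [integral_add hXAZ4 hY4.1, integral_add hXA hZ4.1, integral_add hX4.1 hA4.1]
    linarith [hX4.2, hA4.2, hZ4.2, hY4.2]
  -- This replaces negative moments of the denominator. If `m + Y ≥ m / 2`, the quotient is at most
  -- `2 |A| / m`; otherwise `|Y| ≥ m / 2`, and the quotient, being at most `B`, is at most `2 B |Y|
  -- / m`.
  have hratio : ∀ ω, |A ω / (m + Y ω)| ≤ c * (|A ω| + |Y ω|) := by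
    intro ω
    rw [abs_div, abs_of_pos (hpos ω), div_le_iff₀ (hpos ω), hc]
    have hA0 := abs_nonneg (A ω)
    have hY0 := abs_nonneg (Y ω)
    have e : 2 * (1 + B) / m * (|A ω| + |Y ω|) * (m + Y ω) =
        (2 * (1 + B) * (|A ω| + |Y ω|) * (m + Y ω)) / m := by ring
    rw [e, le_div_iff₀ hm]
    rcases le_total (m / 2) (m + Y ω) with h | h
    · have h1 : |A ω| * m ≤ 2 * |A ω| * (m + Y ω) := by nlinarith
      have h2 : 2 * |A ω| * (m + Y ω) ≤ 2 * (1 + B) * (|A ω| + |Y ω|) * (m + Y ω) := by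
        refine mul_le_mul_of_nonneg_right ?_ (hpos ω).le
        nlinarith [mul_nonneg hB hA0, mul_nonneg hB hY0]
      linarith
    · have h1 : m ≤ 2 * |Y ω| := by linarith [neg_abs_le (Y ω)]
      calc |A ω| * m ≤ B * (m + Y ω) * (2 * |Y ω|) :=
            mul_le_mul (hAB ω) h1 hm.le (mul_nonneg hB (hpos ω).le)
        _ = 2 * B * |Y ω| * (m + Y ω) := by ring
        _ ≤ _ := by
            refine mul_le_mul_of_nonneg_right ?_ (hpos ω).le
            nlinarith [mul_nonneg hB hA0, mul_nonneg hB hY0]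
  have hRm : AEStronglyMeasurable R P := by
    have := (hA.aestronglyMeasurable.aemeasurable.mul
      hZ.aestronglyMeasurable.aemeasurable).div
      (hY.aestronglyMeasurable.aemeasurable.const_add m)
    exact this.aestronglyMeasurable
  have hRsq : ∀ ω, R ω ^ 2 ≤ 2 * c ^ 2 * W ω := by
    intro ω
    have h1 : R ω ^ 2 = |A ω / (m + Y ω)| ^ 2 * Z ω ^ 2 := by
      rw [sq_abs, hR]; ring
    have h2 : |A ω / (m + Y ω)| ^ 2 ≤ (c * (|A ω| + |Y ω|)) ^ 2 :=
      pow_le_pow_left₀ (abs_nonneg _) (hratio ω) 2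
    have h3 : (|A ω| + |Y ω|) ^ 2 ≤ 2 * (A ω ^ 2 + Y ω ^ 2) := by
      rw [← sq_abs (A ω), ← sq_abs (Y ω)]
      nlinarith [sq_nonneg (|A ω| - |Y ω|)]
    have h4 : (A ω ^ 2 + Y ω ^ 2) * Z ω ^ 2 ≤ W ω := by
      simp only [hW]
      linarith [sq_nonneg (A ω ^ 2 - Z ω ^ 2), sq_nonneg (Y ω ^ 2 - Z ω ^ 2),
        sq_nonneg (A ω ^ 2), sq_nonneg (Y ω ^ 2), sq_nonneg (X ω ^ 2), sq_nonneg (Z ω ^ 2)]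
    calc R ω ^ 2 = |A ω / (m + Y ω)| ^ 2 * Z ω ^ 2 := h1
      _ ≤ (c * (|A ω| + |Y ω|)) ^ 2 * Z ω ^ 2 := mul_le_mul_of_nonneg_right h2 (sq_nonneg _)
      _ = c ^ 2 * ((|A ω| + |Y ω|) ^ 2 * Z ω ^ 2) := by ring
      _ ≤ c ^ 2 * (2 * (A ω ^ 2 + Y ω ^ 2) * Z ω ^ 2) := by gcongr
      _ = 2 * c ^ 2 * ((A ω ^ 2 + Y ω ^ 2) * Z ω ^ 2) := by ring
      _ ≤ _ := by gcongr
  have hR2 : Integrable (fun ω => R ω ^ 2) P :=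
    (hWi.const_mul (2 * c ^ 2)).mono' (hRm.pow 2) (ae_of_all _ fun ω => by
      rw [Real.norm_of_nonneg (sq_nonneg _)]
      exact hRsq ω)
  have hER2 : ∫ ω, R ω ^ 2 ∂P ≤ 2 * c ^ 2 * (4 * Q) := by
    calc ∫ ω, R ω ^ 2 ∂P ≤ ∫ ω, 2 * c ^ 2 * W ω ∂P := integral_mono hR2 (hWi.const_mul _) hRsq
      _ = 2 * c ^ 2 * ∫ ω, W ω ∂P := integral_const_mul _ _
      _ ≤ _ := mul_le_mul_of_nonneg_left hWQ (by positivity)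
  have hRL : MemLp R 2 P := (memLp_two_iff_integrable_sq hRm).2 hR2
  have hXL : MemLp X 2 P := (memLp_two_iff_integrable_sq hX.aestronglyMeasurable).2 hX2
  have hXRi : Integrable (fun ω => X ω * R ω) P := hXL.integrable_mul hRL
  have hRi : Integrable R P := hRL.integrable one_le_two
  -- The error `X A Z - m X R` made by replacing the random denominator by `m`. It is of fourth
  -- order since the quotient `A / (m + Y)` is itself of first order.
  set E : Ω → ℝ := fun ω => X ω * (A ω / (m + Y ω)) * Z ω * Y ω with hE
  have hEle : ∀ ω, |E ω| ≤ c * W ω := by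
    intro ω
    simp only [hE, abs_mul]
    have hn := abs_nonneg (X ω)
    have hn2 := abs_nonneg (Z ω)
    have hn3 := abs_nonneg (Y ω)
    have hn4 := abs_nonneg (A ω)
    calc |X ω| * |A ω / (m + Y ω)| * |Z ω| * |Y ω|
        ≤ |X ω| * (c * (|A ω| + |Y ω|)) * |Z ω| * |Y ω| := by
          gcongr
          exact hratio ω
      _ = c * ((|X ω| * |Z ω|) * (|A ω| * |Y ω|) + (|X ω| * |Z ω|) * |Y ω| ^ 2) := by ring
      _ ≤ c * W ω := by
          refine mul_le_mul_of_nonneg_left ?_ hc0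
          have e4 : W ω = |X ω| ^ 4 + |A ω| ^ 4 + |Z ω| ^ 4 + |Y ω| ^ 4 := by
            simp only [hW, (by decide : Even 4).pow_abs]
          rw [e4]
          have i1 := sq_nonneg (|X ω| * |Z ω| - |A ω| * |Y ω|)
          have i2 := sq_nonneg (|X ω| * |Z ω| - |Y ω| ^ 2)
          have i3 := sq_nonneg (|X ω| ^ 2 - |Z ω| ^ 2)
          have i4 := sq_nonneg (|A ω| ^ 2 - |Y ω| ^ 2)
          have i5 : 0 ≤ |A ω| ^ 4 := by positivity
          have i6 : 0 ≤ |Y ω| ^ 4 := by positivity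
          have i7 : 0 ≤ |X ω| ^ 4 := by positivity
          have i8 : 0 ≤ |Z ω| ^ 4 := by positivity
          linarith
  have hEeq : ∀ ω, E ω = X ω * (A ω * Z ω) - m * (X ω * R ω) := by
    intro ω
    have := (hpos ω).ne'
    simp only [hE, hR]
    field_simp
    ring
  have hEi : Integrable E P := by
    have : E = fun ω => X ω * (A ω * Z ω) - m * (X ω * R ω) := funext hEeq
    rw [this]
    exact hXAZ.1.sub (hXRi.const_mul m)
  have hEE : |∫ ω, E ω ∂P| ≤ c * (4 * Q) := by
    calc |∫ ω, E ω ∂P| ≤ ∫ ω, |E ω| ∂P := abs_integral_le_integral_abs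
      _ ≤ ∫ ω, c * W ω ∂P := integral_mono hEi.abs (hWi.const_mul _) hEle
      _ = c * ∫ ω, W ω ∂P := integral_const_mul _ _
      _ ≤ _ := mul_le_mul_of_nonneg_left hWQ hc0
  have hXR : |∫ ω, X ω * R ω ∂P| ≤ Q₃ / m + c / m * (4 * Q) := by
    have h1 : ∫ ω, E ω ∂P = ∫ ω, X ω * (A ω * Z ω) ∂P - m * ∫ ω, X ω * R ω ∂P := by
      rw [← integral_const_mul, ← integral_sub hXAZ.1 (hXRi.const_mul m)]
      exact integral_congr_ae (ae_of_all _ hEeq)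
    have h2 : ∫ ω, X ω * R ω ∂P = (∫ ω, X ω * (A ω * Z ω) ∂P - ∫ ω, E ω ∂P) / m := by
      rw [h1]
      field_simp
      ring
    rw [h2, abs_div, abs_of_pos hm]
    calc |∫ ω, X ω * (A ω * Z ω) ∂P - ∫ ω, E ω ∂P| / m ≤ (Q₃ + c * (4 * Q)) / m := by
          gcongr
          exact (abs_sub _ _).trans (add_le_add hXAZ.2 hEE)
      _ = _ := by ring
  have hXRL : MemLp (fun ω => X ω - R ω) 2 P := hXL.sub hRL
  have hIL : MemLp I 2 P := by
    rw [memLp_congr_ae hI]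
    exact (memLp_const c₀).add hXRL
  refine ⟨hIL, ?_⟩
  -- Expanding gives `E X² - 2 E[X R] + Var R`, as `X` is centred. Only the cross term needs the
  -- third moment.
  rw [variance_congr hI, variance_const_add hXRL.aestronglyMeasurable, variance_eq_sub hXRL]
  have hs : ∫ ω, ((fun ω => X ω - R ω) ^ 2) ω ∂P =
      ∫ ω, X ω ^ 2 ∂P - 2 * ∫ ω, X ω * R ω ∂P + ∫ ω, R ω ^ 2 ∂P := by
    have h12 : Integrable (fun ω => X ω ^ 2 - 2 * (X ω * R ω)) P := hX2.sub (hXRi.const_mul 2)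
    rw [← integral_const_mul, ← integral_sub hX2 (hXRi.const_mul 2), ← integral_add h12 hR2]
    refine integral_congr_ae (ae_of_all _ fun ω => ?_)
    simp only [Pi.pow_apply]
    ring
  have hmean : ∫ ω, (X ω - R ω) ∂P = -∫ ω, R ω ∂P := by
    rw [integral_sub hX hRi, hX0, zero_sub]
  have hJ : (∫ ω, R ω ∂P) ^ 2 ≤ ∫ ω, R ω ^ 2 ∂P := by
    have := variance_nonneg R P
    rw [variance_eq_sub hRL] at this
    simpa using this
  have hR0 : 0 ≤ ∫ ω, R ω ^ 2 ∂P := integral_nonneg fun ω => sq_nonneg _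
  rw [hs, hmean, neg_sq]
  obtain ⟨l, r⟩ := abs_le.1 hXR
  rw [abs_le]
  constructor <;> linarith [sq_nonneg (∫ ω, R ω ∂P)]

/-! ### The kernel `(1 + |x - y| / ε)^{-β}` and its integrals -/

lemma ae_mem_unitVol : ∀ᵐ x ∂unitVol, x ∈ Ioc (0 : ℝ) 1 := ae_restrict_mem measurableSet_Ioc

/-- Convolution of a nonnegative even profile with the unit interval. -/
lemma integral_abs_sub_le {φ : ℝ → ℝ} (hφ : IntervalIntegrable φ volume 0 1)
    (h0 : ∀ z, 0 ≤ z → 0 ≤ φ z) {x : ℝ} (hx : x ∈ Icc (0 : ℝ) 1) :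
    Integrable (fun y => φ |x - y|) unitVol ∧
      ∫ y, φ |x - y| ∂unitVol ≤ 2 * ∫ z in (0 : ℝ)..1, φ z := by
  have hx1 : IntervalIntegrable φ volume 0 x := hφ.mono_set (by
    rw [uIcc_of_le hx.1, uIcc_of_le zero_le_one]
    exact Icc_subset_Icc_right hx.2)
  have hx2 : IntervalIntegrable φ volume 0 (1 - x) := hφ.mono_set (by
    rw [uIcc_of_le (by linarith [hx.2]), uIcc_of_le zero_le_one]
    exact Icc_subset_Icc_right (by linarith [hx.1]))
  have e1 : EqOn (fun y => φ (x - y)) (fun y => φ |x - y|) (uIcc 0 x) := by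
    intro y hy
    rw [uIcc_of_le hx.1] at hy
    simp only [abs_of_nonneg (sub_nonneg.2 hy.2)]
  have e2 : EqOn (fun y => φ (y - x)) (fun y => φ |x - y|) (uIcc x 1) := by
    intro y hy
    rw [uIcc_of_le hx.2] at hy
    simp only [abs_sub_comm x y, abs_of_nonneg (sub_nonneg.2 hy.1)]
  have i1 : IntervalIntegrable (fun y => φ |x - y|) volume 0 x := by
    have h := hx1.comp_sub_left x
    simp only [sub_zero, sub_self] at h
    exact (intervalIntegrable_congr (e1.mono uIoc_subset_uIcc)).1 (IntervalIntegrable.symm h)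
  have i2 : IntervalIntegrable (fun y => φ |x - y|) volume x 1 := by
    have h := hx2.comp_sub_right x
    simp only [zero_add, sub_add_cancel] at h
    exact (intervalIntegrable_congr (e2.mono uIoc_subset_uIcc)).1 h
  refine ⟨(i1.trans i2).1, ?_⟩
  have mono : ∀ b ∈ Icc (0 : ℝ) 1, ∫ z in (0 : ℝ)..b, φ z ≤ ∫ z in (0 : ℝ)..1, φ z := by
    intro b hb
    refine intervalIntegral.integral_mono_interval le_rfl hb.1 hb.2 ?_ hφ
    exact (ae_restrict_mem measurableSet_Ioc).mono fun z hz => h0 z hz.1.le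
  rw [integral_unitVol, ← intervalIntegral.integral_add_adjacent_intervals i1 i2,
    ← intervalIntegral.integral_congr e1, ← intervalIntegral.integral_congr e2,
    intervalIntegral.integral_comp_sub_left, intervalIntegral.integral_comp_sub_right,
    sub_self, sub_zero, two_mul]
  exact add_le_add (mono x hx) (mono (1 - x) ⟨by linarith [hx.2], by linarith [hx.1]⟩)

/-- Reduces double integrals of profiles in `|x - y|` to one dimension. No boundedness is required,
so the singular profile `z^{-β}` is covered. -/
lemma integral_prod_abs_sub_le {φ : ℝ → ℝ} (hm : Measurable φ)
    (hφ : IntervalIntegrable φ volume 0 1) (h0 : ∀ z, 0 ≤ z → 0 ≤ φ z) :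
    Integrable (fun p : ℝ × ℝ => φ |p.1 - p.2|) (unitVol.prod unitVol) ∧
      ∫ p : ℝ × ℝ, φ |p.1 - p.2| ∂(unitVol.prod unitVol) ≤ 2 * ∫ z in (0 : ℝ)..1, φ z := by
  have hmeas : Measurable fun p : ℝ × ℝ => φ |p.1 - p.2| :=
    hm.comp (measurable_fst.sub measurable_snd).abs
  have hbound : ∀ᵐ x ∂unitVol, ∫ y, φ |x - y| ∂unitVol ≤ 2 * ∫ z in (0 : ℝ)..1, φ z :=
    ae_mem_unitVol.mono fun x hx => (integral_abs_sub_le hφ h0 (Ioc_subset_Icc_self hx)).2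
  have hint : Integrable (fun p : ℝ × ℝ => φ |p.1 - p.2|) (unitVol.prod unitVol) := by
    rw [integrable_prod_iff hmeas.aestronglyMeasurable]
    refine ⟨ae_mem_unitVol.mono fun x hx =>
      (integral_abs_sub_le hφ h0 (Ioc_subset_Icc_self hx)).1, ?_⟩
    refine Integrable.of_bound
      (hmeas.norm.stronglyMeasurable.integral_prod_right').aestronglyMeasurable
      (2 * ∫ z in (0 : ℝ)..1, φ z) (hbound.mono fun x hx => ?_)
    rw [Real.norm_of_nonneg (integral_nonneg fun _ => norm_nonneg _)]
    refine le_trans (le_of_eq (integral_congr_ae (ae_of_all _ fun y => ?_))) hx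
    exact Real.norm_of_nonneg (h0 _ (abs_nonneg _))
  refine ⟨hint, ?_⟩
  rw [integral_prod _ hint]
  simpa using integral_mono_ae hint.integral_prod_left (integrable_const _) hbound

/-- The kernel `(1 + |x - y| / ε)^{-β}`. -/
noncomputable def decayKernel (β ε x y : ℝ) : ℝ := (1 + |x - y| / ε) ^ (-β)

lemma continuous_one_add_div_rpow {ε : ℝ} (hε : 0 < ε) (s : ℝ) :
    ContinuousOn (fun z : ℝ => (1 + z / ε) ^ (-s)) (Ici 0) := by
  refine ContinuousOn.rpow_const (by fun_prop) fun z hz => Or.inl ?_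
  have : 0 ≤ z / ε := div_nonneg hz hε.le
  linarith

lemma intervalIntegrable_one_add_div_rpow {ε : ℝ} (hε : 0 < ε) (s : ℝ) :
    IntervalIntegrable (fun z : ℝ => (1 + z / ε) ^ (-s)) volume 0 1 :=
  ((continuous_one_add_div_rpow hε s).mono (by
    rw [uIcc_of_le zero_le_one]
    exact Icc_subset_Ici_self)).intervalIntegrable

/-- The larger of `|x - z|` and `|y - z|` is at least half of `|x - y|`, and halving the argument
costs the factor `2 ^ β ≤ 2`; this is where `β ≤ 1` enters. -/
lemma isDecayKernel_decayKernel {β ε S : ℝ} (hβ0 : 0 < β) (hβ1 : β ≤ 1) (hε : 0 < ε)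
    (hS : 2 * ∫ z in (0 : ℝ)..1, (1 + z / ε) ^ (-β) ≤ S) :
    IsDecayKernel (decayKernel β ε) S := by
  have hbase : ∀ x y : ℝ, 1 ≤ 1 + |x - y| / ε := fun x y => by
    have : 0 ≤ |x - y| / ε := by positivity
    linarith
  have hle : ∀ x y, decayKernel β ε x y ≤ 1 := fun x y =>
    Real.rpow_le_one_of_one_le_of_nonpos (hbase x y) (by linarith)
  have hnn : ∀ x y, 0 ≤ decayKernel β ε x y := fun x y =>
    Real.rpow_nonneg (by linarith [hbase x y]) _
  have hsymm : ∀ x y, decayKernel β ε x y = decayKernel β ε y x := fun x y => by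
    simp only [decayKernel, abs_sub_comm]
  have hmeas : Measurable (Function.uncurry (decayKernel β ε)) := by
    unfold decayKernel Function.uncurry
    fun_prop
  have half : ∀ x y z : ℝ, |y - z| ≤ |x - z| →
      decayKernel β ε x z ≤ 2 * decayKernel β ε x y := by
    intro x y z h
    have h1 : |x - y| ≤ 2 * |x - z| := by
      have := abs_sub_le x z y
      rw [abs_sub_comm z y] at this
      linarith
    have h2 : (1 + |x - y| / ε) / 2 ≤ 1 + |x - z| / ε := by
      have : |x - y| / ε ≤ 2 * (|x - z| / ε) := by
        rw [← mul_div_assoc]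
        gcongr
      linarith
    have hpos : 0 < 1 + |x - y| / ε := by linarith [hbase x y]
    calc decayKernel β ε x z ≤ ((1 + |x - y| / ε) / 2) ^ (-β) :=
          Real.rpow_le_rpow_of_nonpos (by positivity) h2 (by linarith)
      _ = (2 : ℝ) ^ β * decayKernel β ε x y := by
          rw [Real.div_rpow hpos.le (by norm_num), Real.rpow_neg (by norm_num : (0 : ℝ) ≤ 2),
            div_inv_eq_mul, mul_comm, decayKernel]
      _ ≤ 2 * decayKernel β ε x y := by
          refine mul_le_mul_of_nonneg_right ?_ (hnn x y)
          calc (2 : ℝ) ^ β ≤ 2 ^ (1 : ℝ) :=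
                Real.rpow_le_rpow_of_exponent_le (by norm_num) hβ1
            _ = 2 := Real.rpow_one 2
  refine ⟨hmeas, hnn, hle, hsymm, fun x y z => ?_, fun x => ?_⟩
  · have n1 := hnn x y
    have n2 := hnn x z
    have n3 := hnn y z
    rcases le_total |y - z| |x - z| with h | h
    · have := mul_le_mul_of_nonneg_right (half x y z h) n3
      nlinarith [mul_nonneg n1 n2]
    · have h1 := half y x z h
      rw [hsymm y x] at h1
      have := mul_le_mul_of_nonneg_left h1 n2
      nlinarith [mul_nonneg n1 n3]
  -- The bound is required for every real `x`. Moving `x` to the nearest point of the unit interval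
  -- brings it closer to each `y` there and so increases the kernel.
  · set x' := max 0 (min x 1) with hx'
    have hx'I : x' ∈ Icc (0 : ℝ) 1 := ⟨le_max_left _ _, max_le zero_le_one (min_le_right _ _)⟩
    have hφ := integral_abs_sub_le (intervalIntegrable_one_add_div_rpow hε β)
      (fun z hz => Real.rpow_nonneg (by have := div_nonneg hz hε.le; linarith) _) hx'I
    refine le_trans (integral_mono_of_nonneg (ae_of_all _ fun y => hnn x y) hφ.1 ?_)
      (hφ.2.trans hS)
    filter_upwards [ae_mem_unitVol] with y hy
    refine Real.rpow_le_rpow_of_nonpos (by linarith [hbase x' y]) ?_ (by linarith)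
    have : |x' - y| ≤ |x - y| := by
      rcases le_total x 0 with h | h
      · have e : x' = 0 := by rw [hx', min_eq_left (by linarith), max_eq_left h]
        rw [e, abs_of_nonpos (by linarith [hy.1]), abs_of_nonpos (by linarith [hy.1])]
        linarith
      · rcases le_total x 1 with h1 | h1
        · have e : x' = x := by rw [hx', min_eq_left h1, max_eq_right h]
          rw [e]
        · have e : x' = 1 := by rw [hx', min_eq_right h1, max_eq_right zero_le_one]
          rw [e, abs_of_nonneg (by linarith [hy.2]), abs_of_nonneg (by linarith [hy.2])]
          linarith
    gcongr

lemma integral_one_add_div {ε : ℝ} (hε : 0 < ε) (s : ℝ) :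
    ∫ z in (0 : ℝ)..1, (1 + z / ε) ^ (-s) = ε * ∫ t in (1 : ℝ)..(1 + 1 / ε), t ^ (-s) := by
  rw [intervalIntegral.integral_comp_add_div (fun t : ℝ => t ^ (-s)) hε.ne', smul_eq_mul,
    zero_div, add_zero]

lemma integral_one_add_div_eq {ε : ℝ} (hε : 0 < ε) {s : ℝ} (hs : s ≠ 1) :
    ∫ z in (0 : ℝ)..1, (1 + z / ε) ^ (-s) = ε * (((1 + 1 / ε) ^ (1 - s) - 1) / (1 - s)) := by
  rw [integral_one_add_div hε, integral_rpow, Real.one_rpow, neg_add_eq_sub]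
  refine Or.inr ⟨fun h => hs (by linarith), fun h => ?_⟩
  have : 0 < 1 / ε := by positivity
  rw [uIcc_of_le (by linarith)] at h
  linarith [h.1]

/-- Below the critical exponent, `∫ t^{-s}` up to `1 + 1 / ε ≤ 2 / ε` is governed by its upper end.
Used both for `s = β` and for `s = 2 * β`. -/
lemma integral_one_add_div_le_of_lt {ε : ℝ} (hε : 0 < ε) (hε1 : ε < 1) {s : ℝ} (hs0 : 0 < s)
    (hs : s < 1) :
    ∫ z in (0 : ℝ)..1, (1 + z / ε) ^ (-s) ≤ 2 / (1 - s) * ε ^ s := by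
  have h1s : 0 < 1 - s := by linarith
  rw [integral_one_add_div_eq hε hs.ne]
  have h1 : (1 + 1 / ε) ^ (1 - s) ≤ 2 * (ε ^ s / ε) := by
    calc (1 + 1 / ε) ^ (1 - s) ≤ (2 / ε) ^ (1 - s) := by
          refine Real.rpow_le_rpow (by positivity) ?_ h1s.le
          have h1 : 1 ≤ 1 / ε := one_le_one_div hε hε1.le
          have h2 : 2 / ε = 1 / ε + 1 / ε := by ring
          linarith
      _ = 2 ^ (1 - s) * (ε ^ s / ε) := by
          rw [Real.div_rpow (by norm_num) hε.le, Real.rpow_sub hε, Real.rpow_one]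
          field_simp
      _ ≤ 2 * (ε ^ s / ε) := by
          refine mul_le_mul_of_nonneg_right ?_ (by positivity)
          calc (2 : ℝ) ^ (1 - s) ≤ 2 ^ (1 : ℝ) :=
                Real.rpow_le_rpow_of_exponent_le (by norm_num) (by linarith)
            _ = 2 := Real.rpow_one 2
  calc ε * (((1 + 1 / ε) ^ (1 - s) - 1) / (1 - s))
      ≤ ε * ((2 * (ε ^ s / ε)) / (1 - s)) := by
        gcongr
        linarith
    _ = _ := by field_simp

/-- Above the critical exponent `t^{-s}` is integrable at infinity, and only the scaling factor `ε`
remains. -/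
lemma integral_one_add_div_le_of_gt {ε : ℝ} (hε : 0 < ε) {s : ℝ} (hs : 1 < s) :
    ∫ z in (0 : ℝ)..1, (1 + z / ε) ^ (-s) ≤ 1 / (s - 1) * ε := by
  rw [integral_one_add_div_eq hε hs.ne']
  have h1s : 0 < s - 1 := by linarith
  have h : 0 ≤ (1 + 1 / ε) ^ (1 - s) := by positivity
  have e : ((1 + 1 / ε) ^ (1 - s) - 1) / (1 - s) = (1 - (1 + 1 / ε) ^ (1 - s)) / (s - 1) := by
    rw [← neg_div_neg_eq, neg_sub, neg_sub]
  rw [e, mul_comm]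
  gcongr
  linarith

/-- At the critical exponent a logarithm appears; the summand `1` absorbs `log (1 + ε) ≤ ε`. -/
lemma integral_one_add_div_le_of_eq {ε : ℝ} (hε : 0 < ε) (hε1 : ε < 1) :
    ∫ z in (0 : ℝ)..1, (1 + z / ε) ^ (-(1 : ℝ)) ≤ ε * (1 + |Real.log ε|) := by
  rw [integral_one_add_div hε]
  have h1 : 0 < 1 / ε := by positivity
  simp only [Real.rpow_neg_one]
  rw [integral_inv_of_pos one_pos (by linarith), div_one]
  refine mul_le_mul_of_nonneg_left ?_ hε.le
  have e : 1 + 1 / ε = (1 + ε) / ε := by field_simp; ring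
  rw [e, Real.log_div (by linarith) hε.ne', abs_of_neg (Real.log_neg hε hε1)]
  linarith [Real.log_le_sub_one_of_pos (by linarith : 0 < 1 + ε)]

/-! ### Reduction of the variance to the covariance of the field -/

lemma abs_exp_sub_one_le (c : ℝ) : |Real.exp c - 1| ≤ |c| * Real.exp |c| := by
  have h := Complex.norm_exp_sub_sum_le_norm_mul_exp c 1
  simp only [Finset.sum_range_one, pow_zero, Nat.factorial_zero, Nat.cast_one, div_one, pow_one,
    ← Complex.ofReal_exp, Complex.norm_real] at h
  rw [← Complex.ofReal_one, ← Complex.ofReal_sub, Complex.norm_real] at h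
  simpa using h

lemma abs_exp_sub_one_sub_le (c : ℝ) : |Real.exp c - 1 - c| ≤ c ^ 2 * Real.exp |c| := by
  have h := Complex.norm_exp_sub_sum_le_norm_mul_exp c 2
  simp only [Finset.sum_range_succ, Finset.sum_range_zero, pow_zero, Nat.factorial_zero,
    Nat.factorial_one, Nat.cast_one, div_one, pow_one, zero_add,
    ← Complex.ofReal_exp, Complex.norm_real] at h
  rw [← Complex.ofReal_one, ← Complex.ofReal_add, ← Complex.ofReal_sub, Complex.norm_real] at h
  rw [sub_sub]
  simpa using h

section Field

variable {Ω : Type*} [MeasurableSpace Ω] {P : Measure Ω} {G : ℝ → Ω → ℝ} {C : ℝ → ℝ}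

/-- Away from the origin no regularity of `C` is assumed; measurability comes from writing it as a
parametric integral of the jointly measurable field. -/
lemma IsStationaryGaussianField.measurable_cov (hG : IsStationaryGaussianField P G C)
    (hGm : Measurable (Function.uncurry G)) : Measurable C := by
  have := hG.gaussian.isProbabilityMeasure
  have h : C = fun x => ∫ ω, G x ω * G 0 ω ∂P := by
    funext x
    have h1 := hG.covariance_eq x 0
    rw [sub_zero] at h1
    rw [← h1, covariance]
    simp [hG.mean_zero]
  rw [h]
  have hm : Measurable fun q : ℝ × Ω => G q.1 q.2 * G 0 q.2 :=
    hGm.mul (hGm.comp (measurable_const.prodMk measurable_snd))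
  exact hm.stronglyMeasurable.integral_prod_right'.measurable

lemma IsStationaryGaussianField.cov_zero_pos (hG : IsStationaryGaussianField P G C)
    (hG0 : ∃ x, ¬ (G x =ᵐ[P] 0)) : 0 < C 0 := by
  have := hG.gaussian.isProbabilityMeasure
  obtain ⟨x, hx⟩ := hG0
  have hL := (hG.gaussian.hasGaussianLaw_eval x).memLp_two
  have hvar : Var[G x; P] = C 0 := by
    have h := hG.covariance_eq x x
    rwa [covariance_self hL.aestronglyMeasurable.aemeasurable, sub_self] at h
  refine lt_of_le_of_ne (hvar ▸ variance_nonneg _ _) fun h0 => hx ?_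
  have hz : ∫ ω, G x ω ^ 2 ∂P = 0 := by
    have h := variance_eq_sub hL
    rw [hvar, hG.mean_zero x, ← h0] at h
    simpa using h.symm
  rw [integral_eq_zero_iff_of_nonneg (fun ω => sq_nonneg _) hL.integrable_sq] at hz
  filter_upwards [hz] with ω hω
  simpa using hω

lemma abs_cov_le_decayKernel {β M ε : ℝ} (hM : ∀ x, |C x| ≤ M * (1 + |x|) ^ (-β)) (hε : 0 < ε)
    (x y : ℝ) : |C (x / ε - y / ε)| ≤ M * decayKernel β ε x y := by
  have h := hM (x / ε - y / ε)
  rwa [← sub_div, abs_div, abs_of_pos hε, sub_div] at h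

lemma decay_const_nonneg {β M : ℝ} (hM : ∀ x, |C x| ≤ M * (1 + |x|) ^ (-β)) : 0 ≤ M := by
  have h := (abs_nonneg _).trans (hM 0)
  simpa using h

lemma abs_exp_cov_sub_one_le {β M ε S : ℝ} (hM : ∀ x, |C x| ≤ M * (1 + |x|) ^ (-β))
    (hε : 0 < ε) (hκ : IsDecayKernel (decayKernel β ε) S) (x y : ℝ) :
    |Real.exp (C (x / ε - y / ε)) - 1| ≤ M * Real.exp M * decayKernel β ε x y := by
  have hM0 := decay_const_nonneg hM
  have h1 := abs_cov_le_decayKernel hM hε x y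
  have h2 : |C (x / ε - y / ε)| ≤ M := h1.trans (mul_le_of_le_one_right hM0 (hκ.le_one x y))
  calc |Real.exp (C (x / ε - y / ε)) - 1|
      ≤ |C (x / ε - y / ε)| * Real.exp |C (x / ε - y / ε)| := abs_exp_sub_one_le _
    _ ≤ M * decayKernel β ε x y * Real.exp M :=
        mul_le_mul h1 (Real.exp_le_exp.2 h2) (Real.exp_pos _).le
          (mul_nonneg hM0 (hκ.nonneg x y))
    _ = _ := by ring

/-- The variance of the averaged gradient in terms of the covariance of `exp (-G)`. -/
lemma IsStationaryGaussianField.variance_approx (hG : IsStationaryGaussianField P G C)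
    (hGm : Measurable (Function.uncurry G)) (hGc : ∀ ω, Continuous fun x => G x ω)
    {β M B : ℝ} (hβ0 : 0 < β) (hβ1 : β ≤ 1) (hM : ∀ x, |C x| ≤ M * (1 + |x|) ^ (-β))
    {F Γ : ℝ → ℝ} (hF : Continuous F) (hΓ : Continuous Γ) (hF0 : ∫ x, F x ∂unitVol = 0)
    (hΓ0 : ∫ x, Γ x ∂unitVol = 0) (hFB : ∀ x, |F x| ≤ B) (hΓB : ∀ x, |Γ x| ≤ B)
    (hFΓB : ∀ x, |F x * Γ x| ≤ B) (hB : 1 ≤ B) :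
    ∃ K : ℝ, 0 ≤ K ∧ ∀ ε, 0 < ε → ∀ S, 2 * (∫ z in (0 : ℝ)..1, (1 + z / ε) ^ (-β)) ≤ S →
      ∀ I : Ω → ℝ, (∀ᵐ ω ∂P, I ω = ∫ x, F x * Γ x * Real.exp (-G (x / ε) ω) ∂unitVol -
        (∫ x, F x * Real.exp (-G (x / ε) ω) ∂unitVol) *
          (∫ x, Γ x * Real.exp (-G (x / ε) ω) ∂unitVol) /
          ∫ x, Real.exp (-G (x / ε) ω) ∂unitVol) →
      MemLp I 2 P ∧ |Var[I; P] - Real.exp (C 0) *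
        ∫ p, F p.1 * Γ p.1 * (F p.2 * Γ p.2) * (Real.exp (C (p.1 / ε - p.2 / ε)) - 1)
          ∂(unitVol.prod unitVol)| ≤ K * S ^ 2 := by
  have := hG.gaussian.isProbabilityMeasure
  have hM0 := decay_const_nonneg hM
  set m := Real.exp (C 0 / 2) with hm
  have hm0 : 0 < m := Real.exp_pos _
  set T := M * Real.exp M with hT
  have hT0 : 0 ≤ T := mul_nonneg hM0 (Real.exp_pos _).le
  have hB0 : 0 ≤ B := by linarith
  set k₃ := B ^ 3 * m ^ 3 * (3 * T ^ 2 * (1 + T)) * 2 with hk₃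
  set k₄ := B ^ 4 * m ^ 4 * (T ^ 2 * (1 + 2 * T) ^ 4 + 8 * T ^ 3) * 3 with hk₄
  have hk₃0 : 0 ≤ k₃ := by positivity
  have hk₄0 : 0 ≤ k₄ := by positivity
  refine ⟨2 * (k₃ / m + 2 * (1 + B) / m / m * (4 * k₄)) + 4 * (2 * (1 + B) / m) ^ 2 * (4 * k₄),
    by positivity, fun ε hε S hS I hI => ?_⟩
  have hκ := isDecayKernel_decayKernel hβ0 hβ1 hε hS
  have ht := abs_exp_cov_sub_one_le hM hε hκ
  have hFΓ : Continuous fun x => F x * Γ x := hF.mul hΓ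
  have hw : ∀ ω, Continuous fun x => Real.exp (-G (x / ε) ω) := fun ω => by
    have := hGc ω
    fun_prop
  have hsplit : ∀ (φ : ℝ → ℝ), Continuous φ → ∀ ω,
      ∫ x, φ x * Real.exp (-G (x / ε) ω) ∂unitVol =
        fluctInt G C ε φ ω + m * ∫ x, φ x ∂unitVol := by
    intro φ hφ ω
    have h1 : Integrable (fun x => φ x * fluct G C (x / ε) ω) unitVol :=
      integrable_unitVol_of_continuous (hφ.mul ((hw ω).sub continuous_const))
    rw [fluctInt, ← integral_const_mul, ← integral_add h1
      ((integrable_unitVol_of_continuous hφ).const_mul m)]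
    refine integral_congr_ae (ae_of_all _ fun x => ?_)
    simp only [fluct, ← hm]
    ring
  have hone : ∀ ω, ∫ x, Real.exp (-G (x / ε) ω) ∂unitVol =
      m + fluctInt G C ε (fun _ => 1) ω := by
    intro ω
    have h := hsplit (fun _ => 1) continuous_const ω
    simp only [one_mul, integral_const, probReal_univ, smul_eq_mul, mul_one] at h
    rw [h, add_comm]
  have hpos : ∀ ω, 0 < m + fluctInt G C ε (fun _ => 1) ω := by
    intro ω
    rw [← hone ω, integral_unitVol]
    exact intervalIntegral.intervalIntegral_pos_of_pos ((hw ω).intervalIntegrable _ _)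
      (fun x => Real.exp_pos _) zero_lt_one
  -- Positivity of `exp (-G)` bounds the numerator by `B` times the denominator, which is what keeps
  -- the quotient under control when the denominator is small.
  have hAB : ∀ ω, |fluctInt G C ε F ω| ≤ B * (m + fluctInt G C ε (fun _ => 1) ω) := by
    intro ω
    have h := hsplit F hF ω
    rw [hF0, mul_zero, add_zero] at h
    rw [← h, ← hone ω, ← integral_const_mul]
    refine abs_integral_le_integral_abs.trans (integral_mono ?_ ?_ fun x => ?_)
    · exact (integrable_unitVol_of_continuous (hF.mul (hw ω))).abs
    · exact (integrable_unitVol_of_continuous (hw ω)).const_mul B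
    · simp only [abs_mul, abs_of_pos (Real.exp_pos _)]
      exact mul_le_mul_of_nonneg_right (hFB x) (Real.exp_pos _).le
  -- Both factors of the numerator lose their mean because `F` and `Γ` are centred, so the quotient
  -- is quadratic in the fluctuation.
  have hIeq : I =ᵐ[P] fun ω => m * (∫ x, F x * Γ x ∂unitVol) +
      (fluctInt G C ε (fun x => F x * Γ x) ω - fluctInt G C ε F ω * fluctInt G C ε Γ ω /
        (m + fluctInt G C ε (fun _ => 1) ω)) := by
    filter_upwards [hI] with ω hω
    rw [hω, hsplit _ hFΓ, hsplit F hF, hsplit Γ hΓ, hone, hF0, hΓ0]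
    ring
  -- The weight `1` of the denominator shares the bound `B`, hence the requirement `1 ≤ B`.
  have hone_le : ∀ x : ℝ, |(fun _ : ℝ => (1 : ℝ)) x| ≤ B := fun x => by simpa using hB
  have four : ∀ φ : ℝ → ℝ, Continuous φ → (∀ x, |φ x| ≤ B) →
      Integrable (fun ω => fluctInt G C ε φ ω ^ 4) P ∧
        ∫ ω, fluctInt G C ε φ ω ^ 4 ∂P ≤ k₄ * S ^ 2 := by
    intro φ hφ hφB
    have h := hG.fluctInt_four hGm hφ.measurable hφB hκ hT0 ht
    exact ⟨h.1, h.2.trans (le_of_eq (by rw [hk₄]; ring))⟩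
  have three := hG.fluctInt_three hGm hFΓ.measurable hF.measurable hΓ.measurable hFΓB hFB hΓB
    hκ hT0 ht
  have hsq := hG.fluctInt_sq hGm hFΓ.measurable hFΓB ε
  have hone1 := hG.fluctInt_one hGm hFΓ.measurable hFΓB ε
  have main := variance_sub_ratio (Q := k₄ * S ^ 2) (Q₃ := k₃ * S ^ 2) hm0 hB0 hIeq hpos hAB
    hone1.1 (hG.fluctInt_one hGm hF.measurable hFB ε).1
    (hG.fluctInt_one hGm hΓ.measurable hΓB ε).1
    (hG.fluctInt_one hGm measurable_const hone_le ε).1 hone1.2 hsq.1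
    (four _ hFΓ hFΓB) (four _ hF hFB) (four _ hΓ hΓB) (four _ continuous_const hone_le)
    ⟨three.1, three.2.trans (le_of_eq (by rw [hk₃]; ring))⟩
  rw [hsq.2] at main
  exact ⟨main.1, main.2.trans (le_of_eq (by ring))⟩

/-- Linearization of the covariance of `exp (-G)`. -/
lemma integral_exp_cov_sub_le {β M B ε : ℝ} (hC : Measurable C)
    (hM : ∀ x, |C x| ≤ M * (1 + |x|) ^ (-β)) (hβ0 : 0 < β) (hβ1 : β ≤ 1) (hε : 0 < ε)
    {h : ℝ → ℝ} (hh : Measurable h) (hB : ∀ x, |h x| ≤ B) :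
    |∫ p, h p.1 * h p.2 * (Real.exp (C (p.1 / ε - p.2 / ε)) - 1) ∂(unitVol.prod unitVol)
      - ∫ p, h p.1 * h p.2 * C (p.1 / ε - p.2 / ε) ∂(unitVol.prod unitVol)| ≤
      B ^ 2 * (M ^ 2 * Real.exp M) * (2 * ∫ z in (0 : ℝ)..1, (1 + z / ε) ^ (-(2 * β))) := by
  have hM0 := decay_const_nonneg hM
  have hB0 : 0 ≤ B := (abs_nonneg _).trans (hB 0)
  have hκ := isDecayKernel_decayKernel hβ0 hβ1 hε le_rfl
  have hCle : ∀ x y, |C (x / ε - y / ε)| ≤ M := fun x y =>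
    (abs_cov_le_decayKernel hM hε x y).trans (mul_le_of_le_one_right hM0 (hκ.le_one x y))
  have hhh : ∀ x y, |h x * h y| ≤ B ^ 2 := fun x y => by
    rw [abs_mul, sq]
    exact mul_le_mul (hB x) (hB y) (abs_nonneg _) hB0
  have hm1 : Measurable fun p : ℝ × ℝ => h p.1 * h p.2 :=
    (hh.comp measurable_fst).mul (hh.comp measurable_snd)
  have hm2 : Measurable fun p : ℝ × ℝ => C (p.1 / ε - p.2 / ε) :=
    hC.comp ((measurable_fst.div_const ε).sub (measurable_snd.div_const ε))
  have i1 : Integrable (fun p : ℝ × ℝ => h p.1 * h p.2 * (Real.exp (C (p.1 / ε - p.2 / ε)) - 1))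
      (unitVol.prod unitVol) := by
    refine integrable_of_abs_le (B := B ^ 2 * (M * Real.exp M))
      (hm1.mul ((Real.measurable_exp.comp hm2).sub_const 1)) fun p => ?_
    rw [abs_mul]
    refine mul_le_mul (hhh _ _) ?_ (abs_nonneg _) (by positivity)
    exact (abs_exp_cov_sub_one_le hM hε hκ _ _).trans
      (mul_le_of_le_one_right (mul_nonneg hM0 (Real.exp_pos _).le) (hκ.le_one _ _))
  have i2 : Integrable (fun p : ℝ × ℝ => h p.1 * h p.2 * C (p.1 / ε - p.2 / ε))
      (unitVol.prod unitVol) := by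
    refine integrable_of_abs_le (B := B ^ 2 * M) (hm1.mul hm2) fun p => ?_
    rw [abs_mul]
    exact mul_le_mul (hhh _ _) (hCle _ _) (abs_nonneg _) (by positivity)
  have hφ := integral_prod_abs_sub_le (φ := fun z => (1 + z / ε) ^ (-(2 * β))) (by fun_prop)
    (intervalIntegrable_one_add_div_rpow hε (2 * β))
    (fun z hz => Real.rpow_nonneg (by have := div_nonneg hz hε.le; linarith) _)
  rw [← integral_sub i1 i2]
  refine abs_integral_le_integral_abs.trans ?_
  refine (integral_mono_of_nonneg (ae_of_all _ fun _ => abs_nonneg _)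
    (hφ.1.const_mul (B ^ 2 * (M ^ 2 * Real.exp M))) (ae_of_all _ fun p => ?_)).trans ?_
  · simp only []
    rw [← mul_sub, abs_mul, mul_assoc]
    refine mul_le_mul (hhh _ _) ?_ (abs_nonneg _) (by positivity)
    have hbase : 0 ≤ 1 + |p.1 - p.2| / ε := by positivity
    -- The quadratic Taylor remainder squares the kernel, which doubles the exponent and makes `β =
    -- 1/2` critical.
    have e : (1 + |p.1 - p.2| / ε) ^ (-(2 * β)) = decayKernel β ε p.1 p.2 ^ 2 := by
      rw [decayKernel, ← Real.rpow_natCast, ← Real.rpow_mul hbase]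
      congr 1
      push_cast
      ring
    rw [e]
    calc _ ≤ C (p.1 / ε - p.2 / ε) ^ 2 * Real.exp |C (p.1 / ε - p.2 / ε)| :=
          abs_exp_sub_one_sub_le _
      _ ≤ (M * decayKernel β ε p.1 p.2) ^ 2 * Real.exp M := by
          refine mul_le_mul ?_ (Real.exp_le_exp.2 (hCle _ _)) (Real.exp_pos _).le (sq_nonneg _)
          rw [← sq_abs (C _)]
          exact pow_le_pow_left₀ (abs_nonneg _) (abs_cov_le_decayKernel hM hε _ _) 2
      _ = _ := by ring
  · rw [integral_const_mul]
    exact mul_le_mul_of_nonneg_left hφ.2 (by positivity)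

end Field

/-! ### Leading order for `β < 1` -/

lemma ae_ne_unitVol_prod : ∀ᵐ p : ℝ × ℝ ∂(unitVol.prod unitVol), p.1 ≠ p.2 := by
  have hm : MeasurableSet {p : ℝ × ℝ | p.1 = p.2} :=
    measurableSet_eq_fun measurable_fst measurable_snd
  rw [ae_iff]
  simp only [ne_eq, not_not]
  rw [Measure.measure_prod_null hm]
  refine ae_of_all _ fun x => ?_
  have : Prod.mk x ⁻¹' {p : ℝ × ℝ | p.1 = p.2} = {x} := by
    ext y
    simp [eq_comm]
  simp [this]

lemma integral_rpow_neg {β : ℝ} (hβ1 : β < 1) {δ : ℝ} :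
    ∫ z in (0 : ℝ)..δ, z ^ (-β) = δ ^ (1 - β) / (1 - β) := by
  rw [integral_rpow (Or.inl (by linarith)), neg_add_eq_sub, Real.zero_rpow (by linarith), sub_zero]

/-- The profile of the error in the approximation of the covariance by its tail. -/
noncomputable def errorProfile (β δ a b z : ℝ) : ℝ :=
  a * indicator {z | z ≤ δ} (fun z => z ^ (-β)) z + b * z ^ (-β)

lemma errorProfile_integral {β δ a b : ℝ} (hβ1 : β < 1) (hδ : δ ∈ Ioc (0 : ℝ) 1) :
    IntervalIntegrable (errorProfile β δ a b) volume 0 1 ∧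
      ∫ z in (0 : ℝ)..1, errorProfile β δ a b z = (a * δ ^ (1 - β) + b) / (1 - β) := by
  have i0 : IntervalIntegrable (fun z : ℝ => z ^ (-β)) volume 0 1 :=
    intervalIntegral.intervalIntegrable_rpow' (by linarith)
  have i1 : IntervalIntegrable (indicator {z | z ≤ δ} fun z : ℝ => z ^ (-β)) volume 0 1 := by
    rw [intervalIntegrable_iff_integrableOn_Ioc_of_le zero_le_one] at i0 ⊢
    exact i0.indicator measurableSet_Iic
  refine ⟨(i1.const_mul a).add (i0.const_mul b), ?_⟩
  unfold errorProfile
  rw [intervalIntegral.integral_add (i1.const_mul a) (i0.const_mul b),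
    intervalIntegral.integral_const_mul, intervalIntegral.integral_const_mul,
    intervalIntegral.integral_indicator (Ioc_subset_Icc_self hδ), integral_rpow_neg hβ1,
    integral_rpow_neg hβ1, Real.one_rpow]
  ring

lemma integrable_tailKernel {β : ℝ} (hβ1 : β < 1) (Cplus Cminus : ℝ) {h : ℝ → ℝ} {B : ℝ}
    (hh : Measurable h) (hB : ∀ x, |h x| ≤ B) :
    Integrable (fun p : ℝ × ℝ =>
      h p.1 * ((if p.2 < p.1 then Cplus else Cminus) * |p.1 - p.2| ^ (-β)) * h p.2)
      (unitVol.prod unitVol) := by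
  have hB0 : 0 ≤ B := (abs_nonneg _).trans (hB 0)
  have hhh : ∀ x y, |h x * h y| ≤ B ^ 2 := fun x y => by
    rw [abs_mul, sq]
    exact mul_le_mul (hB x) (hB y) (abs_nonneg _) hB0
  have hpow := integral_prod_abs_sub_le (φ := fun z => z ^ (-β)) (by fun_prop)
    (intervalIntegral.intervalIntegrable_rpow' (by linarith)) (fun z hz => Real.rpow_nonneg hz _)
  have hmi : Measurable fun p : ℝ × ℝ => if p.2 < p.1 then Cplus else Cminus :=
    Measurable.ite (measurableSet_lt measurable_snd measurable_fst) measurable_const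
      measurable_const
  refine (hpow.1.const_mul (B ^ 2 * (|Cplus| + |Cminus|))).mono' ?_ (ae_of_all _ fun p => ?_)
  · refine Measurable.aestronglyMeasurable ?_
    exact ((hh.comp measurable_fst).mul (hmi.mul
      ((measurable_fst.sub measurable_snd).abs.pow_const _))).mul (hh.comp measurable_snd)
  · have e : h p.1 * ((if p.2 < p.1 then Cplus else Cminus) * |p.1 - p.2| ^ (-β)) * h p.2 =
        h p.1 * h p.2 * (if p.2 < p.1 then Cplus else Cminus) * |p.1 - p.2| ^ (-β) := by ring
    rw [e, Real.norm_eq_abs, abs_mul, abs_mul,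
      abs_of_nonneg (Real.rpow_nonneg (abs_nonneg (p.1 - p.2)) (-β))]
    refine mul_le_mul_of_nonneg_right ?_ (Real.rpow_nonneg (abs_nonneg _) _)
    refine mul_le_mul (hhh _ _) ?_ (abs_nonneg _) (by positivity)
    split_ifs
    · linarith [abs_nonneg Cminus]
    · linarith [abs_nonneg Cplus]

/-- The leading order of the variance for `β < 1`. -/
lemma leading_order_of_lt {β : ℝ} (hβ0 : 0 < β) (hβ1 : β < 1) {C γ : ℝ → ℝ} {Cplus Cminus M Λ B : ℝ}
    (hC : Measurable C) (hM : ∀ x, |C x| ≤ M * (1 + |x|) ^ (-β)) (hγ0 : ∀ t, 0 ≤ t → 0 ≤ γ t)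
    (hγΛ : ∀ t, 0 ≤ t → γ t ≤ Λ)
    (hlim : ∀ x : ℝ, 0 < x →
      |x ^ β * C x - Cplus| ≤ γ (1 / x) ∧ |x ^ β * C (-x) - Cminus| ≤ γ (1 / x))
    (hmono : MonotoneOn γ (Ioi 0)) {h : ℝ → ℝ} (hh : Measurable h) (hB : ∀ x, |h x| ≤ B)
    {ε δ : ℝ} (hε : 0 < ε) (hδ : δ ∈ Ioc (0 : ℝ) 1) :
    |ε ^ (-β) * ∫ p, h p.1 * h p.2 * C (p.1 / ε - p.2 / ε) ∂(unitVol.prod unitVol)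
      - ∫ p, h p.1 * ((if p.2 < p.1 then Cplus else Cminus) * |p.1 - p.2| ^ (-β)) * h p.2
        ∂(unitVol.prod unitVol)| ≤
      B ^ 2 * (2 * (1 + Λ) / (1 - β)) * (δ ^ (1 - β) + γ (δ⁻¹ * ε)) := by
  have h1β : 0 < 1 - β := by linarith
  have hM0 := decay_const_nonneg hM
  have hB0 : 0 ≤ B := (abs_nonneg _).trans (hB 0)
  have hΛ0 : 0 ≤ Λ := (hγ0 0 le_rfl).trans (hγΛ 0 le_rfl)
  have hδε : 0 < δ⁻¹ * ε := mul_pos (inv_pos.2 hδ.1) hε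
  have hγδ := hγ0 _ hδε.le
  have hκ := isDecayKernel_decayKernel hβ0 hβ1.le hε le_rfl
  have hCle : ∀ x y, |C (x / ε - y / ε)| ≤ M := fun x y =>
    (abs_cov_le_decayKernel hM hε x y).trans (mul_le_of_le_one_right hM0 (hκ.le_one x y))
  have hhh : ∀ x y, |h x * h y| ≤ B ^ 2 := fun x y => by
    rw [abs_mul, sq]
    exact mul_le_mul (hB x) (hB y) (abs_nonneg _) hB0
  have hm1 : Measurable fun p : ℝ × ℝ => h p.1 * h p.2 :=
    (hh.comp measurable_fst).mul (hh.comp measurable_snd)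
  have hm2 : Measurable fun p : ℝ × ℝ => C (p.1 / ε - p.2 / ε) :=
    hC.comp ((measurable_fst.div_const ε).sub (measurable_snd.div_const ε))
  have i1 : Integrable (fun p : ℝ × ℝ => h p.1 * h p.2 * C (p.1 / ε - p.2 / ε))
      (unitVol.prod unitVol) := by
    refine integrable_of_abs_le (B := B ^ 2 * M) (hm1.mul hm2) fun p => ?_
    rw [abs_mul]
    exact mul_le_mul (hhh _ _) (hCle _ _) (abs_nonneg _) (by positivity)
  have i2 := integrable_tailKernel hβ1 Cplus Cminus hh hB
  have hprof := errorProfile_integral (a := Λ) (b := γ (δ⁻¹ * ε)) hβ1 hδ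
  have hprofm : Measurable (errorProfile β δ Λ (γ (δ⁻¹ * ε))) := by
    unfold errorProfile
    exact ((Measurable.indicator (by fun_prop) measurableSet_Iic).const_mul Λ).add (by fun_prop)
  have hprod := integral_prod_abs_sub_le hprofm hprof.1 (fun z hz => by
    unfold errorProfile
    have h1 : 0 ≤ z ^ (-β) := Real.rpow_nonneg hz _
    have h2 : 0 ≤ indicator {z | z ≤ δ} (fun z : ℝ => z ^ (-β)) z := by
      rw [indicator_apply]
      split_ifs <;> simp [h1]
    positivity)
  rw [hprof.2] at hprod
  -- After rescaling, the error at distance `r` is at most `r^{-β} γ(ε / r)`. For `r ≤ δ` only the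
  -- bound `Λ` on `γ` is used; for `r > δ` monotonicity gives `γ(ε / r) ≤ γ(ε / δ)`.
  have key : ∀ r : ℝ, 0 < r → ∀ Cr c : ℝ, |(r / ε) ^ β * Cr - c| ≤ γ (1 / (r / ε)) →
      |ε ^ (-β) * Cr - c * r ^ (-β)| ≤ errorProfile β δ Λ (γ (δ⁻¹ * ε)) r := by
    intro r hr Cr c hc
    have hrβ : 0 < r ^ (-β) := Real.rpow_pos_of_pos hr _
    have e : ε ^ (-β) * Cr - c * r ^ (-β) = r ^ (-β) * ((r / ε) ^ β * Cr - c) := by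
      rw [Real.div_rpow hr.le hε.le, Real.rpow_neg hr.le, Real.rpow_neg hε.le]
      have := (Real.rpow_pos_of_pos hr β).ne'
      field_simp
    rw [e, abs_mul, abs_of_pos hrβ]
    rw [one_div_div] at hc
    have hεr : 0 < ε / r := div_pos hε hr
    refine (mul_le_mul_of_nonneg_left hc hrβ.le).trans ?_
    unfold errorProfile
    rw [indicator_apply]
    by_cases hrδ : r ≤ δ
    · rw [if_pos (by exact hrδ)]
      have h1 := mul_le_mul_of_nonneg_left (hγΛ _ hεr.le) hrβ.le
      have h2 := mul_nonneg hγδ hrβ.le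
      linarith
    · rw [if_neg (by exact hrδ), mul_zero, zero_add, mul_comm]
      refine mul_le_mul_of_nonneg_right (hmono hεr hδε ?_) hrβ.le
      rw [div_eq_inv_mul]
      exact mul_le_mul_of_nonneg_right (inv_anti₀ hδ.1 (not_le.1 hrδ).le) hε.le
  rw [← integral_const_mul, ← integral_sub (i1.const_mul _) i2]
  refine abs_integral_le_integral_abs.trans ?_
  refine (integral_mono_of_nonneg (ae_of_all _ fun _ => abs_nonneg _)
    (hprod.1.const_mul (B ^ 2)) ?_).trans ?_
  · filter_upwards [ae_ne_unitVol_prod] with p hp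
    have e : ε ^ (-β) * (h p.1 * h p.2 * C (p.1 / ε - p.2 / ε)) -
        h p.1 * ((if p.2 < p.1 then Cplus else Cminus) * |p.1 - p.2| ^ (-β)) * h p.2 =
        h p.1 * h p.2 * (ε ^ (-β) * C (p.1 / ε - p.2 / ε) -
          (if p.2 < p.1 then Cplus else Cminus) * |p.1 - p.2| ^ (-β)) := by ring
    rw [e, abs_mul]
    refine mul_le_mul (hhh _ _) ?_ (abs_nonneg _) (by positivity)
    have hr : 0 < |p.1 - p.2| := abs_pos.2 (sub_ne_zero.2 hp)
    refine key _ hr _ _ ?_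
    have hx := hlim (|p.1 - p.2| / ε) (div_pos hr hε)
    rw [← sub_div]
    by_cases hlt : p.2 < p.1
    · rw [if_pos hlt]
      have h1 := hx.1
      rwa [abs_of_pos (sub_pos.2 hlt)] at h1 ⊢
    · rw [if_neg hlt]
      have h1 := hx.2
      rwa [abs_of_nonpos (by linarith : p.1 - p.2 ≤ 0), neg_div, neg_neg, ← neg_div,
        ← abs_of_nonpos (by linarith : p.1 - p.2 ≤ 0)] at h1
  · rw [integral_const_mul, mul_assoc]
    refine mul_le_mul_of_nonneg_left (hprod.2.trans ?_) (by positivity)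
    rw [← mul_div_assoc, div_mul_eq_mul_div, div_le_div_iff_of_pos_right h1β, mul_assoc]
    have hd : 0 ≤ δ ^ (1 - β) := Real.rpow_nonneg hδ.1.le _
    nlinarith [mul_nonneg hΛ0 hγδ]

/-! ### Leading order for `β = 1` -/

/-- The part of the unit interval which a translation moves out of it. -/
lemma unitVol_translate_le (z : ℝ) :
    ∫ x, indicator {x | x - z ∉ Ioc (0 : ℝ) 1} (fun _ => (1 : ℝ)) x ∂unitVol ≤ |z| := by
  have hm : MeasurableSet {x : ℝ | x - z ∉ Ioc (0 : ℝ) 1} :=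
    ((measurable_id.sub_const z) measurableSet_Ioc).compl
  rw [integral_indicator_const _ hm, smul_eq_mul, mul_one, measureReal_def]
  refine ENNReal.toReal_le_of_le_ofReal (abs_nonneg z) ?_
  rw [Measure.restrict_apply hm]
  have hsub : {x | x - z ∉ Ioc (0 : ℝ) 1} ∩ Ioc 0 1 ⊆ Ioc 0 z ∪ Ioc (1 + z) 1 := by
    rintro x ⟨hx, hx0, hx1⟩
    by_cases h : x ≤ z
    · exact Or.inl ⟨hx0, h⟩
    · refine Or.inr ⟨?_, hx1⟩
      by_contra h'
      exact hx ⟨by linarith, by linarith⟩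
  refine (measure_mono hsub).trans ((measure_union_le _ _).trans ?_)
  rw [Real.volume_Ioc, Real.volume_Ioc]
  rcases le_total 0 z with hz | hz
  · rw [ENNReal.ofReal_of_nonpos (by linarith : 1 - (1 + z) ≤ 0), add_zero, sub_zero,
      abs_of_nonneg hz]
  · rw [ENNReal.ofReal_of_nonpos (by linarith : z - 0 ≤ 0), zero_add, abs_of_nonpos hz]
    exact ENNReal.ofReal_le_ofReal (by linarith)

/-- The leading order of the variance for `β = 1`. -/
lemma leading_order_of_eq {C : ℝ → ℝ} {M B L : ℝ}
    (hC : Measurable C) (hM : ∀ x, |C x| ≤ M * (1 + |x|) ^ (-(1 : ℝ)))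
    {h : ℝ → ℝ} (hh : Measurable h) (hB : ∀ x, |h x| ≤ B)
    (hL : ∀ x y, |h x - h y| ≤ L * |x - y|) {ε : ℝ} (hε : 0 < ε) :
    |∫ p, h p.1 * h p.2 * C (p.1 / ε - p.2 / ε) ∂(unitVol.prod unitVol)
      - (∫ x, h x ^ 2 ∂unitVol) * ∫ z in (-1 : ℝ)..1, C (z / ε)| ≤
      2 * (B * L + B ^ 2) * M * ε := by
  have hM0 := decay_const_nonneg hM
  have hB0 : 0 ≤ B := (abs_nonneg _).trans (hB 0)
  have hL0 : 0 ≤ L := by simpa using (abs_nonneg _).trans (hL 1 0)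
  set ρ : Measure ℝ := volume.restrict (Ioc (-1) 1) with hρ
  -- Extending one factor by zero lets the substitution `z = x - y` run over the fixed interval
  -- `(-1, 1]`.
  set h₀ : ℝ → ℝ := indicator (Ioc 0 1) h with hh₀
  have hh₀m : Measurable h₀ := hh.indicator measurableSet_Ioc
  have hh₀B : ∀ x, |h₀ x| ≤ B := by
    intro x
    rw [hh₀, indicator_apply]
    split_ifs
    · exact hB x
    · simpa using hB0
  have hCM : ∀ x, |C x| ≤ M := fun x => (hM x).trans (mul_le_of_le_one_right hM0
    (Real.rpow_le_one_of_one_le_of_nonpos (by linarith [abs_nonneg x]) (by norm_num)))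
  have bound3 : ∀ a b c : ℝ, |a| ≤ B → |b| ≤ B → |c| ≤ M → |a * b * c| ≤ B * B * M := by
    intro a b c ha hb hc
    rw [abs_mul, abs_mul]
    gcongr
  have i0 : Integrable (fun p : ℝ × ℝ => h p.1 * h p.2 * C (p.1 / ε - p.2 / ε))
      (unitVol.prod unitVol) :=
    integrable_of_abs_le (((hh.comp measurable_fst).mul (hh.comp measurable_snd)).mul
      (hC.comp ((measurable_fst.div_const ε).sub (measurable_snd.div_const ε))))
      fun p => bound3 _ _ _ (hB _) (hB _) (hCM _)
  have i1 : Integrable (Function.uncurry fun x z : ℝ => h x * h₀ (x - z) * C (z / ε))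
      (unitVol.prod ρ) :=
    integrable_of_abs_le (((hh.comp measurable_fst).mul
      (hh₀m.comp (measurable_fst.sub measurable_snd))).mul
      (hC.comp (measurable_snd.div_const ε))) fun p => bound3 _ _ _ (hB _) (hh₀B _) (hCM _)
  have step : ∫ p, h p.1 * h p.2 * C (p.1 / ε - p.2 / ε) ∂(unitVol.prod unitVol) =
      ∫ z, ∫ x, h x * h₀ (x - z) * C (z / ε) ∂unitVol ∂ρ := by
    rw [integral_prod _ i0, ← integral_integral_swap i1]
    refine integral_congr_ae (ae_mem_unitVol.mono fun x hx => ?_)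
    simp only []
    calc ∫ y, h x * h y * C (x / ε - y / ε) ∂unitVol
        = ∫ y, h x * h₀ y * C (x / ε - y / ε) := by
          rw [← integral_indicator measurableSet_Ioc]
          congr 1
          funext y
          simp only [hh₀, indicator_apply]
          split_ifs <;> simp
      _ = ∫ z, h x * h₀ (x - z) * C (x / ε - (x - z) / ε) :=
          (integral_sub_left_eq_self (fun y => h x * h₀ y * C (x / ε - y / ε)) volume x).symm
      _ = ∫ z, h x * h₀ (x - z) * C (z / ε) := by
          congr 1
          funext z
          rw [← sub_div, sub_sub_cancel]
      _ = ∫ z, h x * h₀ (x - z) * C (z / ε) ∂ρ := by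
          refine (setIntegral_eq_integral_of_forall_compl_eq_zero fun z hz => ?_).symm
          have : h₀ (x - z) = 0 := by
            rw [hh₀, indicator_of_notMem]
            exact fun hxz => hz ⟨by linarith [hxz.2, hx.1], by linarith [hxz.1, hx.2]⟩
          rw [this, mul_zero, zero_mul]
  have step2 : (∫ x, h x ^ 2 ∂unitVol) * ∫ z in (-1 : ℝ)..1, C (z / ε) =
      ∫ z, (∫ x, h x ^ 2 ∂unitVol) * C (z / ε) ∂ρ := by
    rw [intervalIntegral.integral_of_le (by norm_num), integral_const_mul]
  have iC : Integrable (fun z => (∫ x, h x ^ 2 ∂unitVol) * C (z / ε)) ρ :=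
    (integrable_of_abs_le (hC.comp (measurable_id.div_const ε)) fun z => hCM _).const_mul _
  have i2 : Integrable (fun z => ∫ x, h x * h₀ (x - z) * C (z / ε) ∂unitVol) ρ :=
    i1.integral_prod_right
  rw [step, step2, ← integral_sub i2 iC]
  -- At lag `z` the autocorrelation of `h` differs from `∫ h²` by `O(|z|)`: the Lipschitz bound
  -- accounts for the overlap, boundedness for the part shifted out. The decay of `C` cancels the
  -- factor `|z|`, leaving `O(ε)` without a logarithm.
  have hpt : ∀ z, ‖∫ x, h x * h₀ (x - z) * C (z / ε) ∂unitVol -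
      (∫ x, h x ^ 2 ∂unitVol) * C (z / ε)‖ ≤ (B * L + B ^ 2) * M * ε := by
    intro z
    have j1 : Integrable (fun x => h x * h₀ (x - z)) unitVol :=
      integrable_of_abs_le (B := B * B) (hh.mul (hh₀m.comp (measurable_id.sub_const z)))
        fun x => by
          rw [abs_mul]
          exact mul_le_mul (hB _) (hh₀B _) (abs_nonneg _) hB0
    have j2 : Integrable (fun x => h x ^ 2) unitVol :=
      integrable_of_abs_le (B := B ^ 2) (hh.pow_const 2) fun x => by
        rw [abs_pow]
        exact pow_le_pow_left₀ (abs_nonneg _) (hB x) 2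
    rw [integral_mul_const, ← sub_mul, ← integral_sub j1 j2, norm_mul]
    have hD : ‖∫ x, (h x * h₀ (x - z) - h x ^ 2) ∂unitVol‖ ≤ (B * L + B ^ 2) * |z| := by
      have hm : MeasurableSet {x : ℝ | x - z ∉ Ioc (0 : ℝ) 1} :=
        ((measurable_id.sub_const z) measurableSet_Ioc).compl
      have ji : Integrable (indicator {x : ℝ | x - z ∉ Ioc (0 : ℝ) 1} fun _ => (1 : ℝ)) unitVol :=
        (integrable_const 1).indicator hm
      refine (norm_integral_le_of_norm_le (((integrable_const (B * L * |z|)).add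
        (ji.const_mul (B ^ 2)))) (ae_of_all _ fun x => ?_)).trans ?_
      · rw [Real.norm_eq_abs, sq, ← mul_sub, abs_mul]
        simp only [Pi.add_apply]
        by_cases hx : x - z ∈ Ioc (0 : ℝ) 1
        · rw [indicator_of_notMem (by exact not_not.2 hx), mul_zero, add_zero, hh₀,
            indicator_of_mem hx, mul_assoc]
          refine mul_le_mul (hB x) ((hL _ _).trans (le_of_eq ?_)) (abs_nonneg _) hB0
          rw [sub_sub_cancel_left, abs_neg]
        · rw [indicator_of_mem (by exact hx), mul_one, hh₀, indicator_of_notMem hx, zero_sub,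
            abs_neg]
          have h1 : |h x| * |h x| ≤ B * B := mul_le_mul (hB x) (hB x) (abs_nonneg _) hB0
          have h2 : 0 ≤ B * L * |z| := by positivity
          nlinarith
      · simp only [Pi.add_apply]
        rw [integral_add (integrable_const _) (ji.const_mul _), integral_const_mul (B ^ 2), integral_const,
          probReal_univ, one_smul]
        have := mul_le_mul_of_nonneg_left (unitVol_translate_le z) (sq_nonneg B)
        linarith
    have hCz : |z| * |C (z / ε)| ≤ M * ε := by
      have hz := hM (z / ε)
      rw [abs_div, abs_of_pos hε, Real.rpow_neg_one] at hz
      have hpos : 0 < 1 + |z| / ε := by positivity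
      calc |z| * |C (z / ε)| ≤ |z| * (M * (1 + |z| / ε)⁻¹) :=
            mul_le_mul_of_nonneg_left hz (abs_nonneg z)
        _ = M * ε * ((|z| / ε) * (1 + |z| / ε)⁻¹) := by field_simp
        _ ≤ M * ε * 1 := by
            refine mul_le_mul_of_nonneg_left ?_ (by positivity)
            rw [← div_eq_mul_inv, div_le_one hpos]
            linarith
        _ = M * ε := mul_one _
    calc _ ≤ (B * L + B ^ 2) * |z| * |C (z / ε)| :=
          mul_le_mul_of_nonneg_right hD (abs_nonneg _)
      _ = (B * L + B ^ 2) * (|z| * |C (z / ε)|) := by ring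
      _ ≤ (B * L + B ^ 2) * (M * ε) := mul_le_mul_of_nonneg_left hCz (by positivity)
      _ = _ := by ring
  refine (norm_integral_le_of_norm_le_const (ae_of_all _ hpt)).trans (le_of_eq ?_)
  have : ρ.real univ = 2 := by
    rw [hρ, measureReal_restrict_apply MeasurableSet.univ, univ_inter, measureReal_def,
      Real.volume_Ioc]
    norm_num
  rw [this]
  ring

/-! ### Comparison of the error terms with `Π_β` -/

section Rates

variable {β : ℝ} {γ : ℝ → ℝ}

lemma infTerm_bddBelow (hγ0 : ∀ t, 0 ≤ t → 0 ≤ γ t) {ε : ℝ} (hε : 0 < ε) :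
    ∀ a ∈ (fun δ : ℝ => δ ^ (1 - β) + γ (δ⁻¹ * ε)) '' Ioc 0 1, 0 ≤ a := by
  rintro _ ⟨δ, hδ, rfl⟩
  exact add_nonneg (Real.rpow_nonneg hδ.1.le _)
    (hγ0 _ (mul_nonneg (inv_nonneg.2 hδ.1.le) hε.le))

lemma infTerm_nonneg (hγ0 : ∀ t, 0 ≤ t → 0 ≤ γ t) {ε : ℝ} (hε : 0 < ε) : 0 ≤ infTerm β γ ε :=
  Real.sInf_nonneg (infTerm_bddBelow hγ0 hε)

lemma le_mul_infTerm {ε a K : ℝ} (hK : 0 < K)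
    (h : ∀ δ ∈ Ioc (0 : ℝ) 1, a ≤ K * (δ ^ (1 - β) + γ (δ⁻¹ * ε))) : a ≤ K * infTerm β γ ε := by
  rw [← div_le_iff₀' hK]
  refine le_csInf ⟨_, 1, ⟨one_pos, le_rfl⟩, rfl⟩ ?_
  rintro _ ⟨δ, hδ, rfl⟩
  rw [div_le_iff₀' hK]
  exact h δ hδ

/-- A nontrivial covariance is not exactly homogeneous near the origin. -/
lemma exists_rate_pos (hβ0 : 0 < β) {C : ℝ → ℝ} {M Cplus : ℝ} (hM : ∀ x, |C x| ≤ M)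
    (hC0 : 0 < C 0) (hC : HolderAtZero C)
    (hlim : ∀ x : ℝ, 0 < x → |x ^ β * C x - Cplus| ≤ γ (1 / x)) : ∃ t, 0 < t ∧ 0 < γ t := by
  -- If `γ` were never positive, `x^β C x` would equal `Cplus` for all `x > 0`. Letting `x` tend to
  -- `0` gives `Cplus = 0`, so `C` vanishes on the positive axis, against Hölder continuity at `0`
  -- and `C 0 > 0`.
  by_contra! hcon
  have heq : ∀ x : ℝ, 0 < x → x ^ β * C x = Cplus := fun x hx => by
    have h1 := (hlim x hx).trans (hcon (1 / x) (by positivity))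
    exact sub_eq_zero.1 (abs_eq_zero.1 (le_antisymm h1 (abs_nonneg _)))
  have hpow : Tendsto (fun x : ℝ => x ^ β) (𝓝[>] 0) (𝓝 0) := by
    have h := (Real.continuousAt_rpow_const 0 β (Or.inr hβ0.le)).tendsto
    rw [Real.zero_rpow hβ0.ne'] at h
    exact h.mono_left nhdsWithin_le_nhds
  have hzero : Tendsto (fun _ : ℝ => Cplus) (𝓝[>] (0 : ℝ)) (𝓝 0) := by
    have h1 : Tendsto (fun x : ℝ => x ^ β * C x) (𝓝[>] 0) (𝓝 0) := by
      refine squeeze_zero_norm' (a := fun x : ℝ => x ^ β * M) ?_ (by simpa using hpow.mul_const M)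
      filter_upwards [self_mem_nhdsWithin] with x hx
      have hx0 : 0 ≤ x ^ β := Real.rpow_nonneg (le_of_lt hx) _
      rw [norm_mul, Real.norm_of_nonneg hx0]
      exact mul_le_mul_of_nonneg_left (hM x) hx0
    refine h1.congr' ?_
    filter_upwards [self_mem_nhdsWithin] with x hx using heq x hx
  have hCp : Cplus = 0 := tendsto_nhds_unique tendsto_const_nhds hzero
  obtain ⟨α, N, r, hα, hr, hN⟩ := hC
  have hval : ∀ᶠ x : ℝ in 𝓝[>] 0, C 0 ≤ N * x ^ α := by
    filter_upwards [Ioc_mem_nhdsGT hr] with x hx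
    have h1 := hN x (by rw [abs_of_pos hx.1]; exact hx.2)
    have h2 : C x = 0 := by
      have h := heq x hx.1
      rw [hCp] at h
      exact (mul_eq_zero.1 h).resolve_left (Real.rpow_pos_of_pos hx.1 β).ne'
    rw [h2, zero_sub, abs_neg, abs_of_pos hC0, abs_of_pos hx.1] at h1
    exact h1
  have hα0 : Tendsto (fun x : ℝ => N * x ^ α) (𝓝[>] 0) (𝓝 0) := by
    have h := (Real.continuousAt_rpow_const 0 α (Or.inr hα.le)).tendsto
    rw [Real.zero_rpow hα.ne'] at h
    simpa using (h.mono_left nhdsWithin_le_nhds).const_mul N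
  exact absurd (ge_of_tendsto hα0 hval) (not_le.2 hC0)

/-- Fix `t` with `γ t > 0`. If `ε / δ ≥ t`, monotonicity keeps `γ(ε / δ)` above `γ t`; otherwise `δ
> ε / t`, and `δ^{1-β}` is at least a multiple of `ε^{1-β}`. -/
lemma exists_le_infTerm (hβ1 : β < 1) (hγ0 : ∀ t, 0 ≤ t → 0 ≤ γ t)
    (hmono : MonotoneOn γ (Ioi 0)) (hpos : ∃ t, 0 < t ∧ 0 < γ t) :
    ∃ K : ℝ, 0 < K ∧ ∀ ε ∈ Ioo (0 : ℝ) 1, ε ^ (1 - β) ≤ K * infTerm β γ ε := by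
  obtain ⟨t, ht, hγt⟩ := hpos
  have h1β : 0 < 1 - β := by linarith
  have htp : 0 < t ^ (1 - β) := Real.rpow_pos_of_pos ht _
  refine ⟨(γ t)⁻¹ + t ^ (1 - β), by positivity, fun ε hε => ?_⟩
  refine le_mul_infTerm (by positivity) fun δ hδ => ?_
  have hδp : 0 < δ ^ (1 - β) := Real.rpow_pos_of_pos hδ.1 _
  have hγδ := hγ0 (δ⁻¹ * ε) (mul_nonneg (inv_nonneg.2 hδ.1.le) hε.1.le)
  have hi : 0 < (γ t)⁻¹ := inv_pos.2 hγt
  have hε1 : ε ^ (1 - β) ≤ 1 := Real.rpow_le_one hε.1.le hε.2.le h1β.le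
  rcases le_total t (δ⁻¹ * ε) with h | h
  · have h1 : γ t ≤ γ (δ⁻¹ * ε) := hmono ht (lt_of_lt_of_le ht h) h
    have h2 : 1 ≤ (γ t)⁻¹ * γ (δ⁻¹ * ε) := by
      rw [inv_mul_eq_div, one_le_div hγt]
      exact h1
    nlinarith [mul_nonneg hi.le hδp.le, mul_nonneg htp.le hδp.le, mul_nonneg htp.le hγδ]
  · have h1 : ε ≤ t * δ := by
      rwa [inv_mul_eq_div, div_le_iff₀ hδ.1] at h
    have h2 : ε ^ (1 - β) ≤ t ^ (1 - β) * δ ^ (1 - β) := by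
      rw [← Real.mul_rpow ht.le hδ.1.le]
      exact Real.rpow_le_rpow hε.1.le h1 h1β.le
    nlinarith [mul_nonneg hi.le hδp.le, mul_nonneg hi.le hγδ, mul_nonneg htp.le hγδ]

lemma infTerm_le_PiRate (hβ1 : β < 1) {ε : ℝ} (hε : ε ∈ Ioo (0 : ℝ) 1) :
    infTerm β γ ε ≤ PiRate β γ ε := by
  rw [PiRate, if_neg hβ1.ne]
  have h1 : 0 ≤ ε ^ (1 / 2 : ℝ) * |Real.log ε| :=
    mul_nonneg (Real.rpow_nonneg hε.1.le _) (abs_nonneg _)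
  have h2 : 0 ≤ ε ^ min β (1 - β) := Real.rpow_nonneg hε.1.le _
  split_ifs <;> linarith

/-- All algebraic error terms are controlled by `Π_β` for `β < 1`. -/
lemma exists_algebraic_le_PiRate (hβ0 : 0 < β) (hβ1 : β < 1) (hγ0 : ∀ t, 0 ≤ t → 0 ≤ γ t)
    (hmono : MonotoneOn γ (Ioi 0)) (hpos : ∃ t, 0 < t ∧ 0 < γ t) :
    ∃ K : ℝ, 0 < K ∧ ∀ ε ∈ Ioo (0 : ℝ) 1, ε ^ β ≤ K * PiRate β γ ε ∧
      ε ^ (-β) * (∫ z in (0 : ℝ)..1, (1 + z / ε) ^ (-(2 * β))) ≤ K * PiRate β γ ε := by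
  obtain ⟨K₁, hK₁, hinf⟩ := exists_le_infTerm hβ1 hγ0 hmono hpos
  have hmin : β ≠ 1 / 2 → ∀ ε ∈ Ioo (0 : ℝ) 1, ε ^ min β (1 - β) ≤ PiRate β γ ε := by
    intro hβ ε hε
    rw [PiRate, if_neg hβ1.ne, if_neg hβ]
    linarith [infTerm_nonneg (β := β) hγ0 hε.1]
  rcases lt_trichotomy β (1 / 2) with hβ | hβ | hβ
  · have hc : 1 ≤ 2 / (1 - 2 * β) := by
      rw [one_le_div (by linarith)]
      linarith
    refine ⟨2 / (1 - 2 * β), by linarith, fun ε hε => ?_⟩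
    have h1 : ε ^ β ≤ PiRate β γ ε := by
      have h := hmin hβ.ne ε hε
      rwa [min_eq_left (by linarith)] at h
    have hε0 : 0 ≤ ε ^ β := Real.rpow_nonneg hε.1.le _
    refine ⟨h1.trans (le_mul_of_one_le_left (hε0.trans h1) hc), ?_⟩
    calc _ ≤ ε ^ (-β) * (2 / (1 - 2 * β) * ε ^ (2 * β)) :=
          mul_le_mul_of_nonneg_left (integral_one_add_div_le_of_lt hε.1 hε.2 (by linarith)
            (by linarith)) (Real.rpow_nonneg hε.1.le _)
      _ = 2 / (1 - 2 * β) * ε ^ β := by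
          rw [mul_left_comm, ← Real.rpow_add hε.1]
          congr 2
          ring
      _ ≤ _ := mul_le_mul_of_nonneg_left h1 (by linarith)
  -- Here the explicit term `ε^{1/2} |log ε|` does not control `ε^{1/2}` as `ε` tends to `1`; that
  -- power has to come from the infimum.
  · refine ⟨1 + K₁, by linarith, fun ε hε => ?_⟩
    have hI0 := infTerm_nonneg (β := β) hγ0 hε.1
    have h1 : ε ^ (1 / 2 : ℝ) ≤ K₁ * infTerm β γ ε := by
      have h := hinf ε hε
      rwa [show 1 - β = 1 / 2 by linarith] at h
    have hl : 0 ≤ ε ^ (1 / 2 : ℝ) * |Real.log ε| :=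
      mul_nonneg (Real.rpow_nonneg hε.1.le _) (abs_nonneg _)
    have hP : PiRate β γ ε = ε ^ (1 / 2 : ℝ) * |Real.log ε| + infTerm β γ ε := by
      rw [PiRate, if_neg hβ1.ne, if_pos hβ]
    have hsum : ε ^ (1 / 2 : ℝ) * (1 + |Real.log ε|) ≤ (1 + K₁) * PiRate β γ ε := by
      rw [hP]
      nlinarith [mul_nonneg hK₁.le hl]
    refine ⟨le_trans ?_ hsum, le_trans ?_ hsum⟩
    · rw [hβ, mul_add, mul_one]
      linarith
    · have h2 : (2 : ℝ) * β = 1 := by linarith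
      rw [h2]
      calc _ ≤ ε ^ (-β) * (ε * (1 + |Real.log ε|)) :=
            mul_le_mul_of_nonneg_left (integral_one_add_div_le_of_eq hε.1 hε.2)
              (Real.rpow_nonneg hε.1.le _)
        _ = ε ^ (1 / 2 : ℝ) * (1 + |Real.log ε|) := by
            rw [← mul_assoc, ← Real.rpow_add_one hε.1.ne']
            congr 2
            linarith
  · have hc : 0 ≤ 1 / (2 * β - 1) := by
      have : 0 < 2 * β - 1 := by linarith
      positivity
    refine ⟨1 + 1 / (2 * β - 1), by linarith, fun ε hε => ?_⟩
    have h1 : ε ^ (1 - β) ≤ PiRate β γ ε := by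
      have h := hmin hβ.ne' ε hε
      rwa [min_eq_right (by linarith)] at h
    have hε0 : 0 ≤ ε ^ (1 - β) := Real.rpow_nonneg hε.1.le _
    have h2 : ε ^ β ≤ ε ^ (1 - β) :=
      Real.rpow_le_rpow_of_exponent_ge hε.1 hε.2.le (by linarith)
    refine ⟨by nlinarith [mul_nonneg hc (hε0.trans h1)], ?_⟩
    calc _ ≤ ε ^ (-β) * (1 / (2 * β - 1) * ε) :=
          mul_le_mul_of_nonneg_left (integral_one_add_div_le_of_gt hε.1 (by linarith))
            (Real.rpow_nonneg hε.1.le _)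
      _ = 1 / (2 * β - 1) * ε ^ (1 - β) := by
          rw [mul_left_comm, ← Real.rpow_add_one hε.1.ne']
          congr 2
          ring
      _ ≤ 1 / (2 * β - 1) * PiRate β γ ε := mul_le_mul_of_nonneg_left h1 hc
      _ ≤ _ := by nlinarith [hε0.trans h1]

end Rates

/-! ### Convergence of the rescaled variance -/

/-- Convergence of the rescaled variance for `β < 1`. -/
lemma variance_rate_of_lt {β : ℝ} (hβ0 : 0 < β) (hβ1 : β < 1) {C γ V : ℝ → ℝ}
    {Cbar Cplus Cminus M B K₀ : ℝ} (hC : Measurable C) (hC0 : 0 < C 0) (hCh : HolderAtZero C)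
    (hM : ∀ x, |C x| ≤ M * (1 + |x|) ^ (-β))
    (hhom : AsymptoticallyHomogeneous β C γ Cbar Cplus Cminus)
    {h : ℝ → ℝ} (hh : Measurable h) (hB : ∀ x, |h x| ≤ B) (hK₀ : 0 ≤ K₀)
    (hV : ∀ ε ∈ Ioo (0 : ℝ) 1, ∀ S, 2 * (∫ z in (0 : ℝ)..1, (1 + z / ε) ^ (-β)) ≤ S →
      |V ε - Real.exp (C 0) * ∫ p, h p.1 * h p.2 * (Real.exp (C (p.1 / ε - p.2 / ε)) - 1)
        ∂(unitVol.prod unitVol)| ≤ K₀ * S ^ 2) :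
    ∃ K : ℝ, ∀ ε ∈ Ioo (0 : ℝ) 1, |ε ^ (-β) * V ε - Real.exp (C 0) *
      ∫ p, h p.1 * ((if p.2 < p.1 then Cplus else Cminus) * |p.1 - p.2| ^ (-β)) * h p.2
        ∂(unitVol.prod unitVol)| ≤ K * PiRate β γ ε := by
  have hM0 := decay_const_nonneg hM
  have h1β : 0 < 1 - β := by linarith
  have hγ0 := hhom.rate.nonneg
  have hmono := hhom.mono hβ1
  obtain ⟨Λ, hΛ⟩ := hhom.rate.bounded
  have hΛ0 : 0 ≤ Λ := (hγ0 0 le_rfl).trans (hΛ 0 le_rfl)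
  have hCM : ∀ x, |C x| ≤ M := fun x => (hM x).trans (mul_le_of_le_one_right hM0
    (Real.rpow_le_one_of_one_le_of_nonpos (by linarith [abs_nonneg x]) (by linarith)))
  have hpos := exists_rate_pos hβ0 hCM hC0 hCh fun x hx => (hhom.lt_one hβ1 x hx).1
  obtain ⟨K₁, hK₁, halg⟩ := exists_algebraic_le_PiRate hβ0 hβ1 hγ0 hmono hpos
  set E := Real.exp (C 0) with hE
  have hE0 : 0 < E := Real.exp_pos _
  set K₂ := B ^ 2 * (M ^ 2 * Real.exp M) with hK₂
  have hK₂0 : 0 ≤ K₂ := by positivity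
  -- The summand `1` makes the constant positive, as dividing by it in `le_mul_infTerm` requires.
  set K₃ := B ^ 2 * (2 * (1 + Λ) / (1 - β)) + 1 with hK₃
  have hK₃0 : 0 < K₃ := by positivity
  refine ⟨K₀ * (4 / (1 - β)) ^ 2 * K₁ + E * (K₂ * 2) * K₁ + E * K₃, fun ε hε => ?_⟩
  have hεβ : 0 < ε ^ (-β) := Real.rpow_pos_of_pos hε.1 _
  set A₁ := ∫ p, h p.1 * h p.2 * (Real.exp (C (p.1 / ε - p.2 / ε)) - 1) ∂(unitVol.prod unitVol)
    with hA₁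
  set A₂ := ∫ p, h p.1 * h p.2 * C (p.1 / ε - p.2 / ε) ∂(unitVol.prod unitVol) with hA₂
  set A₃ := ∫ p, h p.1 * ((if p.2 < p.1 then Cplus else Cminus) * |p.1 - p.2| ^ (-β)) * h p.2
    ∂(unitVol.prod unitVol) with hA₃
  obtain ⟨halg1, halg2⟩ := halg ε hε
  -- `S` is taken of order `ε^β`, so `S²` divided by `ε^β` leaves an error `ε^β`.
  have t1 : |ε ^ (-β) * (V ε - E * A₁)| ≤ K₀ * (4 / (1 - β)) ^ 2 * K₁ * PiRate β γ ε := by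
    have hS := hV ε hε (4 / (1 - β) * ε ^ β) (by
      have := integral_one_add_div_le_of_lt hε.1 hε.2 hβ0 hβ1
      calc _ ≤ 2 * (2 / (1 - β) * ε ^ β) := by linarith
        _ = _ := by ring)
    rw [abs_mul, abs_of_pos hεβ]
    calc _ ≤ ε ^ (-β) * (K₀ * (4 / (1 - β) * ε ^ β) ^ 2) :=
          mul_le_mul_of_nonneg_left hS hεβ.le
      _ = K₀ * (4 / (1 - β)) ^ 2 * (ε ^ (-β) * ε ^ β * ε ^ β) := by ring
      _ = K₀ * (4 / (1 - β)) ^ 2 * ε ^ β := by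
          rw [← Real.rpow_add hε.1, neg_add_cancel, Real.rpow_zero, one_mul]
      _ ≤ K₀ * (4 / (1 - β)) ^ 2 * (K₁ * PiRate β γ ε) :=
          mul_le_mul_of_nonneg_left halg1 (by positivity)
      _ = _ := by ring
  have t2 : |ε ^ (-β) * (E * (A₁ - A₂))| ≤ E * (K₂ * 2) * K₁ * PiRate β γ ε := by
    have hl := integral_exp_cov_sub_le hC hM hβ0 hβ1.le hε.1 hh hB
    rw [abs_mul, abs_mul, abs_of_pos hεβ, abs_of_pos hE0]
    calc _ ≤ ε ^ (-β) * (E * (K₂ * (2 * ∫ z in (0 : ℝ)..1, (1 + z / ε) ^ (-(2 * β))))) := by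
          gcongr
      _ = E * (K₂ * 2) * (ε ^ (-β) * ∫ z in (0 : ℝ)..1, (1 + z / ε) ^ (-(2 * β))) := by ring
      _ ≤ E * (K₂ * 2) * (K₁ * PiRate β γ ε) :=
          mul_le_mul_of_nonneg_left halg2 (by positivity)
      _ = _ := by ring
  have t3 : |E * (ε ^ (-β) * A₂ - A₃)| ≤ E * K₃ * PiRate β γ ε := by
    rw [abs_mul, abs_of_pos hE0, mul_assoc]
    refine mul_le_mul_of_nonneg_left ?_ hE0.le
    refine (le_mul_infTerm hK₃0 fun δ hδ => ?_).trans
      (mul_le_mul_of_nonneg_left (infTerm_le_PiRate hβ1 hε) hK₃0.le)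
    refine (leading_order_of_lt hβ0 hβ1 hC hM hγ0 hΛ (hhom.lt_one hβ1) hmono hh hB hε.1
      hδ).trans ?_
    refine mul_le_mul_of_nonneg_right (by linarith) ?_
    exact add_nonneg (Real.rpow_nonneg hδ.1.le _)
      (hγ0 _ (mul_nonneg (inv_nonneg.2 hδ.1.le) hε.1.le))
  have e : ε ^ (-β) * V ε - E * A₃ = ε ^ (-β) * (V ε - E * A₁) + ε ^ (-β) * (E * (A₁ - A₂)) +
      E * (ε ^ (-β) * A₂ - A₃) := by ring
  rw [e]
  refine (abs_add_le _ _).trans ((add_le_add_left (abs_add_le _ _) _).trans ?_)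
  linarith

/-- Asymptotic homogeneity for `β = 1`, extended to all scales. -/
lemma exists_log_average_le {C γ : ℝ → ℝ} {Cbar Cplus Cminus M : ℝ} (hCM : ∀ x, |C x| ≤ M)
    (hhom : AsymptoticallyHomogeneous 1 C γ Cbar Cplus Cminus) :
    ∃ K : ℝ, 0 ≤ K ∧ ∀ ε ∈ Ioo (0 : ℝ) 1,
      |1 / |Real.log ε| * (∫ x in (-(1 / ε))..(1 / ε), C x) - Cbar| ≤
        K * (|Real.log ε|⁻¹ + γ ε) := by
  obtain ⟨L₀, hL₀⟩ := eventually_atTop.1 (hhom.eq_one rfl)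
  have hM0 : 0 ≤ M := (abs_nonneg _).trans (hCM 0)
  set L := max L₀ 1 with hL
  have hL1 : 1 ≤ L := le_max_right _ _
  have hlogL : 0 ≤ Real.log L := Real.log_nonneg hL1
  refine ⟨1 + (M * (2 * L) + |Cbar| * Real.log L), by positivity, fun ε hε => ?_⟩
  have hlog : |Real.log ε| = Real.log (1 / ε) := by
    rw [abs_of_neg (Real.log_neg hε.1 hε.2), one_div, Real.log_inv]
  have hpos : 0 < |Real.log ε| := abs_pos.2 (Real.log_neg hε.1 hε.2).ne
  have hγε := hhom.rate.nonneg ε hε.1.le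
  have hi : 0 < |Real.log ε|⁻¹ := inv_pos.2 hpos
  have hk : 0 ≤ M * (2 * L) + |Cbar| * Real.log L := by positivity
  -- Either `1 / ε` lies in the range of the hypothesis, or `|log ε| ≤ log L`; then `|log ε|⁻¹` is
  -- bounded below and crude bounds suffice.
  rcases le_total L (1 / ε) with h | h
  · have h1 := hL₀ (1 / ε) ((le_max_left _ _).trans h)
    rw [one_div_one_div, ← hlog] at h1
    nlinarith [mul_nonneg hk hi.le, mul_nonneg hk hγε]
  · have hε' : 0 < 1 / ε := by
      have := hε.1
      positivity
    have h1 : |∫ x in (-(1 / ε))..(1 / ε), C x| ≤ M * (2 * L) := by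
      have h2 := intervalIntegral.norm_integral_le_of_norm_le_const (a := -(1 / ε)) (b := 1 / ε)
        (f := C) (C := M) fun x _ => hCM x
      rw [Real.norm_eq_abs, sub_neg_eq_add, abs_of_pos (by linarith : 0 < 1 / ε + 1 / ε)] at h2
      refine h2.trans (mul_le_mul_of_nonneg_left (by linarith) hM0)
    have h2 : |Cbar| ≤ |Cbar| * Real.log L * |Real.log ε|⁻¹ := by
      have h3 : |Real.log ε| ≤ Real.log L := by
        rw [hlog]
        exact Real.log_le_log hε' h
      have h4 : 1 ≤ Real.log L * |Real.log ε|⁻¹ := by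
        rw [← div_eq_mul_inv, one_le_div hpos]
        exact h3
      rw [mul_assoc]
      exact le_mul_of_one_le_right (abs_nonneg _) h4
    have h3 : |1 / |Real.log ε| * ∫ x in (-(1 / ε))..(1 / ε), C x| ≤
        M * (2 * L) * |Real.log ε|⁻¹ := by
      rw [abs_mul, one_div, abs_of_pos hi, mul_comm]
      exact mul_le_mul_of_nonneg_right h1 hi.le
    refine (abs_sub _ _).trans ?_
    nlinarith [mul_nonneg hk hγε]

/-- With `S = 2 ε (1 + |log ε|)`, this bounds `S² / (ε |log ε|)` by a multiple of `|log ε|⁻¹`,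
uniformly up to `ε = 1`. -/
lemma mul_one_add_abs_log_sq_le {ε : ℝ} (hε : ε ∈ Ioo (0 : ℝ) 1) :
    ε * (1 + |Real.log ε|) ^ 2 ≤ 4 := by
  have hl : |Real.log ε| = -Real.log ε := abs_of_neg (Real.log_neg hε.1 hε.2)
  set l := |Real.log ε| with hldef
  have h0 : 0 ≤ l := abs_nonneg _
  have hε' : ε = Real.exp (-l) := by rw [hl, neg_neg, Real.exp_log hε.1]
  have h1 : 1 + l ≤ 2 * Real.exp (l / 2) := by linarith [Real.add_one_le_exp (l / 2)]
  have h2 : (1 + l) ^ 2 ≤ (2 * Real.exp (l / 2)) ^ 2 := pow_le_pow_left₀ (by linarith) h1 2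
  calc ε * (1 + l) ^ 2 ≤ Real.exp (-l) * (2 * Real.exp (l / 2)) ^ 2 := by
        rw [← hε']
        exact mul_le_mul_of_nonneg_left h2 hε.1.le
    _ = 4 * Real.exp (-l + (l / 2 + l / 2)) := by
        rw [Real.exp_add, Real.exp_add]
        ring
    _ = 4 := by
        rw [add_halves, neg_add_cancel, Real.exp_zero, mul_one]

/-- Convergence of the rescaled variance for `β = 1`. -/
lemma variance_rate_of_eq {C γ V : ℝ → ℝ} {Cbar Cplus Cminus M B L K₀ : ℝ}
    (hC : Measurable C) (hM : ∀ x, |C x| ≤ M * (1 + |x|) ^ (-(1 : ℝ)))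
    (hhom : AsymptoticallyHomogeneous 1 C γ Cbar Cplus Cminus)
    {h : ℝ → ℝ} (hh : Measurable h) (hB : ∀ x, |h x| ≤ B)
    (hL : ∀ x y, |h x - h y| ≤ L * |x - y|) (hK₀ : 0 ≤ K₀)
    (hV : ∀ ε ∈ Ioo (0 : ℝ) 1, ∀ S, 2 * (∫ z in (0 : ℝ)..1, (1 + z / ε) ^ (-(1 : ℝ))) ≤ S →
      |V ε - Real.exp (C 0) * ∫ p, h p.1 * h p.2 * (Real.exp (C (p.1 / ε - p.2 / ε)) - 1)
        ∂(unitVol.prod unitVol)| ≤ K₀ * S ^ 2) :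
    ∃ K : ℝ, ∀ ε ∈ Ioo (0 : ℝ) 1, |(ε * |Real.log ε|)⁻¹ * V ε - Real.exp (C 0) *
      (Cbar * ∫ x, h x ^ 2 ∂unitVol)| ≤ K * (|Real.log ε|⁻¹ + γ ε) := by
  have hM0 := decay_const_nonneg hM
  have hB0 : 0 ≤ B := (abs_nonneg _).trans (hB 0)
  have hL0 : 0 ≤ L := by simpa using (abs_nonneg _).trans (hL 1 0)
  have hCM : ∀ x, |C x| ≤ M := fun x => (hM x).trans (mul_le_of_le_one_right hM0
    (Real.rpow_le_one_of_one_le_of_nonpos (by linarith [abs_nonneg x]) (by norm_num)))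
  obtain ⟨K₁, hK₁, havg⟩ := exists_log_average_le hCM hhom
  set E := Real.exp (C 0) with hE
  have hE0 : 0 < E := Real.exp_pos _
  set K₂ := B ^ 2 * (M ^ 2 * Real.exp M) with hK₂
  have hK₂0 : 0 ≤ K₂ := by positivity
  set K₃ := 2 * (B * L + B ^ 2) * M with hK₃
  have hK₃0 : 0 ≤ K₃ := by positivity
  set N := ∫ x, h x ^ 2 ∂unitVol with hN
  have hN0 : 0 ≤ N := integral_nonneg fun x => sq_nonneg _
  refine ⟨K₀ * 16 + E * (K₂ * 2) + E * K₃ + E * N * K₁, fun ε hε => ?_⟩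
  have hpos : 0 < |Real.log ε| := abs_pos.2 (Real.log_neg hε.1 hε.2).ne
  have hγε := hhom.rate.nonneg ε hε.1.le
  set l := |Real.log ε| with hl
  have hli : 0 < l⁻¹ := inv_pos.2 hpos
  have hεl : 0 < (ε * l)⁻¹ := inv_pos.2 (mul_pos hε.1 hpos)
  have hε0 := hε.1
  set A₁ := ∫ p, h p.1 * h p.2 * (Real.exp (C (p.1 / ε - p.2 / ε)) - 1) ∂(unitVol.prod unitVol)
    with hA₁
  set A₂ := ∫ p, h p.1 * h p.2 * C (p.1 / ε - p.2 / ε) ∂(unitVol.prod unitVol) with hA₂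
  have hscale : ∫ z in (-1 : ℝ)..1, C (z / ε) = ε * ∫ x in (-(1 / ε))..(1 / ε), C x := by
    rw [intervalIntegral.integral_comp_div C hε.1.ne', smul_eq_mul, neg_div]
  have t1 : |(ε * l)⁻¹ * (V ε - E * A₁)| ≤ K₀ * 16 * l⁻¹ := by
    have hS := hV ε hε (2 * (ε * (1 + l)))
      (mul_le_mul_of_nonneg_left (integral_one_add_div_le_of_eq hε.1 hε.2) zero_le_two)
    rw [abs_mul, abs_of_pos hεl]
    calc _ ≤ (ε * l)⁻¹ * (K₀ * (2 * (ε * (1 + l))) ^ 2) :=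
          mul_le_mul_of_nonneg_left hS hεl.le
      _ = K₀ * 4 * (ε * (1 + l) ^ 2) * l⁻¹ := by
          field_simp
          ring
      _ ≤ K₀ * 4 * 4 * l⁻¹ := by
          refine mul_le_mul_of_nonneg_right ?_ hli.le
          exact mul_le_mul_of_nonneg_left (mul_one_add_abs_log_sq_le hε) (by positivity)
      _ = _ := by ring
  have t2 : |(ε * l)⁻¹ * (E * (A₁ - A₂))| ≤ E * (K₂ * 2) * l⁻¹ := by
    have hlin := integral_exp_cov_sub_le hC hM one_pos le_rfl hε.1 hh hB
    have hJ : ∫ z in (0 : ℝ)..1, (1 + z / ε) ^ (-(2 * 1 : ℝ)) ≤ ε := by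
      have := integral_one_add_div_le_of_gt hε.1 (s := 2 * 1) (by norm_num)
      norm_num at this ⊢
      exact this
    rw [abs_mul, abs_mul, abs_of_pos hεl, abs_of_pos hE0]
    calc _ ≤ (ε * l)⁻¹ * (E * (K₂ * (2 * ∫ z in (0 : ℝ)..1, (1 + z / ε) ^ (-(2 * 1 : ℝ))))) := by
          gcongr
      _ ≤ (ε * l)⁻¹ * (E * (K₂ * (2 * ε))) := by gcongr
      _ = _ := by field_simp
  have t3 : |(ε * l)⁻¹ * (E * (A₂ - N * ∫ z in (-1 : ℝ)..1, C (z / ε)))| ≤ E * K₃ * l⁻¹ := by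
    have hlo := leading_order_of_eq hC hM hh hB hL hε.1
    rw [abs_mul, abs_mul, abs_of_pos hεl, abs_of_pos hE0]
    calc _ ≤ (ε * l)⁻¹ * (E * (K₃ * ε)) := by gcongr
      _ = _ := by field_simp
  have t4 : |E * N * (1 / l * (∫ x in (-(1 / ε))..(1 / ε), C x) - Cbar)| ≤
      E * N * K₁ * (l⁻¹ + γ ε) := by
    rw [abs_mul, abs_of_nonneg (by positivity), mul_assoc (E * N)]
    exact mul_le_mul_of_nonneg_left (havg ε hε) (by positivity)
  -- The first three errors are `O(|log ε|⁻¹)`; `γ` is needed only for the last, the logarithmic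
  -- average of `C`.
  have e : (ε * l)⁻¹ * V ε - E * (Cbar * N) = (ε * l)⁻¹ * (V ε - E * A₁)
      + (ε * l)⁻¹ * (E * (A₁ - A₂))
      + (ε * l)⁻¹ * (E * (A₂ - N * ∫ z in (-1 : ℝ)..1, C (z / ε)))
      + E * N * (1 / l * (∫ x in (-(1 / ε))..(1 / ε), C x) - Cbar) := by
    rw [hscale]
    field_simp
    ring
  rw [e]
  refine (abs_add_le _ _).trans ((add_le_add_left (abs_add_le _ _) _).trans ?_)
  refine (add_le_add_left (add_le_add_left (abs_add_le _ _) _) _).trans ?_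
  have g1 : 0 ≤ K₀ * 16 * γ ε := by positivity
  have g2 : 0 ≤ E * (K₂ * 2) * γ ε := by positivity
  have g3 : 0 ≤ E * K₃ * γ ε := by positivity
  linarith

/-! ### Centred data, the limiting quadratic form and the normalisation -/

/-- A centered `C¹` function on the unit interval has a bounded Lipschitz extension. -/
lemma exists_centered_extension {f : ℝ → ℝ} (hf : ContDiffOn ℝ 1 f (Icc 0 1)) :
    ∃ (F : ℝ → ℝ) (B L : ℝ), Continuous F ∧ (∀ x, |F x| ≤ B) ∧
      (∀ x y, |F x - F y| ≤ L * |x - y|) ∧ (∀ x ∈ Icc (0 : ℝ) 1, F x = centered f x) ∧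
      ∫ x, F x ∂unitVol = 0 := by
  obtain ⟨K, hK⟩ := hf.exists_lipschitzOnWith one_ne_zero (convex_Icc 0 1) isCompact_Icc
  -- Precomposing with the nearest-point projection preserves the Lipschitz constant and discards
  -- values outside the unit interval.
  set π : ℝ → ℝ := fun x => (projIcc (0 : ℝ) 1 zero_le_one x : ℝ) with hπ
  have hπm : ∀ x, π x ∈ Icc (0 : ℝ) 1 := fun x => (projIcc (0 : ℝ) 1 zero_le_one x).2
  have hπd : ∀ x y, |π x - π y| ≤ |x - y| := by
    intro x y
    have h := (LipschitzWith.projIcc (zero_le_one (α := ℝ))).dist_le_mul x y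
    rw [NNReal.coe_one, one_mul, Subtype.dist_eq, Real.dist_eq, Real.dist_eq] at h
    exact h
  have hL : ∀ x y, |centered f (π x) - centered f (π y)| ≤ K * |x - y| := by
    intro x y
    have h := hK.dist_le_mul (π x) (hπm x) (π y) (hπm y)
    rw [Real.dist_eq, Real.dist_eq] at h
    simp only [centered, sub_sub_sub_cancel_right]
    exact h.trans (mul_le_mul_of_nonneg_left (hπd x y) K.2)
  have heq : ∀ x ∈ Icc (0 : ℝ) 1, centered f (π x) = centered f x := by
    intro x hx
    simp only [hπ, projIcc_of_mem zero_le_one hx]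
  have hcont : Continuous fun x => centered f (π x) := by
    have : LipschitzWith K fun x => centered f (π x) :=
      LipschitzWith.of_dist_le_mul fun x y => by
        rw [Real.dist_eq, Real.dist_eq]
        exact hL x y
    exact this.continuous
  refine ⟨fun x => centered f (π x), |centered f 0| + K, K, hcont, fun x => ?_, hL, heq, ?_⟩
  · have h0 : (0 : ℝ) ∈ Icc (0 : ℝ) 1 := ⟨le_rfl, zero_le_one⟩
    have h1 := hK.dist_le_mul (π x) (hπm x) 0 h0
    rw [Real.dist_eq, Real.dist_eq, sub_zero, abs_of_nonneg (hπm x).1] at h1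
    have h2 : |centered f (π x) - centered f 0| ≤ K := by
      simp only [centered, sub_sub_sub_cancel_right]
      exact h1.trans (mul_le_of_le_one_right K.2 (hπm x).2)
    have h3 := abs_sub_abs_le_abs_sub (centered f (π x)) (centered f 0)
    linarith
  · have hfi : IntervalIntegrable f volume 0 1 := by
      refine ContinuousOn.intervalIntegrable ?_
      rw [uIcc_of_le zero_le_one]
      exact hf.continuousOn
    rw [integral_unitVol, intervalIntegral.integral_congr (g := centered f)]
    · unfold centered
      rw [intervalIntegral.integral_sub hfi intervalIntegrable_const]
      simp
    · rw [uIcc_of_le zero_le_one]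
      exact heq

/-- The quadratic form for `β < 1` as an integral over the unit square. -/
lemma quadForm_of_lt {β : ℝ} (hβ1 : β < 1) (C₀ Cbar Cplus Cminus : ℝ) {h k : ℝ → ℝ} {B : ℝ}
    (hh : Measurable h) (hB : ∀ x, |h x| ≤ B) (hk : ∀ x ∈ Icc (0 : ℝ) 1, h x = k x) :
    quadForm β C₀ Cbar Cplus Cminus k = Real.exp C₀ *
      ∫ p, h p.1 * ((if p.2 < p.1 then Cplus else Cminus) * |p.1 - p.2| ^ (-β)) * h p.2
        ∂(unitVol.prod unitVol) := by
  rw [quadForm, if_pos hβ1, integral_prod _ (integrable_tailKernel hβ1 Cplus Cminus hh hB)]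
  simp only [← integral_unitVol]
  congr 1
  refine integral_congr_ae (ae_mem_unitVol.mono fun x hx => ?_)
  refine integral_congr_ae (ae_mem_unitVol.mono fun y hy => ?_)
  simp only [hk x (Ioc_subset_Icc_self hx), hk y (Ioc_subset_Icc_self hy)]

lemma quadForm_one (C₀ Cbar Cplus Cminus : ℝ) {h k : ℝ → ℝ}
    (hk : ∀ x ∈ Icc (0 : ℝ) 1, h x = k x) :
    quadForm 1 C₀ Cbar Cplus Cminus k = Real.exp C₀ * (Cbar * ∫ x, h x ^ 2 ∂unitVol) := by
  rw [quadForm, if_neg (lt_irrefl _), ← integral_unitVol]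
  congr 2
  refine integral_congr_ae (ae_mem_unitVol.mono fun x hx => ?_)
  simp only [hk x (Ioc_subset_Icc_self hx)]

lemma sigmaEps_sq_of_lt {Ω : Type*} [MeasurableSpace Ω] (P : Measure Ω) {β ε : ℝ} (hβ1 : β < 1)
    (hε : 0 < ε) (I : Ω → ℝ) : sigmaEps P β ε I ^ 2 = ε ^ (-β) * Var[I; P] := by
  rw [sigmaEps, mul_pow, Real.sq_sqrt (variance_nonneg _ _), piRate, if_pos hβ1, inv_pow,
    ← Real.rpow_natCast, ← Real.rpow_mul hε.le, ← Real.rpow_neg hε.le]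
  congr 3
  push_cast
  ring

lemma sigmaEps_sq_one {Ω : Type*} [MeasurableSpace Ω] (P : Measure Ω) {ε : ℝ}
    (hε : 0 < ε) (I : Ω → ℝ) : sigmaEps P 1 ε I ^ 2 = (ε * |Real.log ε|)⁻¹ * Var[I; P] := by
  rw [sigmaEps, mul_pow, Real.sq_sqrt (variance_nonneg _ _), piRate, if_neg (lt_irrefl _),
    inv_pow, mul_pow, Real.sq_sqrt hε.le, ← Real.sqrt_eq_rpow, Real.sq_sqrt (abs_nonneg _)]

end LogNormalHomog

/-! ### The main theorem -/

theorem mainTheorem6 {Ω : Type*} [MeasurableSpace Ω] (P : Measure Ω) [IsProbabilityMeasure P]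
    (β : ℝ) (hβ0 : 0 < β) (hβ1 : β ≤ 1)
    (G : ℝ → Ω → ℝ) (C : ℝ → ℝ)
    (hG : LogNormalHomog.IsStationaryGaussianField P G C)
    (hG0 : ∃ x, ¬ (G x =ᵐ[P] 0))
    (hCholder : LogNormalHomog.HolderAtZero C)
    (hCdecay : LogNormalHomog.DecaysWithExponent C β)
    (γ : ℝ → ℝ) (Cbar Cplus Cminus : ℝ)
    (hhom : LogNormalHomog.AsymptoticallyHomogeneous β C γ Cbar Cplus Cminus)
    (f g : ℝ → ℝ) (hf : ContDiffOn ℝ 1 f (Icc 0 1)) (hg : ContDiffOn ℝ 1 g (Icc 0 1))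
    (u v : ℝ → Ω → ℝ → ℝ)
    (hu : ∀ ε ∈ Ioo (0 : ℝ) 1, ∀ᵐ ω ∂P,
      LogNormalHomog.IsSolution (fun x => Real.exp (G x ω)) ε f (u ε ω))
    (hv : ∀ ε ∈ Ioo (0 : ℝ) 1, ∀ᵐ ω ∂P,
      LogNormalHomog.IsSolution (fun x => Real.exp (G x ω)) ε g (v ε ω)) :
    (∀ ε ∈ Ioo (0 : ℝ) 1,
      (∀ᵐ ω ∂P, LogNormalHomog.gradAverage (u ε ω) g = LogNormalHomog.gradAverage (v ε ω) f) ∧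
      MemLp (fun ω => LogNormalHomog.gradAverage (u ε ω) g) 2 P) ∧
    ∃ K : ℝ, ∀ ε ∈ Ioo (0 : ℝ) 1,
      |LogNormalHomog.sigmaEps P β ε (fun ω => LogNormalHomog.gradAverage (u ε ω) g) ^ 2
          - LogNormalHomog.sigmaSq β (C 0) Cbar Cplus Cminus f g|
        ≤ K * LogNormalHomog.PiRate β γ ε := by
  open LogNormalHomog in
  have hC0 := hG.cov_zero_pos hG0
  obtain ⟨H, hHm, hHc, hGH, hH⟩ := hG.exists_measurable_version
  obtain ⟨M, hM⟩ := hCdecay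
  have hC := hH.measurable_cov hHm
  obtain ⟨F, B₁, L₁, hF, hFB, hFL, hFf, hF0⟩ := exists_centered_extension hf
  obtain ⟨Γ, B₂, L₂, hΓ, hΓB, hΓL, hΓg, hΓ0⟩ := exists_centered_extension hg
  have hB₁ : 0 ≤ B₁ := (abs_nonneg _).trans (hFB 0)
  have hB₂ : 0 ≤ B₂ := (abs_nonneg _).trans (hΓB 0)
  have hFΓ : ∀ x, |F x * Γ x| ≤ B₁ * B₂ := fun x => by
    rw [abs_mul]
    exact mul_le_mul (hFB x) (hΓB x) (abs_nonneg _) hB₁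
  have hFΓm : Measurable fun x => F x * Γ x := (hF.mul hΓ).measurable
  have hBB := mul_nonneg hB₁ hB₂
  -- A common bound for `F`, `Γ`, `F Γ` and the constant weight `1`.
  set B := 1 + B₁ + B₂ + B₁ * B₂ with hB
  obtain ⟨K₀, hK₀, hvar⟩ := hH.variance_approx hHm hHc hβ0 hβ1 hM hF hΓ hF0 hΓ0
    (B := B) (fun x => (hFB x).trans (by linarith)) (fun x => (hΓB x).trans (by linarith))
    (fun x => (hFΓ x).trans (by linarith)) (by linarith)
  have hfF : ∀ x ∈ Icc (0 : ℝ) 1, f x = F x + ∫ y in (0 : ℝ)..1, f y := fun x hx => by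
    rw [hFf x hx, centered, sub_add_cancel]
  have hgΓ : ∀ x ∈ Icc (0 : ℝ) 1, g x = Γ x + ∫ y in (0 : ℝ)..1, g y := fun x hx => by
    rw [hΓg x hx, centered, sub_add_cancel]
  have hcoef : ∀ᵐ ω ∂P, (fun x => Real.exp (G x ω)) = fun x => Real.exp (H x ω) :=
    hGH.mono fun ω h => funext fun x => by rw [h x]
  have hIu : ∀ ε ∈ Ioo (0 : ℝ) 1, ∀ᵐ ω ∂P, gradAverage (u ε ω) g =
      ∫ x, F x * Γ x * Real.exp (-H (x / ε) ω) ∂unitVol -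
        (∫ x, F x * Real.exp (-H (x / ε) ω) ∂unitVol) *
          (∫ x, Γ x * Real.exp (-H (x / ε) ω) ∂unitVol) /
          ∫ x, Real.exp (-H (x / ε) ω) ∂unitVol := by
    intro ε hε
    filter_upwards [hu ε hε, hcoef] with ω hω hc
    rw [hc] at hω
    exact hω.gradAverage_eq (hHc ω) hf hF hΓ hfF hgΓ
  have hIv : ∀ ε ∈ Ioo (0 : ℝ) 1, ∀ᵐ ω ∂P, gradAverage (v ε ω) f =
      ∫ x, Γ x * F x * Real.exp (-H (x / ε) ω) ∂unitVol -
        (∫ x, Γ x * Real.exp (-H (x / ε) ω) ∂unitVol) *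
          (∫ x, F x * Real.exp (-H (x / ε) ω) ∂unitVol) /
          ∫ x, Real.exp (-H (x / ε) ω) ∂unitVol := by
    intro ε hε
    filter_upwards [hv ε hε, hcoef] with ω hω hc
    rw [hc] at hω
    exact hω.gradAverage_eq (hHc ω) hg hΓ hF hgΓ hfF
  refine ⟨fun ε hε => ⟨?_, (hvar ε hε.1 _ le_rfl _ (hIu ε hε)).1⟩, ?_⟩
  -- The duality is the symmetry of the explicit formula in `F` and `Γ`.
  · filter_upwards [hIu ε hε, hIv ε hε] with ω h1 h2
    rw [h1, h2]
    simp only [mul_comm]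
  have hV : ∀ ε ∈ Ioo (0 : ℝ) 1, ∀ S, 2 * (∫ z in (0 : ℝ)..1, (1 + z / ε) ^ (-β)) ≤ S →
      |(fun ε => Var[fun ω => gradAverage (u ε ω) g; P]) ε - Real.exp (C 0) *
        ∫ p, (fun x => F x * Γ x) p.1 * (fun x => F x * Γ x) p.2 *
          (Real.exp (C (p.1 / ε - p.2 / ε)) - 1) ∂(unitVol.prod unitVol)| ≤ K₀ * S ^ 2 :=
    fun ε hε S hS => (hvar ε hε.1 S hS _ (hIu ε hε)).2
  have hk : ∀ x ∈ Icc (0 : ℝ) 1, F x * Γ x = centered f x * centered g x := fun x hx => by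
    rw [hFf x hx, hΓg x hx]
  rcases hβ1.lt_or_eq with hβ | rfl
  · obtain ⟨K, hK⟩ := variance_rate_of_lt hβ0 hβ hC hC0 hCholder hM hhom hFΓm hFΓ hK₀ hV
    refine ⟨K, fun ε hε => ?_⟩
    rw [sigmaEps_sq_of_lt P hβ hε.1, sigmaSq, quadForm_of_lt hβ _ _ _ _ hFΓm hFΓ hk]
    exact hK ε hε
  -- Lipschitz continuity of `h` is needed for `β = 1` only, where `h` is frozen on the diagonal.
  · have hL : ∀ x y, |F x * Γ x - F y * Γ y| ≤ (B₁ * L₂ + B₂ * L₁) * |x - y| := by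
      intro x y
      have e : F x * Γ x - F y * Γ y = F x * (Γ x - Γ y) + Γ y * (F x - F y) := by ring
      rw [e]
      refine (abs_add_le _ _).trans ?_
      rw [abs_mul, abs_mul]
      have h1 := mul_le_mul (hFB x) (hΓL x y) (abs_nonneg _) hB₁
      have h2 := mul_le_mul (hΓB y) (hFL x y) (abs_nonneg _) hB₂
      linarith
    obtain ⟨K, hK⟩ := variance_rate_of_eq hC hM hhom hFΓm hFΓ hL hK₀ hV
    refine ⟨K, fun ε hε => ?_⟩
    rw [sigmaEps_sq_one P hε.1, sigmaSq, quadForm_one _ _ _ _ hk, PiRate, if_pos rfl]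
    exact hK ε hε
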